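/- Let $\mathbf P\subset\mathbb R^2$ be a simple polygon (a closed region), with vertices $p_0,\dots,p_{n-1}$ listed counterclockwise, no three consecutive vertices being collinear. Let $\theta$ be a direction, given by its angle to the $x$-axis, and assume that no edge of $\mathbf P$ parallel to $\theta$ joins two reflex vertices. A path in $\mathbf P$ is $\theta$-monotone if it meets every line parallel to $\theta$ in a connected (possibly empty) set. Two points of $\mathbf P$ $\theta$-see each other if a $\theta$-monotone path in $\mathbf P$ joins them. A tour $T$ in $\mathbf P$ (a closed curve contained in $\mathbf P$) is a watchman tour under $\theta$-monotone visibility if every point of $\mathbf P$ is $\theta$-seen from some point of $T$. Let $v$ be a reflex vertex whose two incident edges both lie strictly on the same side of the line through $v$ parallel to $\theta$ (apart from $v$ itself), and let $s$ be the maximal segment of that line inside $\mathbf P$ passing through $v$. Let $\mathbf P_{\mathsf R}$ be the connected component of $\mathbf P\setminus s$ that the counterclockwise boundary traversal starting at $v$ enters first, and $\mathbf P_{\mathsf L}$ the one from which it returns to $v$. The forward $\theta$-cut at $v$ is the portion $s\cap\overline{\mathbf P_{\mathsf R}}$ of $s$ bounding $\mathbf P_{\mathsf R}$, directed away from $v$;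 the backward $\theta$-cut at $v$ is the portion $s\cap\overline{\mathbf P_{\mathsf L}}$ of $s$ bounding $\mathbf P_{\mathsf L}$, directed towards $v$. For a $\theta$-cut $c$, let $\mathbf L(c)$ be the closed part of $\mathbf P$ to the left of $c$: the union of $c$ and of all connected components of $\mathbf P\setminus c$ that lie locally to the left of $c$ according to its direction. Then a tour $T$ in $\mathbf P$ is a watchman tour under $\theta$-monotone visibility if and only if $T$ intersects $\mathbf L(c)$ for every forward and every backward $\theta$-cut $c$ of $\mathbf P$. -/

import Mathlib

open Set Filter Topology

noncomputable section

namespace WatchmanTour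

/-- The Euclidean plane. -/
abbrev Plane : Type := EuclideanSpace ℝ (Fin 2)

/-- The unit vector with angle `θ` to the `x`-axis. -/
def dir (θ : ℝ) : Plane := !₂[Real.cos θ, Real.sin θ]

/-- The planar cross product: positive iff `w` points to the left of `u`,
negative iff `w` points to the right of `u`. -/
def cross (u w : Plane) : ℝ := u 0 * w 1 - u 1 * w 0

/-- The vector `u` turned by 90 degrees counterclockwise. -/
def leftNormal (u : Plane) : Plane := !₂[-u 1, u 0]

/-- The line with direction `θ` through `v`. -/
def lineThrough (θ : ℝ) (v : Plane) : Set Plane := {x | ∃ t : ℝ, x = v + t • dir θ}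

variable {n : ℕ} [NeZero n]

/-- The polygon with vertices `p 0, …, p (n - 1)` is simple: consecutive edges are not collinear
and meet only in their common vertex, and all other pairs of edges are disjoint.
(Edge `i` joins `p i` to `p (i + 1)`, with indices modulo `n`.) -/
structure IsSimple (p : Polygon Plane n) : Prop where
  corners : p.HasNondegenerateVertices ℝ
  consecutive : ∀ i : Fin n, p.edgeSet ℝ i ∩ p.edgeSet ℝ (i + 1) = {p (i + 1)}
  disjoint : ∀ i j : Fin n, i ≠ j → j ≠ i + 1 → i ≠ j + 1 →
    Disjoint (p.edgeSet ℝ i) (p.edgeSet ℝ j)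

/-- The open region enclosed by the boundary: the bounded part of its complement. -/
def inside (p : Polygon Plane n) : Set Plane :=
  {x | x ∉ p.boundary ℝ ∧ Bornology.IsBounded (connectedComponentIn (p.boundary ℝ)ᶜ x)}

/-- The polygon as a closed region: its boundary together with what the boundary encloses. -/
def region (p : Polygon Plane n) : Set Plane := p.boundary ℝ ∪ inside p

/-- The vertices are listed counterclockwise: traversing an edge from `p i` to `p (i + 1)`,
the inside of the polygon lies locally to the left. -/
def IsCounterclockwise (p : Polygon Plane n) : Prop :=
  ∀ i : Fin n, ∀ x ∈ openSegment ℝ (p i) (p (i + 1)),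
    ∀ᶠ ε : ℝ in 𝓝[>] 0, x + ε • leftNormal (p (i + 1) - p i) ∈ inside p

/-- A path in the polygon is `θ`-monotone if it meets every line of direction `θ`
in a connected (possibly empty) set. -/
def IsThetaMonotone (θ : ℝ) {x y : Plane} (γ : Path x y) : Prop :=
  ∀ a : Plane, IsPreconnected (Set.range γ ∩ lineThrough θ a)

/-- `x` and `y` see each other under `θ`-monotone visibility in the polygon. -/
def ThetaSees (p : Polygon Plane n) (θ : ℝ) (x y : Plane) : Prop :=
  ∃ γ : Path x y, Set.range γ ⊆ region p ∧ IsThetaMonotone θ γ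

/-- The closed curve `T` sees the whole polygon under `θ`-monotone visibility. -/
def IsThetaWatchman (p : Polygon Plane n) (θ : ℝ) {x₀ : Plane} (T : Path x₀ x₀) : Prop :=
  ∀ y ∈ region p, ∃ x ∈ Set.range T, ThetaSees p θ x y

/-- For a polygon listed counterclockwise: the interior angle at vertex `i` exceeds 180 degrees,
that is, the boundary turns right there. -/
def IsReflex (p : Polygon Plane n) (i : Fin n) : Prop :=
  cross (p i - p (i - 1)) (p (i + 1) - p i) < 0

/-- Both edges at vertex `i` lie (locally) to the right of the directed line
with angle `θ` through that vertex. -/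
def EdgesRight (p : Polygon Plane n) (θ : ℝ) (i : Fin n) : Prop :=
  cross (dir θ) (p (i - 1) - p i) < 0 ∧ cross (dir θ) (p (i + 1) - p i) < 0

/-- Both edges at vertex `i` lie (locally) to the left of the directed line
with angle `θ` through that vertex. -/
def EdgesLeft (p : Polygon Plane n) (θ : ℝ) (i : Fin n) : Prop :=
  0 < cross (dir θ) (p (i - 1) - p i) ∧ 0 < cross (dir θ) (p (i + 1) - p i)

/-- The vertices that issue `θ`-cuts: reflex vertices (red or blue) whose two incident edges lie
on the same side of the line of direction `θ` through the vertex. -/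
def IsColored (p : Polygon Plane n) (θ : ℝ) (i : Fin n) : Prop :=
  IsReflex p i ∧ (EdgesRight p θ i ∨ EdgesLeft p θ i)

/-- The maximal segment of direction `θ` inside the polygon that passes through vertex `i`. -/
def chord (p : Polygon Plane n) (θ : ℝ) (i : Fin n) : Set Plane :=
  connectedComponentIn (region p ∩ lineThrough θ (p i)) (p i)

/-- The part of the polygon, cut along the chord through a colored vertex `i`, that the
counterclockwise traversal of the boundary starting at vertex `i` enters first. (The edge from
`p i` to `p (i + 1)` leaves the line of the chord at `p i`, so this is the part
that contains `p (i + 1)`.) -/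
def partR (p : Polygon Plane n) (θ : ℝ) (i : Fin n) : Set Plane :=
  connectedComponentIn (region p \ chord p θ i) (p (i + 1))

/-- The part of the polygon, cut along the chord through a colored vertex `i`, through which the
counterclockwise traversal of the boundary returns to vertex `i`. -/
def partL (p : Polygon Plane n) (θ : ℝ) (i : Fin n) : Set Plane :=
  connectedComponentIn (region p \ chord p θ i) (p (i - 1))

/-- The segment directed from `a` to `b` is a forward `θ`-cut: for a colored vertex, it is the
portion of the chord that bounds `partR`, directed away from the vertex. -/
def IsForwardCut (p : Polygon Plane n) (θ : ℝ) (a b : Plane) : Prop :=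
  ∃ i : Fin n, IsColored p θ i ∧ a = p i ∧
    segment ℝ a b = chord p θ i ∩ closure (partR p θ i)

/-- The segment directed from `a` to `b` is a backward `θ`-cut: for a colored vertex, it is the
portion of the chord that bounds `partL`, directed towards the vertex. -/
def IsBackwardCut (p : Polygon Plane n) (θ : ℝ) (a b : Plane) : Prop :=
  ∃ i : Fin n, IsColored p θ i ∧ b = p i ∧
    segment ℝ a b = chord p θ i ∩ closure (partL p θ i)

/-- The segment directed from `a` to `b` is a `θ`-cut. -/
def IsThetaCut (p : Polygon Plane n) (θ : ℝ) (a b : Plane) : Prop :=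
  IsForwardCut p θ a b ∨ IsBackwardCut p θ a b

/-- The closed region to the left of the cut directed from `a` to `b`: the cut itself and every
point whose component in the polygon without the cut lies locally to the left of the cut,
that is, contains all points `x + ε • leftNormal (b - a)` with `ε > 0` small, for some `x`
in the relative interior of the cut. -/
def leftRegion (p : Polygon Plane n) (a b : Plane) : Set Plane :=
  segment ℝ a b ∪ {z | z ∈ region p \ segment ℝ a b ∧ ∃ x ∈ openSegment ℝ a b,
    ∀ᶠ ε : ℝ in 𝓝[>] 0,
      x + ε • leftNormal (b - a) ∈ connectedComponentIn (region p \ segment ℝ a b) z}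

end WatchmanTour

end

set_option linter.unusedSectionVars false

namespace WatchmanTour

/-! ### Planar algebra -/

/-! Let `d` be one of `±dir θ` and call `cross d z` the level of `z`; the lines parallel to θ are
the level sets. At a vertex that issues cuts, choose the sign of `d` so that both edges climb. Each
of the two edges borders a pocket: the component, in the polygon without the corresponding cut, of
the far endpoint of that edge. `IsCut.leftRegion_eq` identifies the closed left region of a cut with
the complement of its pocket in the polygon. The claim becomes: a tour sees everything iff it is
contained in no pocket.

Necessity (`IsCut.false_of_monotone`). In a slab just above the vertex that contains no vertices,
the components of the polygon ("cells") are convex, and the cells `K`, `K'` along the two edges are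
different because the vertex is reflex. A path from the pocket behind `K` to a point of `K'` has to
cross the section of `K` at some level `x`, and also the section of `K'` at the same level. If its
intersection with that line were connected, it would join `K` to `K'` inside the slab. Hence the
points of `K'` are not seen from the pocket.

Sufficiency (`IsSimple.isThetaWatchman`). Fix `y` and let `V` be the set of ends of monotone paths
from `y`. Every point of the polygon lies in `V` or in a pocket whose cut is contained in `V`
(`IsSimple.visible_or_inPocket_of_mem`). This property spreads along segments. The essential case
has two paths climbing from a common origin, one to `y` and one to `z`; ascend both while points of
equal level can be joined by a level segment in the polygon (`IsSimple.climbs_or_inPocket`). If the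
ascent reaches an end, `y` and `z` see each other. If it gets stuck, a reflex vertex with both edges
pointing up lies on the last level segment (`IsSimple.exists_obstacle`); here edges parallel to θ
between reflex vertices must be excluded. Then `z` lies in a pocket at this vertex, and its cut is
visible from `y`. Finally, a tour that starts in such a pocket but visits the left region of its cut
must meet the cut, hence `V`.

The topology is obtained directly. A union of components of the complement of the boundary that
touches one edge from one side touches all edges from that side (`IsSimple.edgeGerm_all`), so the
inside is connected and the polygon has its expected shape near each boundary point. Separation by a
chord comes from comparing two branches of the argument of `(z - a) / (z - b)`
(`exists_separating_function`). -/

lemma cross_add_right (u v w : Plane) : cross u (v + w) = cross u v + cross u w := by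
  simp only [cross, PiLp.add_apply]; ring

lemma cross_sub_right (u v w : Plane) : cross u (v - w) = cross u v - cross u w := by
  simp only [cross, PiLp.sub_apply]; ring

lemma cross_smul_right (u v : Plane) (t : ℝ) : cross u (t • v) = t * cross u v := by
  simp only [cross, PiLp.smul_apply, smul_eq_mul]; ring

lemma cross_neg_right (u v : Plane) : cross u (-v) = -cross u v := by
  simp only [cross, PiLp.neg_apply]; ring

lemma cross_swap (u v : Plane) : cross u v = -cross v u := by
  simp only [cross]; ring

lemma cross_neg_left (u v : Plane) : cross (-u) v = -cross u v := by
  simp only [cross, PiLp.neg_apply]; ring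

lemma cross_smul_left (u v : Plane) (t : ℝ) : cross (t • u) v = t * cross u v := by
  simp only [cross, PiLp.smul_apply, smul_eq_mul]; ring

lemma cross_self (u : Plane) : cross u u = 0 := by
  simp only [cross]; ring

lemma cross_zero_right (u : Plane) : cross u 0 = 0 := by
  simp [cross]

lemma cross_leftNormal (u : Plane) : cross u (leftNormal u) = u 0 ^ 2 + u 1 ^ 2 := by
  simp [cross, leftNormal]; ring

@[fun_prop]
lemma continuous_cross (u : Plane) : Continuous (cross u) := by
  unfold cross; fun_prop

lemma sq_add_sq_pos {u : Plane} (hu : u ≠ 0) : 0 < u 0 ^ 2 + u 1 ^ 2 := by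
  by_contra h
  apply hu
  ext j
  fin_cases j
  · simp only [Fin.zero_eta, PiLp.zero_apply]; nlinarith [sq_nonneg (u 0), sq_nonneg (u 1)]
  · simp only [Fin.mk_one, PiLp.zero_apply]; nlinarith [sq_nonneg (u 0), sq_nonneg (u 1)]

/-- A vector in terms of a basis of the plane (Cramer's rule). -/
lemma eq_basis {a b : Plane} (h : cross a b ≠ 0) (w : Plane) :
    w = (cross w b / cross a b) • a + (cross a w / cross a b) • b := by
  have h' : a 0 * b 1 - a 1 * b 0 ≠ 0 := h
  ext j
  fin_cases j
  · simp only [cross, Fin.zero_eta, PiLp.add_apply, PiLp.smul_apply, smul_eq_mul]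
    rw [div_mul_eq_mul_div, div_mul_eq_mul_div, ← add_div, eq_div_iff h']; ring
  · simp only [cross, Fin.mk_one, PiLp.add_apply, PiLp.smul_apply, smul_eq_mul]
    rw [div_mul_eq_mul_div, div_mul_eq_mul_div, ← add_div, eq_div_iff h']; ring

lemma exists_smul_of_cross_eq_zero {u w : Plane} (hu : u ≠ 0) (h : cross u w = 0) :
    ∃ t : ℝ, w = t • u := by
  have hp := sq_add_sq_pos hu
  have h' : u 0 * w 1 - u 1 * w 0 = 0 := h
  refine ⟨(u 0 * w 0 + u 1 * w 1) / (u 0 ^ 2 + u 1 ^ 2), ?_⟩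
  ext j
  fin_cases j
  · simp only [Fin.zero_eta, PiLp.smul_apply, smul_eq_mul]
    field_simp; linear_combination -u 1 * h'
  · simp only [Fin.mk_one, PiLp.smul_apply, smul_eq_mul]
    field_simp; linear_combination u 0 * h'

lemma mem_segment_iff_exists {a b z : Plane} :
    z ∈ segment ℝ a b ↔ ∃ t : ℝ, 0 ≤ t ∧ t ≤ 1 ∧ z = a + t • (b - a) := by
  rw [segment_eq_image']
  constructor
  · rintro ⟨t, ⟨h0, h1⟩, rfl⟩; exact ⟨t, h0, h1, rfl⟩
  · rintro ⟨t, h0, h1, rfl⟩; exact ⟨t, ⟨h0, h1⟩, rfl⟩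

lemma mem_openSegment_iff_exists {a b z : Plane} :
    z ∈ openSegment ℝ a b ↔ ∃ t : ℝ, 0 < t ∧ t < 1 ∧ z = a + t • (b - a) := by
  rw [openSegment_eq_image']
  constructor
  · rintro ⟨t, ⟨h0, h1⟩, rfl⟩; exact ⟨t, h0, h1, rfl⟩
  · rintro ⟨t, h0, h1, rfl⟩; exact ⟨t, ⟨h0, h1⟩, rfl⟩

lemma isPreconnected_segment (a b : Plane) : IsPreconnected (segment ℝ a b) :=
  (convex_segment a b).isPreconnected

lemma isCompact_segment (a b : Plane) : IsCompact (segment ℝ a b) := by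
  rw [segment_eq_image']
  exact isCompact_Icc.image (by fun_prop)

lemma isClosed_segment (a b : Plane) : IsClosed (segment ℝ a b) := (isCompact_segment a b).isClosed

/-- A locally constant predicate on a preconnected set is constant. -/
lemma iff_of_isPreconnected {α : Type*} [TopologicalSpace α] {s : Set α} (hs : IsPreconnected s)
    (Q : α → Prop) (h : ∀ x ∈ s, ∀ᶠ y in 𝓝 x, y ∈ s → (Q x ↔ Q y)) {x y : α} (hx : x ∈ s)
    (hy : y ∈ s) : Q x ↔ Q y :=
  hs.induction₂ (fun x y => Q x ↔ Q y) (fun x hx => eventually_nhdsWithin_iff.2 (h x hx))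
    (fun _ _ _ _ _ _ h1 h2 => h1.trans h2) (fun _ _ _ _ h => h.symm) hx hy

lemma convex_cross_pos (u : Plane) (c : ℝ) : Convex ℝ {z : Plane | c < cross u z} := by
  intro x hx y hy a b ha hb hab
  simp only [mem_ofPred_eq, cross_add_right, cross_smul_right] at *
  rcases ha.eq_or_lt with rfl | ha
  · have : b = 1 := by linarith
    subst this; simpa using hy
  · have h1 : a * c < a * cross u x := by nlinarith
    have h2 : b * c ≤ b * cross u y := by nlinarith
    have : c = a * c + b * c := by rw [← add_mul, hab, one_mul]
    linarith

lemma convex_cross_neg (u : Plane) (c : ℝ) : Convex ℝ {z : Plane | cross u z < c} := by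
  have := convex_cross_pos (-u) (-c)
  simpa only [cross_neg_left, neg_lt_neg_iff] using this

lemma convex_cross_nonneg (u : Plane) (c : ℝ) : Convex ℝ {z : Plane | c ≤ cross u z} := by
  intro x hx y hy a b ha hb hab
  simp only [mem_ofPred_eq, cross_add_right, cross_smul_right] at *
  have h1 : a * c ≤ a * cross u x := by nlinarith
  have h2 : b * c ≤ b * cross u y := by nlinarith
  have : c = a * c + b * c := by rw [← add_mul, hab, one_mul]
  linarith

/-! ### Indices and edges -/

variable {n : ℕ} [NeZero n]

lemma edgeSet_eq (p : Polygon Plane n) (i : Fin n) :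
    p.edgeSet ℝ i = segment ℝ (p i) (p (i + 1)) := by
  rw [Polygon.edgeSet, finRotate_apply, affineSegment_eq_segment]

/-- Induction around the cycle: every index is `j` plus a natural number. -/
lemma forall_of_step {Q : Fin n → Prop} (h : ∀ i, Q i → Q (i + 1)) {j : Fin n} (hj : Q j)
    (i : Fin n) : Q i := by
  have key : ∀ m : ℕ, Q (j + Fin.ofNat n m) := by
    intro m
    induction m with
    | zero => simpa using hj
    | succ m ih =>
      have := h _ ih
      convert this using 1
      rw [add_assoc]
      congr 1
      ext
      simp [Fin.add_def, Fin.ofNat]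
  have := key (i - j).val
  simpa using this

/-- The signed distance (up to a positive factor) to the line through edge `k`, positive to the
left of the edge. -/
noncomputable def side (p : Polygon Plane n) (k : Fin n) (z : Plane) : ℝ :=
  cross (p (k + 1) - p k) (z - p k)

@[fun_prop]
lemma continuous_side (p : Polygon Plane n) (k : Fin n) : Continuous (side p k) := by
  unfold side; fun_prop

lemma side_eq (p : Polygon Plane n) (k : Fin n) (z w : Plane) :
    side p k z = side p k w + cross (p (k + 1) - p k) (z - w) := by
  simp only [side, cross_sub_right]; ring

lemma side_eq_sub (p : Polygon Plane n) (k : Fin n) (z : Plane) :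
    side p k z = cross (p (k + 1) - p k) z - cross (p (k + 1) - p k) (p k) := by
  simp only [side, cross_sub_right]

lemma convex_side_pos (p : Polygon Plane n) (k : Fin n) : Convex ℝ {z | 0 < side p k z} := by
  simp only [side_eq_sub, sub_pos]; exact convex_cross_pos _ _

lemma convex_side_neg (p : Polygon Plane n) (k : Fin n) : Convex ℝ {z | side p k z < 0} := by
  simp only [side_eq_sub, sub_neg]; exact convex_cross_neg _ _

lemma convex_side_nonneg (p : Polygon Plane n) (k : Fin n) : Convex ℝ {z | 0 ≤ side p k z} := by
  simp only [side_eq_sub, sub_nonneg]; exact convex_cross_nonneg _ _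

lemma side_segment (p : Polygon Plane n) (k : Fin n) (a b : Plane) (t : ℝ) :
    side p k (a + t • (b - a)) = side p k a + t * (side p k b - side p k a) := by
  rw [side_eq p k _ a, side_eq p k b a, add_sub_cancel_left, cross_smul_right]; ring

lemma side_self (p : Polygon Plane n) (k : Fin n) : side p k (p k) = 0 := by
  simp [side, cross_zero_right]

lemma side_succ (p : Polygon Plane n) (k : Fin n) : side p k (p (k + 1)) = 0 := by
  simp [side, cross_self]

lemma side_of_mem_edge {p : Polygon Plane n} {k : Fin n} {z : Plane}
    (hz : z ∈ segment ℝ (p k) (p (k + 1))) : side p k z = 0 := by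
  obtain ⟨t, -, -, rfl⟩ := mem_segment_iff_exists.1 hz
  rw [side_segment, side_self, side_succ]; simp

variable {p : Polygon Plane n}

/-! ### The boundary of a simple polygon near its points -/

lemma mem_boundary_iff {z : Plane} :
    z ∈ p.boundary ℝ ↔ ∃ k, z ∈ segment ℝ (p k) (p (k + 1)) := by
  simp [Polygon.boundary, edgeSet_eq]

lemma isCompact_boundary (p : Polygon Plane n) : IsCompact (p.boundary ℝ) := by
  simp only [Polygon.boundary, edgeSet_eq]
  exact isCompact_iUnion fun i => isCompact_segment _ _

/-- Twice the signed area of the triangle formed by vertex `i` and its neighbours. -/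
noncomputable def turn (p : Polygon Plane n) (i : Fin n) : ℝ :=
  cross (p i - p (i - 1)) (p (i + 1) - p i)

lemma IsSimple.turn_ne_zero (h : IsSimple p) (i : Fin n) : turn p i ≠ 0 := by
  intro h0
  have hc := h.corners (i - 1)
  -- `corners (i - 1)` speaks of `i - 1`, `i - 1 + 1` and `i - 1 + 2`, that is, of `i` and its two
  -- neighbours.
  have h2 : i - 1 + 2 = i + 1 := by
    have : (2 : Fin n) = 1 + 1 := by ext; simp [Fin.add_def]
    rw [this, ← add_assoc, sub_add_cancel]
  rw [sub_add_cancel, h2, affineIndependent_iff_not_collinear_set] at hc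
  have hne : p i - p (i - 1) ≠ 0 := by
    intro h1
    rw [sub_eq_zero] at h1
    apply hc
    rw [h1]
    simpa using collinear_pair ℝ (p (i - 1)) (p (i + 1))
  obtain ⟨t, ht⟩ := exists_smul_of_cross_eq_zero hne h0
  apply hc
  rw [collinear_iff_of_mem (p₀ := p i) (by simp)]
  refine ⟨p i - p (i - 1), ?_⟩
  intro q hq
  simp only [mem_insert_iff, mem_singleton_iff] at hq
  rcases hq with rfl | rfl | rfl
  · exact ⟨-1, by simp⟩
  · exact ⟨0, by simp⟩
  · exact ⟨t, by rw [← ht]; simp⟩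

lemma IsSimple.vertex_ne (h : IsSimple p) (i : Fin n) : p i ≠ p (i + 1) := by
  intro h0
  apply h.turn_ne_zero i
  simp [turn, ← h0, cross_zero_right]

lemma IsSimple.edge_ne_zero (h : IsSimple p) (i : Fin n) : p (i + 1) - p i ≠ 0 :=
  sub_ne_zero.2 (h.vertex_ne i).symm

lemma IsSimple.eq_of_mem_openSegment (h : IsSimple p) {k j : Fin n} {u : Plane}
    (hu : u ∈ openSegment ℝ (p k) (p (k + 1))) (hj : u ∈ segment ℝ (p j) (p (j + 1))) :
    j = k := by
  by_contra hne
  have hk := openSegment_subset_segment ℝ _ _ hu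
  have hends : u ≠ p k ∧ u ≠ p (k + 1) := by
    obtain ⟨t, h0, h1, rfl⟩ := mem_openSegment_iff_exists.1 hu
    constructor
    · intro h'
      rw [add_eq_left, smul_eq_zero] at h'
      exact h'.elim h0.ne' (h.edge_ne_zero k)
    · intro h'
      have : (1 - t) • (p (k + 1) - p k) = 0 := by
        rw [sub_smul, one_smul, sub_eq_zero]
        nth_rewrite 1 [← h']
        simp
      rw [smul_eq_zero] at this
      exact this.elim (fun h3 => by linarith) (h.edge_ne_zero k)
  rw [← edgeSet_eq] at hj hk
  by_cases h1 : j = k + 1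
  · subst h1
    have := mem_inter hk hj
    rw [h.consecutive] at this
    exact hends.2 this
  by_cases h2 : k = j + 1
  · subst h2
    have := mem_inter hj hk
    rw [h.consecutive] at this
    exact hends.1 this
  exact (h.disjoint j k hne h2 h1).le_bot ⟨hj, hk⟩

lemma IsSimple.eq_of_vertex_mem (h : IsSimple p) {i j : Fin n}
    (hj : p i ∈ segment ℝ (p j) (p (j + 1))) : j = i ∨ j = i - 1 := by
  by_contra! hne
  have hi : p i ∈ p.edgeSet ℝ i := by rw [edgeSet_eq]; exact left_mem_segment _ _ _
  rw [← edgeSet_eq] at hj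
  by_cases h1 : j = i + 1
  · subst h1
    have := mem_inter hi hj
    rw [h.consecutive] at this
    exact h.vertex_ne i this
  by_cases h2 : i = j + 1
  · exact hne.2 (by rw [h2]; simp)
  exact (h.disjoint j i hne.1 h2 h1).le_bot ⟨hj, hi⟩

lemma eventually_not_mem_edge (p : Polygon Plane n) (u : Plane) :
    ∀ᶠ z in 𝓝 u, ∀ j, u ∉ segment ℝ (p j) (p (j + 1)) → z ∉ segment ℝ (p j) (p (j + 1)) := by
  rw [eventually_all]
  intro j
  by_cases hj : u ∈ segment ℝ (p j) (p (j + 1))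
  · exact Eventually.of_forall fun z h => (h hj).elim
  · filter_upwards [(isClosed_segment _ _).isOpen_compl.mem_nhds hj] with z hz _ using hz

lemma IsSimple.eventually_mem_boundary_iff_of_openSegment (h : IsSimple p) {k : Fin n} {u : Plane}
    (hu : u ∈ openSegment ℝ (p k) (p (k + 1))) :
    ∀ᶠ z in 𝓝 u, z ∈ p.boundary ℝ ↔ side p k z = 0 := by
  set e := p (k + 1) - p k with he
  have hpos := sq_add_sq_pos (h.edge_ne_zero k)
  rw [← he] at hpos
  -- Parameter of the orthogonal projection to the line of the edge: `0` at `p k` and `1` at `p (k +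
  -- 1)`.
  let φ : Plane → ℝ := fun z => (e 0 * (z - p k) 0 + e 1 * (z - p k) 1) / (e 0 ^ 2 + e 1 ^ 2)
  have hφ : Continuous φ := by
    simp only [φ]; fun_prop
  have hφt : ∀ t : ℝ, φ (p k + t • e) = t := by
    intro t
    simp only [φ, add_sub_cancel_left, PiLp.smul_apply, smul_eq_mul]
    field_simp
  obtain ⟨t, h0, h1, hut⟩ := mem_openSegment_iff_exists.1 hu
  have hu0 : φ u = t := by rw [hut, hφt]
  have hev : ∀ᶠ z in 𝓝 u, φ z ∈ Ioo (0 : ℝ) 1 :=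
    hφ.continuousAt.eventually_mem (isOpen_Ioo.mem_nhds (by rw [hu0]; exact ⟨h0, h1⟩))
  filter_upwards [hev, eventually_not_mem_edge p u] with z hz hzj
  constructor
  · intro hb
    obtain ⟨j, hj⟩ := mem_boundary_iff.1 hb
    have hjk : j = k := by
      by_contra hne
      exact hzj j (fun h' => hne (h.eq_of_mem_openSegment hu h')) hj
    subst hjk
    exact side_of_mem_edge hj
  · intro hs
    obtain ⟨s, hs⟩ := exists_smul_of_cross_eq_zero (h.edge_ne_zero k) hs
    have hzs : z = p k + s • e := by rw [he, ← hs]; simp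
    rw [hzs, hφt] at hz
    exact mem_boundary_iff.2 ⟨k, mem_segment_iff_exists.2 ⟨s, hz.1.le, hz.2.le, hzs⟩⟩

lemma side_sub_one (p : Polygon Plane n) (i : Fin n) (z : Plane) :
    side p (i - 1) z = cross (p i - p (i - 1)) (z - p i) := by
  rw [side_eq p (i - 1) z (p i)]
  have := side_succ p (i - 1)
  simp only [sub_add_cancel] at this ⊢
  rw [this, zero_add]

lemma side_sub_one_succ (p : Polygon Plane n) (i : Fin n) :
    side p (i - 1) (p (i + 1)) = turn p i := by
  rw [side_sub_one, turn]

lemma side_pred (p : Polygon Plane n) (i : Fin n) : side p i (p (i - 1)) = turn p i := by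
  simp only [side, turn, cross]
  simp only [PiLp.sub_apply]; ring

lemma side_sub_one_self (p : Polygon Plane n) (i : Fin n) : side p (i - 1) (p i) = 0 := by
  rw [side_sub_one, sub_self, cross_zero_right]

/-- Coordinates with respect to the two edges at a vertex. -/
lemma IsSimple.sub_vertex_eq (h : IsSimple p) (i : Fin n) (z : Plane) :
    z - p i = (side p i z / turn p i) • (p (i - 1) - p i)
      + (side p (i - 1) z / turn p i) • (p (i + 1) - p i) := by
  have ht := h.turn_ne_zero i
  have hc : cross (p (i - 1) - p i) (p (i + 1) - p i) = -turn p i := by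
    rw [turn, ← cross_neg_left, neg_sub]
  have := eq_basis (a := p (i - 1) - p i) (b := p (i + 1) - p i) (by rw [hc]; simpa) (z - p i)
  rw [hc, cross_swap (z - p i), ← neg_sub (p i) (p (i - 1)), cross_neg_left, ← side_sub_one,
    neg_div_neg_eq, neg_div_neg_eq, neg_sub] at this
  exact this

/-- Near a vertex only its two edges matter, and they look like rays: in the coordinates of
`sub_vertex_eq`, one coordinate vanishes and the other is nonnegative. Multiplying by `turn p i`
instead of dividing treats convex and reflex vertices alike. -/
lemma IsSimple.eventually_mem_boundary_iff_vertex (h : IsSimple p) (i : Fin n) :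
    ∀ᶠ z in 𝓝 (p i), z ∈ p.boundary ℝ ↔
      (side p i z = 0 ∧ 0 ≤ side p (i - 1) z * turn p i) ∨
      (side p (i - 1) z = 0 ∧ 0 ≤ side p i z * turn p i) := by
  have ht := h.turn_ne_zero i
  -- Coordinates below `1` keep the points of the rays from passing the far ends of the edges.
  have hsm : ∀ k, side p k (p i) = 0 → ∀ᶠ z in 𝓝 (p i), side p k z / turn p i < 1 := by
    intro k hk
    have hc : Continuous fun z => side p k z / turn p i := by fun_prop
    exact hc.continuousAt.eventually_lt continuousAt_const (by simp [hk])
  filter_upwards [eventually_not_mem_edge p (p i), hsm i (side_self p i),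
    hsm (i - 1) (side_sub_one_self p i)] with z hz h1 h2
  have hdiv : ∀ x : ℝ, 0 ≤ x * turn p i → 0 ≤ x / turn p i := by
    intro x hx
    have : x / turn p i = x * turn p i / (turn p i) ^ 2 := by field_simp
    rw [this]; positivity
  constructor
  · intro hb
    obtain ⟨j, hj⟩ := mem_boundary_iff.1 hb
    have hji : j = i ∨ j = i - 1 := by
      by_contra hne
      exact hz j (fun h' => hne (h.eq_of_vertex_mem h')) hj
    rcases hji with rfl | rfl
    · left
      refine ⟨side_of_mem_edge hj, ?_⟩
      obtain ⟨t, h0, -, rfl⟩ := mem_segment_iff_exists.1 hj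
      rw [side_segment, side_sub_one_self, side_sub_one_succ]
      have := mul_nonneg h0 (mul_self_nonneg (turn p j))
      linarith
    · right
      refine ⟨side_of_mem_edge hj, ?_⟩
      rw [sub_add_cancel, segment_symm] at hj
      obtain ⟨t, h0, -, rfl⟩ := mem_segment_iff_exists.1 hj
      rw [side_segment, side_self, side_pred]
      have := mul_nonneg h0 (mul_self_nonneg (turn p i))
      linarith
  · have hzb := h.sub_vertex_eq i z
    rintro (⟨h3, h4⟩ | ⟨h3, h4⟩)
    · rw [h3, zero_div, zero_smul, zero_add] at hzb
      exact mem_boundary_iff.2 ⟨i, mem_segment_iff_exists.2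
        ⟨_, hdiv _ h4, h2.le, by rw [← hzb]; simp⟩⟩
    · rw [h3, zero_div, zero_smul, add_zero] at hzb
      refine mem_boundary_iff.2 ⟨i - 1, ?_⟩
      rw [sub_add_cancel, segment_symm]
      exact mem_segment_iff_exists.2 ⟨_, hdiv _ h4, h1.le, by rw [← hzb]; simp⟩

/-! ### Germs of complementary sets at the two sides of the edges -/

/-- `U` is a union of connected components of the complement of the boundary. -/
structure IsSaturated (p : Polygon Plane n) (U : Set Plane) : Prop where
  subset : U ⊆ (p.boundary ℝ)ᶜ
  saturated : ∀ C : Set Plane, IsPreconnected C → C ⊆ (p.boundary ℝ)ᶜ → (C ∩ U).Nonempty → C ⊆ U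

/-- Near `u`, the set `U` contains the side of edge `k` with sign `κ`. -/
def HasGerm (p : Polygon Plane n) (κ : ℝ) (U : Set Plane) (k : Fin n) (u : Plane) : Prop :=
  ∀ᶠ z in 𝓝 u, 0 < κ * side p k z → z ∈ U

lemma mul_pos_iff_of_neg_left' {a b : ℝ} (h : a < 0) : 0 < a * b ↔ b < 0 := by
  constructor <;> intro <;> nlinarith

lemma convex_mul_side_pos {κ : ℝ} (hκ : κ ≠ 0) (p : Polygon Plane n) (k : Fin n) :
    Convex ℝ {z | 0 < κ * side p k z} := by
  rcases hκ.lt_or_gt with h | h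
  · simpa only [mul_pos_iff_of_neg_left' h] using convex_side_neg p k
  · simpa only [mul_pos_iff_of_pos_left h] using convex_side_pos p k

lemma IsSimple.frequently_side (h : IsSimple p) {κ : ℝ} (hκ : κ ≠ 0) {k : Fin n} {u : Plane}
    (hu : side p k u = 0) : ∃ᶠ z in 𝓝 u, 0 < κ * side p k z := by
  set e := p (k + 1) - p k with he
  have hpos := sq_add_sq_pos (h.edge_ne_zero k)
  have hlim : Tendsto (fun ε : ℝ => u + ε • κ • leftNormal e) (𝓝[>] 0) (𝓝 u) := by
    have : Continuous fun ε : ℝ => u + ε • κ • leftNormal e := by fun_prop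
    simpa using (this.tendsto 0).mono_left nhdsWithin_le_nhds
  refine hlim.frequently (Eventually.frequently ?_)
  filter_upwards [self_mem_nhdsWithin] with ε hε
  rw [side_eq p k _ u, hu, add_sub_cancel_left, cross_smul_right, cross_smul_right,
    cross_leftNormal, zero_add]
  have hε : 0 < ε := hε
  have : 0 < κ ^ 2 := by positivity
  have h3 := mul_pos (mul_pos hε this) hpos
  linarith

/-- A small half-disc on one side of the edge is convex and misses the boundary, so a saturated set
that meets it contains it. -/
lemma IsSimple.hasGerm_of_frequently (h : IsSimple p) {κ : ℝ} (hκ : κ ≠ 0) {U : Set Plane}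
    (hU : IsSaturated p U) {k : Fin n} {u : Plane}
    (hu : u ∈ openSegment ℝ (p k) (p (k + 1)))
    (hf : ∃ᶠ z in 𝓝 u, 0 < κ * side p k z ∧ z ∈ U) : HasGerm p κ U k u := by
  obtain ⟨r, hr, hball⟩ := Metric.eventually_nhds_iff_ball.1
    (h.eventually_mem_boundary_iff_of_openSegment hu)
  have hC : Metric.ball u r ∩ {z | 0 < κ * side p k z} ⊆ U := by
    refine hU.saturated _ ((convex_ball u r).inter (convex_mul_side_pos hκ p k)).isPreconnected
      ?_ ?_
    · rintro z ⟨hz1, hz2⟩ hb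
      rw [hball z hz1] at hb
      simp [hb] at hz2
    · obtain ⟨z, ⟨hz1, hz2⟩, hz3⟩ := (hf.and_eventually (Metric.ball_mem_nhds u hr)).exists
      exact ⟨z, ⟨hz3, hz1⟩, hz2⟩
  filter_upwards [Metric.ball_mem_nhds u hr] with z hz hs using hC ⟨hz, hs⟩

lemma HasGerm.frequently (h : IsSimple p) {κ : ℝ} (hκ : κ ≠ 0) {U : Set Plane} {k : Fin n}
    {u : Plane} (hu : side p k u = 0) (hg : HasGerm p κ U k u) :
    ∃ᶠ z in 𝓝 u, 0 < κ * side p k z ∧ z ∈ U :=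
  ((h.frequently_side hκ hu).and_eventually hg).mono fun _ hz => ⟨hz.1, hz.2 hz.1⟩

lemma side_of_mem_openSegment {k : Fin n} {z : Plane}
    (hz : z ∈ openSegment ℝ (p k) (p (k + 1))) : side p k z = 0 :=
  side_of_mem_edge (openSegment_subset_segment ℝ _ _ hz)

/-- Having the germ is an open condition on the point of the edge; by `hasGerm_of_frequently`, so is
its failure. The open edge is connected. -/
lemma IsSimple.hasGerm_iff (h : IsSimple p) {κ : ℝ} (hκ : κ ≠ 0) {U : Set Plane}
    (hU : IsSaturated p U) {k : Fin n} {u u' : Plane}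
    (hu : u ∈ openSegment ℝ (p k) (p (k + 1))) (hu' : u' ∈ openSegment ℝ (p k) (p (k + 1))) :
    HasGerm p κ U k u ↔ HasGerm p κ U k u' := by
  refine iff_of_isPreconnected (convex_openSegment (p k) (p (k + 1))).isPreconnected
    (fun u => HasGerm p κ U k u) (fun x hx => ?_) hu hu'
  by_cases hg : HasGerm p κ U k x
  · have : ∀ᶠ y in 𝓝 x, HasGerm p κ U k y := Filter.Eventually.eventually_nhds hg
    filter_upwards [this] with y hy _
    simp [hg, hy]
  · have h1 : ∀ᶠ z in 𝓝 x, ¬ (0 < κ * side p k z ∧ z ∈ U) := by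
      by_contra hcon
      exact hg (h.hasGerm_of_frequently hκ hU hx hcon)
    filter_upwards [h1.eventually_nhds] with y hy hys
    simp only [hg, false_iff]
    intro hgy
    exact (hgy.frequently h hκ (side_of_mem_openSegment hys)) hy

/-- The sector at vertex `i` that lies on the side with sign `κ` of both edges. -/
def sector (p : Polygon Plane n) (i : Fin n) (κ : ℝ) : Set Plane :=
  {z | (0 < κ * turn p i → 0 < κ * side p (i - 1) z ∧ 0 < κ * side p i z) ∧
    (κ * turn p i < 0 → 0 < κ * side p (i - 1) z ∨ 0 < κ * side p i z)}

lemma side_vertex_add (p : Polygon Plane n) (i : Fin n) (c : ℝ) :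
    side p i (p i + c • ((p (i - 1) - p i) + (p (i + 1) - p i))) = c * turn p i ∧
    side p (i - 1) (p i + c • ((p (i - 1) - p i) + (p (i + 1) - p i))) = c * turn p i := by
  constructor
  · rw [side_eq p i _ (p i), side_self, add_sub_cancel_left, cross_smul_right, cross_add_right,
      cross_self, add_zero, zero_add, ← side_pred]
    rfl
  · rw [side_eq p (i - 1) _ (p i), side_sub_one_self, add_sub_cancel_left, cross_smul_right,
      cross_add_right, sub_add_cancel, zero_add, turn, ← neg_sub (p i) (p (i - 1)), cross_neg_right,
      cross_self, neg_zero, zero_add]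

lemma IsSimple.frequently_both (h : IsSimple p) {κ : ℝ} (hκ : κ ≠ 0) (i : Fin n) :
    ∃ᶠ z in 𝓝 (p i), 0 < κ * side p (i - 1) z ∧ 0 < κ * side p i z := by
  set w := (p (i - 1) - p i) + (p (i + 1) - p i) with hw
  have ht := h.turn_ne_zero i
  have hlim : Tendsto (fun ε : ℝ => p i + (ε * (κ * turn p i)) • w) (𝓝[>] 0) (𝓝 (p i)) := by
    have : Continuous fun ε : ℝ => p i + (ε * (κ * turn p i)) • w := by fun_prop
    simpa using (this.tendsto 0).mono_left nhdsWithin_le_nhds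
  refine hlim.frequently (Eventually.frequently ?_)
  filter_upwards [self_mem_nhdsWithin] with ε hε
  have hε : 0 < ε := hε
  rw [(side_vertex_add p i _).1, (side_vertex_add p i _).2]
  have : 0 < ε * (κ * turn p i) ^ 2 := by positivity
  constructor <;> linarith

/-- A small disc without the boundary consists of the two sectors. The convex one is an intersection
of half-discs, the other one a union of two half-discs with a common point; both are connected. -/
lemma IsSimple.exists_sectors (h : IsSimple p) (i : Fin n) : ∃ r > 0,
    (∀ κ : ℝ, κ ≠ 0 → IsPreconnected (Metric.ball (p i) r ∩ sector p i κ) ∧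
      Metric.ball (p i) r ∩ sector p i κ ⊆ (p.boundary ℝ)ᶜ) ∧
    ∀ z ∈ Metric.ball (p i) r, z ∉ p.boundary ℝ → z ∈ sector p i 1 ∨ z ∈ sector p i (-1) := by
  have ht := h.turn_ne_zero i
  obtain ⟨r, hr, hball⟩ := Metric.eventually_nhds_iff_ball.1
    (h.eventually_mem_boundary_iff_vertex i)
  refine ⟨r, hr, fun κ hκ => ⟨?_, ?_⟩, ?_⟩
  · rcases (mul_ne_zero hκ ht).lt_or_gt with hs | hs
    · have : Metric.ball (p i) r ∩ sector p i κ =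
          (Metric.ball (p i) r ∩ {z | 0 < κ * side p (i - 1) z}) ∪
          (Metric.ball (p i) r ∩ {z | 0 < κ * side p i z}) := by
        ext z
        simp only [sector, mem_inter_iff, mem_ofPred_eq, hs, not_lt.2 hs.le, mem_union,
          false_imp_iff, true_imp_iff, true_and, ← and_or_left]
      rw [this]
      obtain ⟨z, ⟨hz1, hz2⟩, hz3⟩ :=
        ((h.frequently_both hκ i).and_eventually (Metric.ball_mem_nhds (p i) hr)).exists
      exact IsPreconnected.union z ⟨hz3, hz1⟩ ⟨hz3, hz2⟩
        ((convex_ball _ r).inter (convex_mul_side_pos hκ p _)).isPreconnected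
        ((convex_ball _ r).inter (convex_mul_side_pos hκ p _)).isPreconnected
    · have : Metric.ball (p i) r ∩ sector p i κ = Metric.ball (p i) r ∩
          ({z | 0 < κ * side p (i - 1) z} ∩ {z | 0 < κ * side p i z}) := by
        ext z
        simp only [sector, mem_inter_iff, mem_ofPred_eq, hs, not_lt.2 hs.le,
          false_imp_iff, true_imp_iff, and_true]
      rw [this]
      exact ((convex_ball _ r).inter
        ((convex_mul_side_pos hκ p _).inter (convex_mul_side_pos hκ p _))).isPreconnected
  · rintro z ⟨hz, hs1, hs2⟩ hb
    rw [hball z hz] at hb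
    rcases (mul_ne_zero hκ ht).lt_or_gt with hs | hs
    · have key : ∀ x : ℝ, 0 ≤ x * turn p i → ¬ 0 < κ * x := by
        intro x hx hx'
        nlinarith [mul_pos hx' (neg_pos.2 hs), mul_nonneg hx (sq_nonneg κ)]
      rcases hs2 hs with h1 | h1 <;> rcases hb with hb | hb
      · exact key _ hb.2 h1
      · simp [hb.1] at h1
      · simp [hb.1] at h1
      · exact key _ hb.2 h1
    · have := hs1 hs
      rcases hb with hb | hb <;> simp [hb.1] at this
  · intro z hz hb
    rw [hball z hz] at hb
    simp only [sector, mem_ofPred_eq, one_mul, neg_mul, Left.neg_pos_iff, Left.neg_neg_iff]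
    rcases ht.lt_or_gt with hs | hs
    · simp only [hs, not_lt.2 hs.le, false_imp_iff, true_imp_iff, true_and, and_true]
      by_contra! hcon
      obtain ⟨⟨h1, h2⟩, h3⟩ := hcon
      rcases h1.eq_or_lt with h1 | h1
      · exact hb (Or.inr ⟨h1, by nlinarith⟩)
      · exact hb (Or.inl ⟨le_antisymm h2 (h3 h1), by nlinarith⟩)
    · simp only [hs, not_lt.2 hs.le, false_imp_iff, true_imp_iff, true_and, and_true]
      by_contra! hcon
      obtain ⟨h3, h1, h2⟩ := hcon
      rcases h1.eq_or_lt with h1 | h1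
      · exact hb (Or.inr ⟨h1.symm, by nlinarith⟩)
      · exact hb (Or.inl ⟨le_antisymm (h3 h1) h2, by nlinarith⟩)

/-- Points of either edge close to the vertex border the sector; this links germs along edges to
sectors at vertices. -/
lemma IsSimple.exists_germ_sector (h : IsSimple p) (i : Fin n) {r : ℝ} (hr : 0 < r) {κ : ℝ}
    {j : Fin n} (hj : j = i ∨ j = i - 1) :
    ∃ u ∈ openSegment ℝ (p j) (p (j + 1)), ∀ᶠ z in 𝓝 u, 0 < κ * side p j z →
      z ∈ Metric.ball (p i) r ∩ sector p i κ := by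
  have ht := h.turn_ne_zero i
  have hlim : ∀ q : Plane, Tendsto (fun ε : ℝ => p i + ε • (q - p i)) (𝓝[>] 0) (𝓝 (p i)) := by
    intro q
    have : Continuous fun ε : ℝ => p i + ε • (q - p i) := by fun_prop
    simpa using (this.tendsto 0).mono_left nhdsWithin_le_nhds
  have hex : ∀ q : Plane, ∃ ε : ℝ, 0 < ε ∧ ε < 1 ∧ p i + ε • (q - p i) ∈ Metric.ball (p i) r := by
    intro q
    have h1 : ∀ᶠ ε : ℝ in 𝓝[>] 0, ε < 1 := (Iio_mem_nhds one_pos |> nhdsWithin_le_nhds)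
    obtain ⟨ε, h2, h3, h4⟩ := (h1.and (((hlim q).eventually (Metric.ball_mem_nhds _ hr)).and
      self_mem_nhdsWithin)).exists
    exact ⟨ε, h4, h2, h3⟩
  have hpos : ∀ (k : Fin n) (u : Plane), (0 < κ * turn p i → 0 < κ * side p k u) →
      ∀ᶠ z in 𝓝 u, 0 < κ * turn p i → 0 < κ * side p k z := by
    intro k u hk
    by_cases hs : 0 < κ * turn p i
    · have : Continuous fun z => κ * side p k z := by fun_prop
      filter_upwards [this.continuousAt.eventually (lt_mem_nhds (hk hs))] with z hz _ using hz
    · exact Eventually.of_forall fun z h' => (hs h').elim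
  rcases hj with rfl | rfl
  · obtain ⟨ε, h0, h1, hb⟩ := hex (p (j + 1))
    refine ⟨_, mem_openSegment_iff_exists.2 ⟨ε, h0, h1, rfl⟩, ?_⟩
    have hk := hpos (j - 1) (p j + ε • (p (j + 1) - p j)) (by
      intro hs
      rw [side_segment, side_sub_one_self, side_sub_one_succ]
      have := mul_pos h0 hs
      linarith)
    filter_upwards [hk, Metric.isOpen_ball.mem_nhds hb] with z hz1 hz2 hz3
    exact ⟨hz2, fun hs => ⟨hz1 hs, hz3⟩, fun _ => Or.inr hz3⟩
  · obtain ⟨ε, h0, h1, hb⟩ := hex (p (i - 1))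
    refine ⟨_, by
      rw [sub_add_cancel, openSegment_symm]
      exact mem_openSegment_iff_exists.2 ⟨ε, h0, h1, rfl⟩, ?_⟩
    have hk := hpos i (p i + ε • (p (i - 1) - p i)) (by
      intro hs
      rw [side_segment, side_self, side_pred]
      have := mul_pos h0 hs
      linarith)
    filter_upwards [hk, Metric.isOpen_ball.mem_nhds hb] with z hz1 hz2 hz3
    exact ⟨hz2, fun hs => ⟨hz3, hz1 hs⟩, fun _ => Or.inl hz3⟩

/-- The set `U` contains the side of edge `k` with sign `κ`. -/
def EdgeGerm (p : Polygon Plane n) (κ : ℝ) (U : Set Plane) (k : Fin n) : Prop :=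
  ∀ u ∈ openSegment ℝ (p k) (p (k + 1)), HasGerm p κ U k u

lemma IsSimple.edgeGerm_iff_sector (h : IsSimple p) {i : Fin n} {r : ℝ} (hr : 0 < r)
    {κ : ℝ} (hκ : κ ≠ 0) (hpre : IsPreconnected (Metric.ball (p i) r ∩ sector p i κ))
    (hsub : Metric.ball (p i) r ∩ sector p i κ ⊆ (p.boundary ℝ)ᶜ) {U : Set Plane}
    (hU : IsSaturated p U) {j : Fin n} (hj : j = i ∨ j = i - 1) :
    EdgeGerm p κ U j ↔ Metric.ball (p i) r ∩ sector p i κ ⊆ U := by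
  obtain ⟨u, hu, hev⟩ := h.exists_germ_sector i hr (κ := κ) hj
  constructor
  · intro hg
    obtain ⟨z, ⟨hz1, hz2⟩, hz3⟩ :=
      (((hg u hu).frequently h hκ (side_of_mem_openSegment hu)).and_eventually hev).exists
    exact hU.saturated _ hpre hsub ⟨z, hz3 hz1, hz2⟩
  · intro hs u' hu'
    rw [h.hasGerm_iff hκ hU hu' hu]
    filter_upwards [hev] with z hz hz' using hs (hz hz')

/-- The sector at `p (i + 1)` borders both edge `i` and edge `i + 1`, so a germ is carried around
each corner. -/
lemma IsSimple.edgeGerm_all (h : IsSimple p) {κ : ℝ} (hκ : κ ≠ 0) {U : Set Plane}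
    (hU : IsSaturated p U) {j : Fin n} (hj : EdgeGerm p κ U j) (k : Fin n) :
    EdgeGerm p κ U k := by
  refine forall_of_step (fun i hi => ?_) hj k
  obtain ⟨r, hr, hsec, -⟩ := h.exists_sectors (i + 1)
  have h1 := h.edgeGerm_iff_sector hr hκ (hsec κ hκ).1 (hsec κ hκ).2 hU (j := i)
    (Or.inr (by simp))
  have h2 := h.edgeGerm_iff_sector hr hκ (hsec κ hκ).1 (hsec κ hκ).2 hU (j := i + 1)
    (Or.inl rfl)
  exact h2.2 (h1.1 hi)

/-- Every proper union of components touches all edges from the same side. -/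
lemma IsSimple.exists_edgeGerm (h : IsSimple p) {U : Set Plane} (hU : IsSaturated p U)
    {z z' : Plane} (hz : z ∈ U) (hzU : z' ∉ U) :
    ∃ κ : ℝ, (κ = 1 ∨ κ = -1) ∧ ∀ k, EdgeGerm p κ U k := by
  suffices ∃ κ : ℝ, (κ = 1 ∨ κ = -1) ∧ ∃ k, EdgeGerm p κ U k by
    obtain ⟨κ, hκ, k, hk⟩ := this
    exact ⟨κ, hκ, h.edgeGerm_all (by rcases hκ with rfl | rfl <;> norm_num) hU hk⟩
  let f : ℝ → Plane := fun t => z + t • (z' - z)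
  have hf : Continuous f := by simp only [f]; fun_prop
  have hcl : IsCompact (Icc (0 : ℝ) 1 ∩ f ⁻¹' p.boundary ℝ) :=
    isCompact_Icc.inter_right ((isCompact_boundary p).isClosed.preimage hf)
  have hne : (Icc (0 : ℝ) 1 ∩ f ⁻¹' p.boundary ℝ).Nonempty := by
    by_contra hcon
    rw [not_nonempty_iff_eq_empty] at hcon
    have hsub : f '' Icc 0 1 ⊆ (p.boundary ℝ)ᶜ := by
      rintro _ ⟨t, ht, rfl⟩ hb
      exact eq_empty_iff_forall_notMem.1 hcon t (mem_inter ht hb)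
    have := hU.saturated _ (isPreconnected_Icc.image f hf.continuousOn) hsub
      ⟨z, ⟨0, by simp, by simp [f]⟩, hz⟩
    exact hzU (this ⟨1, by simp, by simp [f]⟩)
  -- The first hit of the boundary on the way from `z` to `z'`: the segment stays in `U` before `τ`,
  -- so `U` accumulates at `f τ`.
  obtain ⟨τ, ⟨hτ, hτb⟩, hmin⟩ := hcl.exists_isLeast hne
  have hsub : f '' Ico 0 τ ⊆ (p.boundary ℝ)ᶜ := by
    rintro _ ⟨t, ht, rfl⟩ hb
    exact absurd (hmin ⟨⟨ht.1, ht.2.le.trans hτ.2⟩, hb⟩) (not_le.2 ht.2)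
  have hτ0 : 0 < τ := by
    rcases hτ.1.eq_or_lt with h0 | h0
    · exfalso
      subst h0
      have : z ∈ p.boundary ℝ := by simpa [f] using hτb
      exact hU.subset hz this
    · exact h0
  have hUsub : f '' Ico 0 τ ⊆ U := hU.saturated _ (isPreconnected_Ico.image f hf.continuousOn) hsub
    ⟨z, ⟨0, ⟨le_rfl, hτ0⟩, by simp [f]⟩, hz⟩
  have hfreq : ∃ᶠ w in 𝓝 (f τ), w ∈ U := by
    have hlim : Tendsto f (𝓝[<] τ) (𝓝 (f τ)) := (hf.tendsto τ).mono_left nhdsWithin_le_nhds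
    refine hlim.frequently (Eventually.frequently ?_)
    filter_upwards [Ioo_mem_nhdsLT hτ0] with t ht
    exact hUsub ⟨t, ⟨ht.1.le, ht.2⟩, rfl⟩
  have hτb : f τ ∈ p.boundary ℝ := hτb
  obtain ⟨k, hk⟩ := mem_boundary_iff.1 hτb
  have hvert : ∀ i, f τ = p i → ∃ κ : ℝ, (κ = 1 ∨ κ = -1) ∧ ∃ k, EdgeGerm p κ U k := by
    intro i hi
    rw [hi] at hfreq
    obtain ⟨r, hr, hsec, hcov⟩ := h.exists_sectors i
    obtain ⟨w, hw, hwr⟩ := (hfreq.and_eventually (Metric.ball_mem_nhds _ hr)).exists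
    have key : ∀ κ : ℝ, κ ≠ 0 → w ∈ sector p i κ → EdgeGerm p κ U i := by
      intro κ hκ hwκ
      rw [h.edgeGerm_iff_sector hr hκ (hsec κ hκ).1 (hsec κ hκ).2 hU (Or.inl rfl)]
      exact hU.saturated _ (hsec κ hκ).1 (hsec κ hκ).2 ⟨w, ⟨hwr, hwκ⟩, hw⟩
    rcases hcov w hwr (hU.subset hw) with hw' | hw'
    · exact ⟨1, Or.inl rfl, i, key 1 one_ne_zero hw'⟩
    · exact ⟨-1, Or.inr rfl, i, key (-1) (by norm_num) hw'⟩
  by_cases h1 : f τ = p k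
  · exact hvert k h1
  by_cases h2 : f τ = p (k + 1)
  · exact hvert (k + 1) h2
  have hu := mem_openSegment_of_ne_left_right (Ne.symm h1) (Ne.symm h2) hk
  have hfr : ∃ᶠ w in 𝓝 (f τ), 0 < side p k w ∧ w ∈ U ∨ side p k w < 0 ∧ w ∈ U := by
    refine (hfreq.and_eventually (h.eventually_mem_boundary_iff_of_openSegment hu)).mono ?_
    rintro w ⟨hw, hw'⟩
    have : side p k w ≠ 0 := fun h0 => hU.subset hw (hw'.2 h0)
    rcases this.lt_or_gt with h' | h'
    · exact Or.inr ⟨h', hw⟩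
    · exact Or.inl ⟨h', hw⟩
  rw [frequently_or_distrib] at hfr
  have key : ∀ κ : ℝ, κ ≠ 0 → (∃ᶠ w in 𝓝 (f τ), 0 < κ * side p k w ∧ w ∈ U) →
      EdgeGerm p κ U k := by
    intro κ hκ hw u' hu'
    rw [h.hasGerm_iff hκ hU hu' hu]
    exact h.hasGerm_of_frequently hκ hU hu hw
  rcases hfr with hfr | hfr
  · exact ⟨1, Or.inl rfl, k, key 1 one_ne_zero (by simpa using hfr)⟩
  · exact ⟨-1, Or.inr rfl, k, key (-1) (by norm_num) (by simpa using hfr)⟩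


/-! ### The two sides of a simple polygon -/

/-- The image of the punctured plane under the radial push by the distance `R`. -/
lemma isPreconnected_norm_gt {R : ℝ} (hR : 0 ≤ R) : IsPreconnected {z : Plane | R < ‖z‖} := by
  have hrank : 1 < Module.rank ℝ Plane := by
    rw [← Module.finrank_eq_rank, finrank_euclideanSpace_fin]
    norm_num
  have h0 := (isConnected_compl_singleton_of_one_lt_rank hrank (0 : Plane)).isPreconnected
  have hcont : ContinuousOn (fun z : Plane => (1 + R / ‖z‖) • z) {0}ᶜ := by
    intro z hz
    have : ‖z‖ ≠ 0 := by simpa using hz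
    exact (ContinuousAt.smul (continuousAt_const.add
      (continuousAt_const.div continuous_norm.continuousAt this)) continuousAt_id).continuousWithinAt
  convert h0.image _ hcont using 1
  ext w
  simp only [mem_ofPred_eq, mem_image, mem_compl_iff, mem_singleton_iff]
  constructor
  · intro hw
    have hw0 : 0 < ‖w‖ := hR.trans_lt hw
    have hc : 0 < (‖w‖ - R) / ‖w‖ := div_pos (sub_pos.2 hw) hw0
    refine ⟨((‖w‖ - R) / ‖w‖) • w, ?_, ?_⟩
    · rw [smul_eq_zero, not_or]
      exact ⟨hc.ne', norm_pos_iff.1 hw0⟩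
    · rw [norm_smul, Real.norm_of_nonneg hc.le, smul_smul, div_mul_cancel₀ _ hw0.ne']
      have h1 : ‖w‖ - R ≠ 0 := (sub_pos.2 hw).ne'
      have : (1 + R / (‖w‖ - R)) * ((‖w‖ - R) / ‖w‖) = 1 := by field_simp; ring
      rw [this, one_smul]
  · rintro ⟨z, hz, rfl⟩
    have hz0 : 0 < ‖z‖ := norm_pos_iff.2 hz
    have hc : 0 < 1 + R / ‖z‖ := by positivity
    rw [norm_smul, Real.norm_of_nonneg hc.le, add_mul, div_mul_cancel₀ _ hz0.ne']
    linarith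

lemma not_isBounded_norm_gt (R : ℝ) : ¬ Bornology.IsBounded {z : Plane | R < ‖z‖} := by
  intro h
  apply NormedSpace.unbounded_univ ℝ Plane
  refine (h.union (Metric.isBounded_closedBall (x := (0 : Plane)) (r := R))).subset ?_
  intro z _
  rcases lt_or_ge R ‖z‖ with h1 | h1
  · exact Or.inl h1
  · exact Or.inr (by simpa using h1)

lemma inside_subset : inside p ⊆ (p.boundary ℝ)ᶜ := fun _ h => h.1

lemma inside_subset_region : inside p ⊆ region p := subset_union_right

lemma boundary_subset_region : p.boundary ℝ ⊆ region p := subset_union_left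

lemma edge_subset_region (k : Fin n) : segment ℝ (p k) (p (k + 1)) ⊆ region p :=
  fun _ h => boundary_subset_region (mem_boundary_iff.2 ⟨k, h⟩)

lemma vertex_mem_region (k : Fin n) : p k ∈ region p := edge_subset_region k (left_mem_segment _ _ _)

lemma mem_compl_region_iff {z : Plane} : z ∈ (region p)ᶜ ↔ z ∉ p.boundary ℝ ∧
    ¬ Bornology.IsBounded (connectedComponentIn (p.boundary ℝ)ᶜ z) := by
  simp only [region, inside, mem_compl_iff, mem_union, mem_ofPred_eq, not_or, not_and]
  tauto

lemma exists_boundary_bound (p : Polygon Plane n) : ∃ R : ℝ, 0 ≤ R ∧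
    {z : Plane | R < ‖z‖} ⊆ (p.boundary ℝ)ᶜ := by
  obtain ⟨R, hR⟩ := (isCompact_boundary p).isBounded.exists_norm_le
  refine ⟨max R 0, le_max_right _ _, fun z hz hb => ?_⟩
  have := hR z hb
  have hz : max R 0 < ‖z‖ := hz
  exact absurd (this.trans (le_max_left R 0)) (not_le.2 hz)

/-- The outside of a large disc is connected and misses the boundary, so there is just one unbounded
component of the complement of the boundary. -/
lemma exists_compl_region_eq (p : Polygon Plane n) : ∃ R : ℝ, ∃ e : Plane, R < ‖e‖ ∧
    {z : Plane | R < ‖z‖} ⊆ (region p)ᶜ ∧ e ∈ (p.boundary ℝ)ᶜ ∧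
    (region p)ᶜ = connectedComponentIn (p.boundary ℝ)ᶜ e := by
  obtain ⟨R, hR0, hR⟩ := exists_boundary_bound p
  have hne : ({z : Plane | R < ‖z‖} : Set Plane).Nonempty := by
    by_contra h
    rw [not_nonempty_iff_eq_empty] at h
    exact not_isBounded_norm_gt R (h ▸ Bornology.isBounded_empty)
  obtain ⟨e, he⟩ := hne
  have hsub : {z : Plane | R < ‖z‖} ⊆ connectedComponentIn (p.boundary ℝ)ᶜ e :=
    (isPreconnected_norm_gt hR0).subset_connectedComponentIn he hR
  have heq : (region p)ᶜ = connectedComponentIn (p.boundary ℝ)ᶜ e := by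
    ext z
    rw [mem_compl_region_iff]
    constructor
    · rintro ⟨hz, hb⟩
      have : ∃ w ∈ connectedComponentIn (p.boundary ℝ)ᶜ z, R < ‖w‖ := by
        by_contra! hcon
        exact hb ((Metric.isBounded_closedBall (x := (0 : Plane)) (r := R)).subset
          fun w hw => by simpa using hcon w hw)
      obtain ⟨w, hw, hwR⟩ := this
      have h1 := connectedComponentIn_eq hw
      have h2 := connectedComponentIn_eq (hsub hwR)
      rw [h2, ← h1]
      exact mem_connectedComponentIn hz
    · intro hz
      refine ⟨connectedComponentIn_subset _ _ hz, fun hb => ?_⟩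
      rw [← connectedComponentIn_eq hz] at hb
      exact not_isBounded_norm_gt R (hb.subset hsub)
  exact ⟨R, e, he, heq ▸ hsub, hR he, heq⟩

lemma isOpen_compl_region : IsOpen (region p)ᶜ := by
  obtain ⟨R, e, -, -, -, heq⟩ := exists_compl_region_eq p
  rw [heq]
  exact (isCompact_boundary p).isClosed.isOpen_compl.connectedComponentIn

lemma isPreconnected_compl_region : IsPreconnected (region p)ᶜ := by
  obtain ⟨R, e, -, -, -, heq⟩ := exists_compl_region_eq p
  rw [heq]
  exact isPreconnected_connectedComponentIn

lemma isClosed_region : IsClosed (region p) := isOpen_compl_iff.1 isOpen_compl_region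

lemma isBounded_region : Bornology.IsBounded (region p) := by
  obtain ⟨R, e, -, hR, -, -⟩ := exists_compl_region_eq p
  refine (Metric.isBounded_closedBall (x := (0 : Plane)) (r := R)).subset fun z hz => ?_
  by_contra h
  exact hR (by simpa using h : R < ‖z‖) hz

lemma isCompact_region : IsCompact (region p) :=
  Metric.isCompact_of_isClosed_isBounded isClosed_region isBounded_region

lemma isSaturated_component {z : Plane} : IsSaturated p (connectedComponentIn (p.boundary ℝ)ᶜ z) where
  subset := connectedComponentIn_subset _ _
  saturated C hC hsub := by
    rintro ⟨w, hw, hw'⟩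
    rw [connectedComponentIn_eq hw']
    exact hC.subset_connectedComponentIn hw hsub

lemma isSaturated_compl_region : IsSaturated p (region p)ᶜ := by
  obtain ⟨R, e, -, -, -, heq⟩ := exists_compl_region_eq p
  rw [heq]
  exact isSaturated_component

lemma component_subset_inside {z : Plane} (hz : z ∈ inside p) :
    connectedComponentIn (p.boundary ℝ)ᶜ z ⊆ inside p := by
  intro w hw
  refine ⟨connectedComponentIn_subset _ _ hw, ?_⟩
  rw [← connectedComponentIn_eq hw]
  exact hz.2

lemma isSaturated_inside : IsSaturated p (inside p) where
  subset := inside_subset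
  saturated C hC hsub := by
    rintro ⟨w, hw, hw'⟩
    exact (hC.subset_connectedComponentIn hw hsub).trans (component_subset_inside hw')

lemma isOpen_inside : IsOpen (inside p) := by
  rw [isOpen_iff_mem_nhds]
  intro z hz
  exact mem_of_superset ((isCompact_boundary p).isClosed.isOpen_compl.connectedComponentIn.mem_nhds
    (mem_connectedComponentIn hz.1)) (component_subset_inside hz)

lemma midpoint_mem_openSegment_edge (p : Polygon Plane n) (k : Fin n) :
    p k + (1 / 2 : ℝ) • (p (k + 1) - p k) ∈ openSegment ℝ (p k) (p (k + 1)) :=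
  mem_openSegment_iff_exists.2 ⟨1 / 2, by norm_num, by norm_num, rfl⟩

lemma tendsto_add_smul (u w : Plane) : Tendsto (fun ε : ℝ => u + ε • w) (𝓝[>] 0) (𝓝 u) := by
  have : Continuous fun ε : ℝ => u + ε • w := by fun_prop
  simpa using (this.tendsto 0).mono_left nhdsWithin_le_nhds

lemma EdgeGerm.inter_nonempty (h : IsSimple p) {κ : ℝ} (hκ : κ ≠ 0) {U V : Set Plane}
    (k : Fin n) (hU : EdgeGerm p κ U k) (hV : EdgeGerm p κ V k) : (U ∩ V).Nonempty := by
  have hu := midpoint_mem_openSegment_edge p k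
  obtain ⟨z, ⟨hz1, hz2⟩, hz3⟩ := (((hU _ hu).frequently h hκ
    (side_of_mem_openSegment hu)).and_eventually (hV _ hu)).exists
  exact ⟨z, hz2, hz3 hz1⟩

/-- The right sides of all edges lie outside of the polygon. -/
lemma IsSimple.edgeGerm_compl (h : IsSimple p) (hccw : IsCounterclockwise p) (k : Fin n) :
    EdgeGerm p (-1) (region p)ᶜ k := by
  obtain ⟨R, e, -, -, he, heq⟩ := exists_compl_region_eq p
  have heΩ : e ∈ (region p)ᶜ := heq ▸ mem_connectedComponentIn he
  have hu := midpoint_mem_openSegment_edge p 0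
  set u := p 0 + (1 / 2 : ℝ) • (p (0 + 1) - p 0)
  have hin := hccw 0 u hu
  obtain ⟨ε, hε⟩ := hin.exists
  -- The sign `1` is impossible, since counterclockwise order puts inside points immediately to the
  -- left of edge `0`.
  obtain ⟨κ, hκ | hκ, hg⟩ := h.exists_edgeGerm isSaturated_compl_region heΩ
    (z' := u + ε • leftNormal (p (0 + 1) - p 0)) (fun hc => hc (inside_subset_region hε))
  · exfalso
    have hev := (tendsto_add_smul u (leftNormal (p (0 + 1) - p 0))).eventually (hg 0 u hu)
    obtain ⟨δ, ⟨h1, h2⟩, h3⟩ := ((hin.and hev).and self_mem_nhdsWithin).exists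
    have h3 : 0 < δ := h3
    refine h2 ?_ (inside_subset_region h1)
    rw [hκ, one_mul, side_eq p 0 _ u, side_of_mem_openSegment hu, add_sub_cancel_left,
      cross_smul_right, cross_leftNormal, zero_add]
    exact mul_pos h3 (sq_add_sq_pos (h.edge_ne_zero 0))
  · exact hκ ▸ hg k

/-- The right sides are taken by the outside, which leaves only the left sides for a component of
the inside. -/
lemma IsSimple.edgeGerm_component (h : IsSimple p) (hccw : IsCounterclockwise p) {z : Plane}
    (hz : z ∈ inside p) (k : Fin n) :
    EdgeGerm p 1 (connectedComponentIn (p.boundary ℝ)ᶜ z) k := by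
  obtain ⟨R, e, -, -, he, heq⟩ := exists_compl_region_eq p
  have heΩ : e ∈ (region p)ᶜ := heq ▸ mem_connectedComponentIn he
  obtain ⟨κ, hκ | hκ, hg⟩ := h.exists_edgeGerm isSaturated_component
    (mem_connectedComponentIn hz.1) (z' := e)
    (fun hc => heΩ (inside_subset_region (component_subset_inside hz hc)))
  · exact hκ ▸ hg k
  · exfalso
    obtain ⟨w, hw1, hw2⟩ := EdgeGerm.inter_nonempty h (by norm_num) k (hκ ▸ hg k)
      (h.edgeGerm_compl hccw k)
    exact hw2 (inside_subset_region (component_subset_inside hz hw1))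

lemma IsSimple.inside_nonempty (hccw : IsCounterclockwise p) : (inside p).Nonempty := by
  obtain ⟨ε, hε⟩ := (hccw 0 _ (midpoint_mem_openSegment_edge p 0)).exists
  exact ⟨_, hε⟩

lemma IsSimple.edgeGerm_inside (h : IsSimple p) (hccw : IsCounterclockwise p) (k : Fin n) :
    EdgeGerm p 1 (inside p) k := by
  obtain ⟨z, hz⟩ := IsSimple.inside_nonempty hccw
  intro u hu
  filter_upwards [h.edgeGerm_component hccw hz k u hu] with w hw hs
  exact component_subset_inside hz (hw hs)

/-- Any two components of the inside contain the points just to the left of edge `0`, hence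
coincide. -/
lemma IsSimple.isPreconnected_inside (h : IsSimple p) (hccw : IsCounterclockwise p) :
    IsPreconnected (inside p) := by
  obtain ⟨z, hz⟩ := IsSimple.inside_nonempty hccw
  have : inside p = connectedComponentIn (p.boundary ℝ)ᶜ z := by
    refine subset_antisymm (fun w hw => ?_) (component_subset_inside hz)
    obtain ⟨q, hq1, hq2⟩ := EdgeGerm.inter_nonempty h one_ne_zero 0
      (h.edgeGerm_component hccw hz 0) (h.edgeGerm_component hccw hw 0)
    rw [connectedComponentIn_eq hq1, ← connectedComponentIn_eq hq2]
    exact mem_connectedComponentIn hw.1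
  rw [this]
  exact isPreconnected_connectedComponentIn

/-- Near a point of an open edge, the polygon is a half-plane. -/
lemma IsSimple.eventually_edge (h : IsSimple p) (hccw : IsCounterclockwise p) {k : Fin n}
    {u : Plane} (hu : u ∈ openSegment ℝ (p k) (p (k + 1))) :
    ∀ᶠ z in 𝓝 u, (z ∈ region p ↔ 0 ≤ side p k z) ∧ (0 < side p k z → z ∈ inside p) := by
  filter_upwards [h.eventually_mem_boundary_iff_of_openSegment hu, h.edgeGerm_compl hccw k u hu,
    h.edgeGerm_inside hccw k u hu] with z h1 h2 h3
  rw [one_mul] at h3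
  refine ⟨⟨fun hz => ?_, fun hz => ?_⟩, h3⟩
  · by_contra hs
    exact h2 (by linarith) hz
  · rcases hz.eq_or_lt with h0 | h0
    · exact boundary_subset_region (h1.2 h0.symm)
    · exact inside_subset_region (h3 h0)

lemma IsSimple.eventually_vertex_aux (h : IsSimple p) (hccw : IsCounterclockwise p) (i : Fin n) :
    ∀ᶠ z in 𝓝 (p i), (z ∈ sector p i 1 → z ∈ inside p) ∧ (z ∈ sector p i (-1) → z ∉ region p) ∧
      (z ∈ p.boundary ℝ ∨ z ∈ sector p i 1 ∨ z ∈ sector p i (-1)) := by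
  obtain ⟨r, hr, hsec, hcov⟩ := h.exists_sectors i
  have h1 := (h.edgeGerm_iff_sector hr one_ne_zero (hsec 1 one_ne_zero).1 (hsec 1 one_ne_zero).2
    isSaturated_inside (Or.inl rfl)).1 (h.edgeGerm_inside hccw i)
  have hm : (-1 : ℝ) ≠ 0 := by norm_num
  have h2 := (h.edgeGerm_iff_sector hr hm (hsec _ hm).1 (hsec _ hm).2
    isSaturated_compl_region (Or.inl rfl)).1 (h.edgeGerm_compl hccw i)
  filter_upwards [Metric.ball_mem_nhds _ hr] with z hz
  exact ⟨fun hs => h1 ⟨hz, hs⟩, fun hs => h2 ⟨hz, hs⟩, or_iff_not_imp_left.2 (hcov z hz)⟩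

/-- Near a convex vertex, the polygon is an intersection of two half-planes. -/
lemma IsSimple.eventually_convex (h : IsSimple p) (hccw : IsCounterclockwise p) {i : Fin n}
    (hi : ¬ IsReflex p i) :
    ∀ᶠ z in 𝓝 (p i), z ∈ region p ↔ 0 ≤ side p (i - 1) z ∧ 0 ≤ side p i z := by
  have ht : 0 < turn p i := (h.turn_ne_zero i).symm.lt_of_le (not_lt.1 hi)
  filter_upwards [h.eventually_vertex_aux hccw i] with z ⟨h1, h2, h3⟩
  simp only [sector, mem_ofPred_eq, one_mul, neg_mul, Left.neg_pos_iff, Left.neg_neg_iff, ht,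
    not_lt.2 ht.le, false_imp_iff, true_imp_iff, true_and, and_true] at h1 h2 h3
  constructor
  · intro hz
    have := mt h2 (not_not.2 hz)
    rw [not_or, not_lt, not_lt] at this
    exact this
  · rintro ⟨ha, hb⟩
    rcases h3 with h3 | h3 | h3
    · exact boundary_subset_region h3
    · exact inside_subset_region (h1 h3)
    · exfalso
      rcases h3 with h3 | h3 <;> linarith

/-- Near a reflex vertex, the polygon is a union of two half-planes. -/
lemma IsSimple.eventually_reflex (h : IsSimple p) (hccw : IsCounterclockwise p) {i : Fin n}
    (hi : IsReflex p i) :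
    ∀ᶠ z in 𝓝 (p i), z ∈ region p ↔ 0 ≤ side p (i - 1) z ∨ 0 ≤ side p i z := by
  have ht : turn p i < 0 := hi
  filter_upwards [h.eventually_vertex_aux hccw i] with z ⟨h1, h2, h3⟩
  simp only [sector, mem_ofPred_eq, one_mul, neg_mul, Left.neg_pos_iff, Left.neg_neg_iff, ht,
    not_lt.2 ht.le, false_imp_iff, true_imp_iff, true_and, and_true] at h1 h2 h3
  constructor
  · intro hz
    have := mt h2 (not_not.2 hz)
    by_contra! hcon
    exact this hcon
  · intro hab
    rcases h3 with h3 | h3 | h3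
    · exact boundary_subset_region h3
    · exact inside_subset_region (h1 h3)
    · exfalso
      rcases hab with h4 | h4 <;> linarith [h3.1, h3.2]

lemma IsSimple.eventually_vertex_inside (h : IsSimple p) (hccw : IsCounterclockwise p)
    (i : Fin n) : ∀ᶠ z in 𝓝 (p i), 0 < side p (i - 1) z → 0 < side p i z → z ∈ inside p := by
  filter_upwards [h.eventually_vertex_aux hccw i] with z ⟨h1, _, _⟩ ha hb
  exact h1 (by simp [sector, ha, hb])

/-- Every point of the polygon can be reached along a segment from the inside. -/
lemma IsSimple.exists_inside_access (h : IsSimple p) (hccw : IsCounterclockwise p) {t : Plane}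
    (ht : t ∈ region p) : ∃ w : Plane, ∀ᶠ ε : ℝ in 𝓝[>] 0, t + ε • w ∈ inside p := by
  rcases ht with hb | hin
  · obtain ⟨k, hk⟩ := mem_boundary_iff.1 hb
    have hvert : ∀ i, t = p i → ∃ w : Plane, ∀ᶠ ε : ℝ in 𝓝[>] 0, t + ε • w ∈ inside p := by
      rintro i rfl
      have hti := h.turn_ne_zero i
      -- The sum of the edge vectors points into the angle below 180 degrees; the factor `turn p i`
      -- reverses it at a reflex vertex.
      refine ⟨turn p i • ((p (i - 1) - p i) + (p (i + 1) - p i)), ?_⟩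
      filter_upwards [(tendsto_add_smul (p i) _).eventually (h.eventually_vertex_inside hccw i),
        self_mem_nhdsWithin] with ε hε hε0
      have hε0 : 0 < ε := hε0
      have hpos : 0 < ε * turn p i * turn p i := by
        have : 0 < turn p i * turn p i := mul_self_pos.2 hti
        nlinarith
      rw [smul_smul] at hε ⊢
      exact hε (by rw [(side_vertex_add p i _).2]; exact hpos)
        (by rw [(side_vertex_add p i _).1]; exact hpos)
    by_cases h1 : t = p k
    · exact hvert k h1
    by_cases h2 : t = p (k + 1)
    · exact hvert (k + 1) h2
    exact ⟨_, hccw k t (mem_openSegment_of_ne_left_right (Ne.symm h1) (Ne.symm h2) hk)⟩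
  · exact ⟨0, Eventually.of_forall fun ε => by simpa using hin⟩

/-! ### Cutting a simply connected region along a segment -/

/-- The plane as the complex plane. -/
noncomputable def toComplex (z : Plane) : ℂ := (z 0 : ℂ) + (z 1 : ℂ) * Complex.I

@[simp] lemma toComplex_re (z : Plane) : (toComplex z).re = z 0 := by simp [toComplex]

@[simp] lemma toComplex_im (z : Plane) : (toComplex z).im = z 1 := by simp [toComplex]

@[fun_prop]
lemma continuous_toComplex : Continuous toComplex := by
  unfold toComplex; fun_prop

lemma toComplex_injective : Function.Injective toComplex := by
  intro a b h
  ext j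
  fin_cases j
  · simpa using congrArg Complex.re h
  · simpa using congrArg Complex.im h

/-- The ratio of the differences from `z` to `a` and to `b`. -/
noncomputable def ratio (a b z : Plane) : ℂ :=
  (toComplex z - toComplex a) / (toComplex z - toComplex b)

lemma continuousAt_ratio {a b z : Plane} (h : z ≠ b) : ContinuousAt (ratio a b) z := by
  unfold ratio
  refine ContinuousAt.div (by fun_prop) (by fun_prop) ?_
  rw [sub_ne_zero]
  exact toComplex_injective.ne h

/-- A real ratio `ρ ≤ 0` would place `z` between `a` and `b`, at parameter `-ρ / (1 - ρ)`. -/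
lemma ratio_mem_slitPlane {a b z : Plane} (h : z ∉ segment ℝ a b) :
    ratio a b z ∈ Complex.slitPlane := by
  by_contra hs
  rw [Complex.mem_slitPlane_iff, not_or, not_lt, not_not] at hs
  obtain ⟨hre, him⟩ := hs
  have hzb : toComplex z - toComplex b ≠ 0 := by
    rw [sub_ne_zero]
    exact toComplex_injective.ne fun hzb => h (hzb ▸ right_mem_segment _ _ _)
  set ρ := (ratio a b z).re with hρ
  have hq : ratio a b z = (ρ : ℂ) := Complex.ext (by simp [hρ]) (by simp [him])
  have heq : toComplex z - toComplex a = ρ * (toComplex z - toComplex b) := by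
    rw [← hq, ratio, div_mul_cancel₀ _ hzb]
  have h0 := congrArg Complex.re heq
  have h1 := congrArg Complex.im heq
  simp at h0 h1
  have hpos : 0 < 1 - ρ := by linarith
  apply h
  refine mem_segment_iff_exists.2 ⟨-ρ / (1 - ρ), div_nonneg (by linarith) hpos.le, ?_, ?_⟩
  · rw [div_le_one hpos]; linarith
  · ext j
    fin_cases j
    · simp only [Fin.zero_eta, PiLp.add_apply, PiLp.smul_apply, PiLp.sub_apply, smul_eq_mul]
      field_simp; linarith
    · simp only [Fin.mk_one, PiLp.add_apply, PiLp.smul_apply, PiLp.sub_apply, smul_eq_mul]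
      field_simp; linarith

/-- For close `a` and `b` the segment between them misses `R`, and the principal logarithm works.
Ratios multiply along chains of points, so logarithms add up, and the connected complement joins any
two points by such chains. -/
lemma exists_log_ratio {R : Set Plane} (hR : IsClosed R) (hc : IsPreconnected Rᶜ) {a b : Plane}
    (ha : a ∈ Rᶜ) (hb : b ∈ Rᶜ) :
    ∃ l : Plane → ℂ, ContinuousOn l R ∧ ∀ z ∈ R, Complex.exp (l z) = ratio a b z := by
  have hsub : ∀ {z x : Plane}, z ∈ R → x ∈ Rᶜ → toComplex z - toComplex x ≠ 0 := by
    intro z x hz hx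
    rw [sub_ne_zero]
    exact toComplex_injective.ne fun h => hx (h ▸ hz)
  refine hc.induction₂ (fun a b => ∃ l : Plane → ℂ, ContinuousOn l R ∧
    ∀ z ∈ R, Complex.exp (l z) = ratio a b z) ?_ ?_ ?_ ha hb
  · intro x hx
    obtain ⟨r, hr, hball⟩ := Metric.isOpen_iff.1 hR.isOpen_compl x hx
    refine eventually_nhdsWithin_of_eventually_nhds ?_
    filter_upwards [Metric.ball_mem_nhds x hr] with y hy
    have hz : ∀ z ∈ R, z ∉ segment ℝ x y := fun z hz hs =>
      hball ((convex_ball x r).segment_subset (Metric.mem_ball_self hr) hy hs) hz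
    refine ⟨fun z => Complex.log (ratio x y z), fun z hzR => ?_, fun z hzR => ?_⟩
    · exact ((continuousAt_ratio (b := y) fun h => hz z hzR (by rw [h]; exact right_mem_segment _ _ _)).clog
        (ratio_mem_slitPlane (hz z hzR))).continuousWithinAt
    · exact Complex.exp_log (Complex.slitPlane_ne_zero (ratio_mem_slitPlane (hz z hzR)))
  · rintro x y w hx hy hw ⟨l1, hc1, he1⟩ ⟨l2, hc2, he2⟩
    refine ⟨fun z => l1 z + l2 z, hc1.add hc2, fun z hz => ?_⟩
    rw [Complex.exp_add, he1 z hz, he2 z hz, ratio, ratio, ratio,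
      div_mul_div_cancel₀ (hsub hz hy)]
  · rintro x y hx hy ⟨l, hcl, he⟩
    refine ⟨fun z => -l z, hcl.neg, fun z hz => ?_⟩
    rw [Complex.exp_neg, he z hz, ratio, ratio, inv_div]

lemma ratio_im {a b z w : Plane} (hw : w ∈ segment ℝ a b) :
    (ratio a b z).im =
      -cross (b - a) (z - w) / Complex.normSq (toComplex z - toComplex b) := by
  obtain ⟨t, -, -, rfl⟩ := mem_segment_iff_exists.1 hw
  rw [ratio, Complex.div_im, ← sub_div]
  congr 1
  simp [cross]
  ring

/-- A segment joining two points outside of a closed set with connected complement separates the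
set: some function that is locally constant off the segment jumps across it. -/
lemma exists_separating_function {R : Set Plane} (hR : IsClosed R) (hc : IsPreconnected Rᶜ)
    {a b w : Plane} (ha : a ∈ Rᶜ) (hb : b ∈ Rᶜ) (hw : w ∈ openSegment ℝ a b) (hwR : R ∈ 𝓝 w) :
    ∃ G : Plane → ℝ, ContinuousOn G (R \ segment ℝ a b) ∧
      (∀ z ∈ R \ segment ℝ a b, ∃ k : ℤ, G z = k) ∧
      ∃ V ∈ 𝓝 w, ∀ z ∈ V, ∀ z' ∈ V, 0 < cross (b - a) (z - w) → cross (b - a) (z' - w) < 0 →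
        G z ≠ G z' := by
  obtain ⟨l, hlc, hle⟩ := exists_log_ratio hR hc ha hb
  have hpi := Real.pi_pos
  have hwb : w ≠ b := fun h => hb (h ▸ mem_of_mem_nhds hwR)
  -- Two arguments of the same number: the principal one, continuous off the segment, and the global
  -- branch, continuous on `R`. They differ by multiples of `2π`.
  refine ⟨fun z => (Complex.arg (ratio a b z) - (l z).im) / (2 * Real.pi), ?_, ?_, ?_⟩
  · refine ContinuousOn.div_const (ContinuousOn.sub (fun z hz => ?_) ?_) _
    · exact ((Complex.continuousAt_arg (ratio_mem_slitPlane hz.2)).comp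
        (continuousAt_ratio fun h => hz.2 (h ▸ right_mem_segment _ _ _))).continuousWithinAt
    · exact Complex.continuous_im.comp_continuousOn (hlc.mono sdiff_subset)
  · intro z hz
    have h1 : Complex.exp (Complex.log (ratio a b z) - l z) = 1 := by
      have hne := Complex.slitPlane_ne_zero (ratio_mem_slitPlane hz.2)
      rw [Complex.exp_sub, Complex.exp_log hne, hle z hz.1, div_self hne]
    obtain ⟨k, hk⟩ := Complex.exp_eq_one_iff.1 h1
    refine ⟨k, ?_⟩
    have := congrArg Complex.im hk
    simp [Complex.log_im] at this
    change ((ratio a b z).arg - (l z).im) / (2 * Real.pi) = k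
    rw [this]
    field_simp
  · have hlw : ContinuousAt (fun z => (l z).im) w :=
      Complex.continuous_im.continuousAt.comp (hlc.continuousAt hwR)
    -- On the open segment the ratio is a negative real number, where the principal argument jumps.
    have hre : (ratio a b w).re < 0 := by
      obtain ⟨t, h0, h1, rfl⟩ := mem_openSegment_iff_exists.1 hw
      have hM : toComplex b - toComplex a ≠ 0 := by
        rw [sub_ne_zero]
        refine toComplex_injective.ne fun h => hwb ?_
        rw [h]; simp
      have h1' : (1 - t : ℂ) ≠ 0 := by
        have : (1 - t : ℝ) ≠ 0 := by linarith
        exact_mod_cast this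
      have e1 : toComplex (a + t • (b - a)) - toComplex a = t * (toComplex b - toComplex a) := by
        apply Complex.ext <;> simp
      have e2 : toComplex (a + t • (b - a)) - toComplex b
          = -(1 - t) * (toComplex b - toComplex a) := by
        apply Complex.ext <;> simp <;> ring
      have e3 : ratio a b (a + t • (b - a)) = ((-(t / (1 - t)) : ℝ) : ℂ) := by
        rw [ratio, e1, e2, mul_div_mul_right _ _ hM]
        push_cast
        field_simp
      rw [e3, Complex.ofReal_re]
      have := div_pos h0 (by linarith : 0 < 1 - t)
      linarith
    have hre' : ∀ᶠ z in 𝓝 w, (ratio a b z).re < 0 :=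
      (Complex.continuous_re.continuousAt.comp (continuousAt_ratio hwb)).eventually
        (gt_mem_nhds hre)
    have hl' : ∀ᶠ z in 𝓝 w, |(l z).im - (l w).im| < Real.pi / 4 := by
      have := Metric.tendsto_nhds.1 hlw (Real.pi / 4) (by positivity)
      simpa [Real.dist_eq] using this
    refine ⟨_, hre'.and hl', ?_⟩
    rintro z ⟨hz1, hz2⟩ z' ⟨hz1', hz2'⟩ hp hn heq
    have hn0 : ∀ z, (ratio a b z).re < 0 → 0 < Complex.normSq (toComplex z - toComplex b) := by
      intro z hz
      rw [Complex.normSq_pos]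
      intro h0
      simp [ratio, h0] at hz
    have hws := openSegment_subset_segment ℝ _ _ hw
    have him : (ratio a b z).im < 0 := by
      rw [ratio_im hws]
      exact div_neg_of_neg_of_pos (by linarith) (hn0 z hz1)
    have him' : 0 < (ratio a b z').im := by
      rw [ratio_im hws]
      exact div_pos (by linarith) (hn0 z' hz1')
    -- The principal arguments at `z` and `z'` differ by more than `π`, the imaginary parts of `l`
    -- by less than `π / 2`.
    have ha1 : Complex.arg (ratio a b z) < -(Real.pi / 2) := by
      have h1 := Complex.arg_neg_iff.2 him
      have h2 := mt Complex.abs_arg_le_pi_div_two_iff.1 (not_le.2 hz1)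
      rw [not_le, abs_of_neg h1] at h2
      linarith
    have ha2 : Real.pi / 2 < Complex.arg (ratio a b z') := by
      have h1 := Complex.arg_nonneg_iff.2 him'.le
      have h2 := mt Complex.abs_arg_le_pi_div_two_iff.1 (not_le.2 hz1')
      rw [not_le, abs_of_nonneg h1] at h2
      linarith
    have h2pi : (2 * Real.pi) ≠ 0 := by positivity
    rw [div_left_inj' h2pi] at heq
    rw [abs_lt] at hz2 hz2'
    linarith [hz2.1, hz2.2, hz2'.1, hz2'.2]

/-- A continuous integer-valued function is constant on preconnected sets. -/
lemma eq_of_isPreconnected_of_int {C R : Set Plane} {G : Plane → ℝ} (hC : IsPreconnected C)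
    (hCR : C ⊆ R) (hG : ContinuousOn G R) (hint : ∀ z ∈ R, ∃ k : ℤ, G z = k) {z z' : Plane}
    (hz : z ∈ C) (hz' : z' ∈ C) : G z = G z' := by
  have key : ∀ x ∈ C, ∀ y ∈ C, ¬ G x < G y := by
    intro x hx y hy hlt
    obtain ⟨k, hk⟩ := hint x (hCR hx)
    obtain ⟨m, hm⟩ := hint y (hCR hy)
    have hkm : k + 1 ≤ m := by
      rw [hk, hm] at hlt
      exact_mod_cast hlt
    have hkm' : (k : ℝ) + 1 ≤ m := by exact_mod_cast hkm
    have hmem : (k : ℝ) + 1 / 2 ∈ Icc (G x) (G y) := by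
      rw [hk, hm]; constructor <;> linarith
    obtain ⟨w, hw, hwG⟩ := hC.intermediate_value hx hy (hG.mono hCR) hmem
    obtain ⟨j, hj⟩ := hint w (hCR hw)
    rw [hj] at hwG
    have h1 : (k : ℝ) < j := by linarith
    have h2 : (j : ℝ) < k + 1 := by linarith
    have h1' : k < j := by exact_mod_cast h1
    have h2' : j < k + 1 := by exact_mod_cast h2
    omega
  exact le_antisymm (not_lt.1 (key z' hz' z hz)) (not_lt.1 (key z hz z' hz'))

/-! ### The polygon in a slab without vertices -/


/-- The open slab between two parallels to `d`. -/
def slab (d : Plane) (x₀ x₁ : ℝ) : Set Plane := {z | x₀ < cross d z ∧ cross d z < x₁}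

lemma convex_slab (d : Plane) (x₀ x₁ : ℝ) : Convex ℝ (slab d x₀ x₁) :=
  (convex_cross_pos d x₀).inter (convex_cross_neg d x₁)

lemma isOpen_slab (d : Plane) (x₀ x₁ : ℝ) : IsOpen (slab d x₀ x₁) :=
  (isOpen_lt continuous_const (continuous_cross d)).inter
    (isOpen_lt (continuous_cross d) continuous_const)

/-- Edge `k` crosses the whole slab. -/
def Spans (p : Polygon Plane n) (d : Plane) (x₀ x₁ : ℝ) (k : Fin n) : Prop :=
  (cross d (p k) ≤ x₀ ∧ x₁ ≤ cross d (p (k + 1))) ∨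
    (x₁ ≤ cross d (p k) ∧ cross d (p (k + 1)) ≤ x₀)

variable {d : Plane} {x₀ x₁ : ℝ}

lemma cross_segment (d a b : Plane) (t : ℝ) :
    cross d (a + t • (b - a)) = cross d a + t * (cross d b - cross d a) := by
  rw [cross_add_right, cross_smul_right, cross_sub_right]

/-- The level is affine along an edge; an edge with a point in the slab but no endpoint there has
its endpoints on opposite sides of the slab. -/
lemma spans_of_mem (hv : ∀ i, p i ∉ slab d x₀ x₁) {k : Fin n} {z : Plane}
    (hz : z ∈ slab d x₀ x₁) (hk : z ∈ segment ℝ (p k) (p (k + 1))) :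
    Spans p d x₀ x₁ k ∧ z ∈ openSegment ℝ (p k) (p (k + 1)) := by
  refine ⟨?_, mem_openSegment_of_ne_left_right (fun h => hv k (h ▸ hz))
    (fun h => hv (k + 1) (h ▸ hz)) hk⟩
  obtain ⟨t, h0, h1, rfl⟩ := mem_segment_iff_exists.1 hk
  obtain ⟨ha, hb⟩ := hz
  rw [cross_segment] at ha hb
  have h2 := hv k
  have h3 := hv (k + 1)
  simp only [slab, mem_ofPred_eq, not_and, not_lt] at h2 h3
  unfold Spans
  set A := cross d (p k)
  set B := cross d (p (k + 1))
  rcases le_or_gt A x₀ with hA | hA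
  · left
    refine ⟨hA, h3 ?_⟩
    by_contra hB
    nlinarith
  · right
    refine ⟨h2 hA, ?_⟩
    by_contra hB
    have := h3 (not_le.1 hB)
    have := h2 hA
    nlinarith

lemma IsSimple.exists_eq_of_side_eq_zero (h : IsSimple p) {k : Fin n} {z : Plane} (hs : side p k z = 0) :
    ∃ t : ℝ, z = p k + t • (p (k + 1) - p k) := by
  obtain ⟨t, ht⟩ := exists_smul_of_cross_eq_zero (h.edge_ne_zero k) hs
  exact ⟨t, by rw [← ht]; simp⟩

lemma Spans.mem_openSegment (h : IsSimple p) {k : Fin n} (hk : Spans p d x₀ x₁ k)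
    {z : Plane} (hz : z ∈ slab d x₀ x₁) (hs : side p k z = 0) :
    z ∈ openSegment ℝ (p k) (p (k + 1)) := by
  obtain ⟨t, rfl⟩ := h.exists_eq_of_side_eq_zero hs
  obtain ⟨ha, hb⟩ := hz
  rw [cross_segment] at ha hb
  refine mem_openSegment_iff_exists.2 ⟨t, ?_, ?_, rfl⟩ <;>
  rcases hk with ⟨h1, h2⟩ | ⟨h1, h2⟩ <;> by_contra hcon <;> nlinarith

lemma Spans.mem_segment (h : IsSimple p) {k : Fin n} (hk : Spans p d x₀ x₁ k) (hx : x₀ < x₁)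
    {z : Plane} (hz : x₀ ≤ cross d z ∧ cross d z ≤ x₁) (hs : side p k z = 0) :
    z ∈ segment ℝ (p k) (p (k + 1)) := by
  obtain ⟨t, rfl⟩ := h.exists_eq_of_side_eq_zero hs
  obtain ⟨ha, hb⟩ := hz
  rw [cross_segment] at ha hb
  refine mem_segment_iff_exists.2 ⟨t, ?_, ?_, rfl⟩ <;>
  rcases hk with ⟨h1, h2⟩ | ⟨h1, h2⟩ <;> by_contra hcon <;> nlinarith

/-- Within the slab, the line of a spanning edge is the edge itself, and near it the polygon lies on
the nonnegative side. So a connected part of the polygon cannot change sides. -/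
lemma IsSimple.side_nonneg_iff (h : IsSimple p) (hccw : IsCounterclockwise p) {C : Set Plane}
    (hC : IsPreconnected C) (hCS : C ⊆ region p ∩ slab d x₀ x₁) {k : Fin n}
    (hk : Spans p d x₀ x₁ k) {z z' : Plane} (hz : z ∈ C) (hz' : z' ∈ C) :
    0 ≤ side p k z ↔ 0 ≤ side p k z' := by
  refine iff_of_isPreconnected hC (fun z => 0 ≤ side p k z) (fun x hx => ?_) hz hz'
  rcases lt_trichotomy (side p k x) 0 with h0 | h0 | h0
  · filter_upwards [(continuous_side p k).continuousAt.eventually (gt_mem_nhds h0)] with y hy _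
    simp [not_le.2 h0, not_le.2 hy]
  · filter_upwards [h.eventually_edge hccw (hk.mem_openSegment h (hCS hx).2 h0)] with y hy hyC
    simp [h0, hy.1.1 (hCS hyC).1]
  · filter_upwards [(continuous_side p k).continuousAt.eventually (lt_mem_nhds h0)] with y hy _
    simp [h0.le, hy.le]

/-- Connected parts of the polygon in a slab without vertices span convex parts. -/
lemma IsSimple.segment_subset_of_slab (h : IsSimple p) (hccw : IsCounterclockwise p)
    (hv : ∀ i, p i ∉ slab d x₀ x₁) {C : Set Plane} (hC : IsPreconnected C)
    (hCS : C ⊆ region p ∩ slab d x₀ x₁) {z z' : Plane} (hz : z ∈ C) (hz' : z' ∈ C) :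
    segment ℝ z z' ⊆ region p := by
  intro w hw
  -- Membership in the polygon is shown to be locally constant along the segment.
  refine (iff_of_isPreconnected (isPreconnected_segment z z') (fun w => w ∈ region p)
    (fun x hx => ?_) (left_mem_segment ℝ z z') hw).1 (hCS hz).1
  by_cases hxR : x ∈ region p
  · rcases hxR with hxb | hxi
    · obtain ⟨k, hk⟩ := mem_boundary_iff.1 hxb
      have hxS := (convex_slab d x₀ x₁).segment_subset (hCS hz).2 (hCS hz').2 hx
      obtain ⟨hsp, ho⟩ := spans_of_mem hv hxS hk
      have hiff := h.side_nonneg_iff hccw hC hCS hsp hz hz'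
      -- `z` and `z'` lie on the same side of edge `k`. Were it the negative one, the segment could
      -- not touch the edge at `x`.
      have hz0 : 0 ≤ side p k z := by
        by_contra hcon
        have hneg := (convex_side_neg p k).segment_subset (not_le.1 hcon)
          (not_le.1 (mt hiff.2 hcon)) hx
        have hneg : side p k x < 0 := hneg
        exact hneg.ne (side_of_mem_edge hk)
      filter_upwards [h.eventually_edge hccw ho] with y hy hys
      have := (convex_side_nonneg p k).segment_subset hz0 (hiff.1 hz0) hys
      simp [boundary_subset_region hxb, hy.1.2 this]
    · filter_upwards [isOpen_inside.mem_nhds hxi] with y hy _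
      simp [inside_subset_region hxi, inside_subset_region hy]
  · filter_upwards [isOpen_compl_region.mem_nhds hxR] with y hy _
    simp only [hxR, false_iff]
    exact hy

/-- The connected component of `z` in the part of the polygon in a slab. -/
def cell (p : Polygon Plane n) (d : Plane) (x₀ x₁ : ℝ) (z : Plane) : Set Plane :=
  connectedComponentIn (region p ∩ slab d x₀ x₁) z

lemma cell_subset {z : Plane} : cell p d x₀ x₁ z ⊆ region p ∩ slab d x₀ x₁ :=
  connectedComponentIn_subset _ _

lemma isPreconnected_cell {z : Plane} : IsPreconnected (cell p d x₀ x₁ z) :=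
  isPreconnected_connectedComponentIn

lemma subset_cell {z : Plane} {C : Set Plane} (hC : IsPreconnected C)
    (hCS : C ⊆ region p ∩ slab d x₀ x₁) (hne : (C ∩ cell p d x₀ x₁ z).Nonempty) :
    C ⊆ cell p d x₀ x₁ z := by
  obtain ⟨w, hw, hw'⟩ := hne
  rw [cell, connectedComponentIn_eq hw']
  exact hC.subset_connectedComponentIn hw hCS

lemma IsSimple.convex_cell (h : IsSimple p) (hccw : IsCounterclockwise p)
    (hv : ∀ i, p i ∉ slab d x₀ x₁) (z : Plane) : Convex ℝ (cell p d x₀ x₁ z) := by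
  rw [convex_iff_segment_subset]
  intro a ha b hb
  exact subset_cell (isPreconnected_segment a b)
    (subset_inter (h.segment_subset_of_slab hccw hv isPreconnected_cell cell_subset ha hb)
      ((convex_slab d x₀ x₁).segment_subset (cell_subset ha).2 (cell_subset hb).2))
    ⟨a, left_mem_segment _ _ _, ha⟩

/-- Cells are open in the polygon. -/
lemma IsSimple.eventually_mem_cell (h : IsSimple p) (hccw : IsCounterclockwise p)
    (hv : ∀ i, p i ∉ slab d x₀ x₁) {z w : Plane} (hw : w ∈ cell p d x₀ x₁ z) :
    ∀ᶠ y in 𝓝 w, y ∈ region p → y ∈ cell p d x₀ x₁ z := by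
  obtain ⟨hwR, hwS⟩ := cell_subset hw
  have key : ∀ A : Set Plane, Convex ℝ A → w ∈ A → (∀ᶠ y in 𝓝 w, y ∈ region p ↔ y ∈ A) →
      ∀ᶠ y in 𝓝 w, y ∈ region p → y ∈ cell p d x₀ x₁ z := by
    intro A hA hwA hev
    obtain ⟨r, hr, hball⟩ := Metric.eventually_nhds_iff_ball.1
      (hev.and ((isOpen_slab d x₀ x₁).mem_nhds hwS))
    have hsub := subset_cell (C := Metric.ball w r ∩ A) (z := z)
      ((convex_ball w r).inter hA).isPreconnected
      (fun y hy => ⟨(hball y hy.1).1.2 hy.2, (hball y hy.1).2⟩)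
      ⟨w, ⟨Metric.mem_ball_self hr, hwA⟩, hw⟩
    filter_upwards [Metric.ball_mem_nhds w hr] with y hy hyR
    exact hsub ⟨hy, (hball y hy).1.1 hyR⟩
  rcases hwR with hwb | hwi
  · obtain ⟨k, hk⟩ := mem_boundary_iff.1 hwb
    obtain ⟨-, ho⟩ := spans_of_mem hv hwS hk
    refine key _ (convex_side_nonneg p k) (side_of_mem_edge hk).ge ?_
    filter_upwards [h.eventually_edge hccw ho] with y hy using hy.1
  · refine key univ convex_univ (mem_univ _) ?_
    filter_upwards [isOpen_inside.mem_nhds hwi] with y hy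
    simp [inside_subset_region hy]

lemma mem_cell_of_mem_closure {z w : Plane} (hw : w ∈ closure (cell p d x₀ x₁ z))
    (hwR : w ∈ region p ∩ slab d x₀ x₁) : w ∈ cell p d x₀ x₁ z := by
  have hpre : IsPreconnected (insert w (cell p d x₀ x₁ z)) :=
    isPreconnected_cell.subset_closure (subset_insert _ _) (insert_subset hw subset_closure)
  have hne : (cell p d x₀ x₁ z).Nonempty := closure_nonempty_iff.1 ⟨w, hw⟩
  obtain ⟨y, hy⟩ := hne
  exact subset_cell hpre (insert_subset hwR cell_subset) ⟨y, Or.inr hy, hy⟩ (mem_insert _ _)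


/-! ### Corners -/

/-- At vertex `i`, one of the two incident edges is edge `k` to vertex `j`, and the other one is
edge `k'` to vertex `j'`. -/
def IsCorner (i k j k' j' : Fin n) : Prop :=
  (k = i ∧ j = i + 1 ∧ k' = i - 1 ∧ j' = i - 1) ∨ (k = i - 1 ∧ j = i - 1 ∧ k' = i ∧ j' = i + 1)

namespace IsCorner

variable {i k j k' j' : Fin n}

lemma swap (hc : IsCorner i k j k' j') : IsCorner i k' j' k j := by
  rcases hc with ⟨h1, h2, h3, h4⟩ | ⟨h1, h2, h3, h4⟩
  · exact Or.inr ⟨h3, h4, h1, h2⟩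
  · exact Or.inl ⟨h3, h4, h1, h2⟩

lemma exists_next (hc : IsCorner i k j k' j') : ∃ k₃ j₃, IsCorner j k i k₃ j₃ := by
  rcases hc with ⟨rfl, rfl, -, -⟩ | ⟨rfl, rfl, -, -⟩
  · exact ⟨k + 1, k + 1 + 1, Or.inr ⟨by simp, by simp, rfl, rfl⟩⟩
  · exact ⟨i - 1 - 1, i - 1 - 1, Or.inl ⟨rfl, by simp, rfl, rfl⟩⟩

lemma side_self (hc : IsCorner i k j k' j') : side p k (p i) = 0 := by
  rcases hc with ⟨rfl, -, -, -⟩ | ⟨rfl, -, -, -⟩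
  · exact WatchmanTour.side_self p _
  · exact side_sub_one_self p i

lemma side_other (hc : IsCorner i k j k' j') : side p k (p j') = turn p i := by
  rcases hc with ⟨rfl, -, -, rfl⟩ | ⟨rfl, -, -, rfl⟩
  · exact side_pred p _
  · exact side_sub_one_succ p i

lemma segment_eq (hc : IsCorner i k j k' j') :
    segment ℝ (p i) (p j) = segment ℝ (p k) (p (k + 1)) := by
  rcases hc with ⟨rfl, rfl, -, -⟩ | ⟨rfl, rfl, -, -⟩
  · rfl
  · rw [sub_add_cancel, segment_symm]

lemma openSegment_eq (hc : IsCorner i k j k' j') :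
    openSegment ℝ (p i) (p j) = openSegment ℝ (p k) (p (k + 1)) := by
  rcases hc with ⟨rfl, rfl, -, -⟩ | ⟨rfl, rfl, -, -⟩
  · rfl
  · rw [sub_add_cancel, openSegment_symm]

lemma sub_eq (hc : IsCorner i k j k' j') (h : IsSimple p) (z : Plane) :
    z - p i = (side p k z / turn p i) • (p j' - p i) + (side p k' z / turn p i) • (p j - p i) := by
  rcases hc with ⟨rfl, rfl, rfl, rfl⟩ | ⟨rfl, rfl, rfl, rfl⟩
  · exact h.sub_vertex_eq _ z
  · rw [add_comm]; exact h.sub_vertex_eq _ z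

lemma cross_sub_eq (hc : IsCorner i k j k' j') (h : IsSimple p) (d z : Plane) :
    cross d z - cross d (p i) = side p k z / turn p i * (cross d (p j') - cross d (p i)) +
      side p k' z / turn p i * (cross d (p j) - cross d (p i)) := by
  have := congrArg (cross d) (hc.sub_eq h z)
  simpa only [cross_sub_right, cross_add_right, cross_smul_right] using this

lemma eventually_convex (hc : IsCorner i k j k' j') (h : IsSimple p) (hccw : IsCounterclockwise p)
    (hi : ¬ IsReflex p i) :
    ∀ᶠ z in 𝓝 (p i), z ∈ region p ↔ 0 ≤ side p k z ∧ 0 ≤ side p k' z := by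
  filter_upwards [h.eventually_convex hccw hi] with z hz
  rcases hc with ⟨rfl, rfl, rfl, rfl⟩ | ⟨rfl, rfl, rfl, rfl⟩
  · rw [hz, and_comm]
  · exact hz

lemma eventually_reflex (hc : IsCorner i k j k' j') (h : IsSimple p) (hccw : IsCounterclockwise p)
    (hi : IsReflex p i) :
    ∀ᶠ z in 𝓝 (p i), z ∈ region p ↔ 0 ≤ side p k z ∨ 0 ≤ side p k' z := by
  filter_upwards [h.eventually_reflex hccw hi] with z hz
  rcases hc with ⟨rfl, rfl, rfl, rfl⟩ | ⟨rfl, rfl, rfl, rfl⟩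
  · rw [hz, or_comm]
  · exact hz

/-- The hypothesis on edges parallel to `d`, in a form that is independent of the orientation of the
edge. -/
lemma not_both_reflex (hc : IsCorner i k j k' j')
    (hθ : ∀ i : Fin n, cross d (p (i + 1) - p i) = 0 → ¬ (IsReflex p i ∧ IsReflex p (i + 1)))
    (hX : cross d (p j) = cross d (p i)) : ¬ (IsReflex p i ∧ IsReflex p j) := by
  rcases hc with ⟨rfl, rfl, -, -⟩ | ⟨rfl, rfl, -, -⟩
  · exact hθ _ (by rw [cross_sub_right, hX, sub_self])
  · have := hθ (i - 1) (by rw [sub_add_cancel, cross_sub_right, hX, sub_self])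
    rw [sub_add_cancel] at this
    exact fun h => this h.symm

end IsCorner

/-! ### Obstacles between two parts of the polygon next to a chord -/

lemma frequently_of_mem_closure {C : Set Plane} {b : Plane} (hb : b ∈ closure C) :
    ∃ᶠ z in 𝓝 b, z ∈ C := mem_closure_iff_frequently.1 hb

/-- The first point on a segment where it leaves the polygon. -/
lemma IsSimple.exists_first_exit (h : IsSimple p) (hccw : IsCounterclockwise p)
    (hv : ∀ i, p i ∉ slab d x₀ x₁) {a b : Plane} (ha : a ∈ region p)
    (haS : a ∈ slab d x₀ x₁) (hab : cross d a = cross d b) (hnot : ¬ segment ℝ a b ⊆ region p) :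
    ∃ k u, u ∈ openSegment ℝ (p k) (p (k + 1)) ∧ Spans p d x₀ x₁ k ∧ cross d u = cross d a ∧
      segment ℝ a u ⊆ region p ∧ 0 ≤ side p k a ∧ side p k b < 0 := by
  let f : ℝ → Plane := fun t => a + t • (b - a)
  have hf : Continuous f := by simp only [f]; fun_prop
  have hfX : ∀ t, cross d (f t) = cross d a := fun t => by
    simp only [f, cross_segment]; rw [hab]; ring
  let B : Set ℝ := {t | 0 ≤ t ∧ t ≤ 1 ∧ f t ∉ region p}
  have hBne : B.Nonempty := by
    obtain ⟨z, hz, hzR⟩ := not_subset.1 hnot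
    obtain ⟨t, h0, h1, rfl⟩ := mem_segment_iff_exists.1 hz
    exact ⟨t, h0, h1, hzR⟩
  have hBb : BddBelow B := ⟨0, fun t ht => ht.1⟩
  -- The segment stays in the polygon up to `τ` and has points outside of it arbitrarily soon
  -- afterwards.
  set τ := sInf B with hτ
  have hglb : IsGLB B τ := isGLB_csInf hBne hBb
  have hτ0 : 0 ≤ τ := le_csInf hBne fun t ht => ht.1
  have hτ1 : τ ≤ 1 := by
    obtain ⟨t, ht⟩ := hBne
    exact (csInf_le hBb ht).trans ht.2.1
  have hlt : ∀ s, 0 ≤ s → s < τ → f s ∈ region p := by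
    intro s hs0 hs
    by_contra hcon
    exact absurd (csInf_le hBb ⟨hs0, hs.le.trans hτ1, hcon⟩) (not_le.2 hs)
  have huR : f τ ∈ region p := by
    rcases hτ0.eq_or_lt with h0 | h0
    · rw [← h0]; simpa [f] using ha
    · have hlim : Tendsto f (𝓝[<] τ) (𝓝 (f τ)) := (hf.tendsto τ).mono_left nhdsWithin_le_nhds
      refine isClosed_region.mem_of_tendsto hlim ?_
      filter_upwards [Ioo_mem_nhdsLT h0] with s hs using hlt s hs.1.le hs.2
  have hfreq : ∀ V ∈ 𝓝 (f τ), ∃ t ∈ B, τ < t ∧ f t ∈ V := by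
    intro V hV
    obtain ⟨δ, hδ, hball⟩ := Metric.mem_nhds_iff.1 (hf.continuousAt.preimage_mem_nhds hV)
    obtain ⟨t, htB, ht1, ht2⟩ := hglb.exists_between (lt_add_of_pos_right τ hδ)
    refine ⟨t, htB, lt_of_le_of_ne ht1 fun h' => htB.2.2 (h' ▸ huR), hball ?_⟩
    rw [Metric.mem_ball, Real.dist_eq, abs_of_nonneg (by linarith)]
    linarith
  have huS : f τ ∈ slab d x₀ x₁ := by
    simp only [slab, mem_ofPred_eq, hfX]; exact haS
  have hub : f τ ∈ p.boundary ℝ := by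
    rcases huR with hb | hi
    · exact hb
    · obtain ⟨t, htB, -, ht⟩ := hfreq _ (isOpen_inside.mem_nhds hi)
      exact absurd (inside_subset_region ht) htB.2.2
  obtain ⟨k, hk⟩ := mem_boundary_iff.1 hub
  obtain ⟨hsp, ho⟩ := spans_of_mem hv huS hk
  obtain ⟨t, htB, htτ, ht⟩ := hfreq _ (h.eventually_edge hccw ho)
  have hs1 : side p k (f t) < 0 := by
    by_contra hcon
    exact htB.2.2 (ht.1.2 (not_lt.1 hcon))
  have hs0 := side_of_mem_edge hk
  simp only [f, side_segment] at hs0 hs1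
  have ht1 := htB.2.1
  have hc : side p k b - side p k a < 0 := by
    by_contra hcon
    nlinarith
  refine ⟨k, f τ, ho, hsp, hfX τ, ?_, by nlinarith, by nlinarith⟩
  intro z hz
  obtain ⟨s, h0, h1, rfl⟩ := mem_segment_iff_exists.1 hz
  have : a + s • (f τ - a) = f (s * τ) := by simp only [f, add_sub_cancel_left, smul_smul]
  rw [this]
  rcases (mul_le_of_le_one_left hτ0 h1).eq_or_lt with h2 | h2
  · rw [h2]; exact huR
  · exact hlt _ (mul_nonneg h0 hτ0) h2

/-- If two parts of the polygon lie on the same side of a common chord, but are separated there,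
then the chord passes through a reflex vertex with both edges on that side, and one of
these edges bounds the first part. -/
lemma IsSimple.exists_obstacle (h : IsSimple p) (hccw : IsCounterclockwise p)
    (hθ : ∀ i : Fin n, cross d (p (i + 1) - p i) = 0 → ¬ (IsReflex p i ∧ IsReflex p (i + 1)))
    (hx : x₀ < x₁) (hv : ∀ i, p i ∉ slab d x₀ x₁) {a b a' b' : Plane} {A B : Set Plane}
    (hab : segment ℝ a b ⊆ region p) (hXa : cross d a = x₀) (hXb : cross d b = x₀)
    (hA : IsPreconnected A) (hAS : A ⊆ region p ∩ slab d x₀ x₁) (haA : a ∈ closure A)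
    (hB : IsPreconnected B) (hBS : B ⊆ region p ∩ slab d x₀ x₁) (hbB : b ∈ closure B)
    (ha' : a' ∈ A) (hb' : b' ∈ B) (hX' : cross d a' = cross d b')
    (hnot : ¬ segment ℝ a' b' ⊆ region p) :
    ∃ i k j k' j', IsCorner i k j k' j' ∧ IsReflex p i ∧ cross d (p i) = x₀ ∧
      x₀ < cross d (p j) ∧ x₀ < cross d (p j') ∧ p i ∈ segment ℝ a b ∧
      ∃ u ∈ openSegment ℝ (p i) (p j), cross d u = cross d a' ∧ segment ℝ a' u ⊆ region p := by
  obtain ⟨k, u, huo, hsp, huX, hau, hka', hkb'⟩ :=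
    h.exists_first_exit hccw hv (hAS ha').1 (hAS ha').2 hX' hnot
  -- The exit edge `k` separates `A` from `B`. In the limit its line separates `a` from `b`, so it
  -- meets the chord in a point `v`, which lies on edge `k` since this edge spans the slab.
  have hAk : ∀ z ∈ A, 0 ≤ side p k z := fun z hz =>
    (h.side_nonneg_iff hccw hA hAS hsp ha' hz).1 hka'
  have hBk : ∀ z ∈ B, side p k z < 0 := fun z hz =>
    not_le.1 (mt (h.side_nonneg_iff hccw hB hBS hsp hb' hz).2 (not_le.2 hkb'))
  have hka : 0 ≤ side p k a :=
    closure_minimal hAk (isClosed_le continuous_const (continuous_side p k)) haA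
  have hkb : side p k b ≤ 0 :=
    closure_minimal (fun z hz => (hBk z hz).le)
      (isClosed_le (continuous_side p k) continuous_const) hbB
  obtain ⟨v, hvab, hvk⟩ := (isPreconnected_segment a b).intermediate_value
    (right_mem_segment _ _ _) (left_mem_segment _ _ _) (continuous_side p k).continuousOn
    ⟨hkb, hka⟩
  have hXab : ∀ z ∈ segment ℝ a b, cross d z = x₀ := by
    intro z hz
    obtain ⟨t, -, -, rfl⟩ := mem_segment_iff_exists.1 hz
    rw [cross_segment, hXa, hXb]; ring
  have hvX := hXab v hvab
  have hvk' : v ∈ segment ℝ (p k) (p (k + 1)) :=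
    hsp.mem_segment h hx (by rw [hvX]; exact ⟨le_rfl, hx.le⟩) hvk
  have hvb : segment ℝ v b ⊆ segment ℝ a b :=
    (convex_segment a b).segment_subset hvab (right_mem_segment _ _ _)
  -- `b` lies strictly below the line of the edge, or is the point `v`
  have hdich : side p k b < 0 ∨ b = v := by
    rcases hkb.lt_or_eq with h1 | h1
    · exact Or.inl h1
    · right
      obtain ⟨s, hs⟩ := h.exists_eq_of_side_eq_zero h1
      obtain ⟨t, ht⟩ := h.exists_eq_of_side_eq_zero hvk
      have e1 : cross d b = cross d v := by rw [hXb, hvX]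
      rw [hs, ht, cross_segment, cross_segment] at e1
      have hne : cross d (p (k + 1)) - cross d (p k) ≠ 0 := by
        rcases hsp with ⟨h2, h3⟩ | ⟨h2, h3⟩
        · intro h0; linarith
        · intro h0; linarith
      have hst : s = t := mul_right_cancel₀ hne (by linarith)
      rw [hs, ht, hst]
  have hray : side p k b < 0 → ∃ᶠ z in 𝓝 v, z ∈ region p ∧ side p k z < 0 ∧
      cross d z = x₀ := by
    intro hb0
    refine (tendsto_add_smul v (b - v)).frequently (Eventually.frequently ?_)
    filter_upwards [Ioo_mem_nhdsGT one_pos] with ε hε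
    have hmem : v + ε • (b - v) ∈ segment ℝ a b :=
      hvb (mem_segment_iff_exists.2 ⟨ε, hε.1.le, hε.2.le, rfl⟩)
    refine ⟨hab hmem, ?_, hXab _ hmem⟩
    rw [side_segment, hvk]
    have := mul_neg_of_pos_of_neg hε.1 hb0
    linarith
  -- Near `v` the polygon has points on the outer side of edge `k` that are not below the chord:
  -- points of the chord towards `b`, or of `B` if `b = v`. This forces `v` to be a reflex vertex.
  have hfreq : ∃ᶠ z in 𝓝 v, z ∈ region p ∧ side p k z < 0 ∧ x₀ ≤ cross d z ∧
      (b = v → x₀ < cross d z) := by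
    by_cases hbv : b = v
    · rw [← hbv]
      refine (frequently_of_mem_closure hbB).mono fun z hz => ?_
      exact ⟨(hBS hz).1, hBk z hz, (hBS hz).2.1.le, fun _ => (hBS hz).2.1⟩
    · exact (hray (hdich.resolve_right hbv)).mono fun z hz =>
        ⟨hz.1, hz.2.1, hz.2.2.ge, fun h' => absurd h' hbv⟩
  have hcorner : ∃ i j k' j', IsCorner i k j k' j' ∧ v = p i := by
    by_contra hcon
    push Not at hcon
    have h1 : v ≠ p k := hcon k (k + 1) (k - 1) (k - 1) (Or.inl ⟨rfl, rfl, rfl, rfl⟩)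
    have h2 : v ≠ p (k + 1) :=
      hcon (k + 1) k (k + 1) (k + 1 + 1) (Or.inr ⟨by simp, by simp, rfl, rfl⟩)
    have ho := mem_openSegment_of_ne_left_right h1.symm h2.symm hvk'
    obtain ⟨z, ⟨hz1, hz2, -, -⟩, hz3⟩ := (hfreq.and_eventually (h.eventually_edge hccw ho)).exists
    exact absurd (hz3.1.1 hz1) (not_le.2 hz2)
  obtain ⟨i, j, k', j', hc, hvi⟩ := hcorner
  subst hvi
  rw [← hc.openSegment_eq] at huo
  have hXj : x₀ < cross d (p j) := by
    rcases hc with ⟨rfl, rfl, -, -⟩ | ⟨rfl, rfl, -, -⟩ <;>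
    rcases hsp with ⟨h2, h3⟩ | ⟨h2, h3⟩ <;>
    (try simp only [sub_add_cancel] at *) <;> linarith
  have hrefl : IsReflex p i := by
    by_contra hcon
    obtain ⟨z, ⟨hz1, hz2, -, -⟩, hz3⟩ :=
      (hfreq.and_eventually (hc.eventually_convex h hccw hcon)).exists
    exact absurd (hz3.1 hz1).1 (not_le.2 hz2)
  have hT : turn p i < 0 := hrefl
  have hXj' : x₀ ≤ cross d (p j') ∧ (b = p i → x₀ < cross d (p j')) := by
    obtain ⟨z, ⟨hz1, hz2, hz3, hz4⟩, hz5⟩ :=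
      (hfreq.and_eventually (hc.eventually_reflex h hccw hrefl)).exists
    have hk' : 0 ≤ side p k' z := (hz5.1 hz1).resolve_left (not_le.2 hz2)
    have heq := hc.cross_sub_eq h d z
    rw [hvX] at heq
    have c1 : 0 < side p k z / turn p i := div_pos_of_neg_of_neg hz2 hT
    have c2 : side p k' z / turn p i ≤ 0 := div_nonpos_of_nonneg_of_nonpos hk' hT.le
    have c3 := mul_nonneg (neg_nonneg.2 c2) (sub_pos.2 hXj).le
    constructor
    · by_contra hcon
      have := mul_pos c1 (by linarith : 0 < x₀ - cross d (p j'))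
      linarith
    · intro hb
      have := hz4 hb
      by_contra hcon
      have := mul_nonneg c1.le (by linarith : 0 ≤ x₀ - cross d (p j'))
      linarith
  refine ⟨i, k, j, k', j', hc, hrefl, hvX, hXj, ?_, hvab, u, huo, huX, hau⟩
  refine lt_of_le_of_ne hXj'.1 fun hXeq => ?_
  -- the other edge is parallel to `d`
  have hbv : b ≠ p i := fun hb => (hXj'.2 hb).ne hXeq
  have hkb0 := hdich.resolve_right hbv
  have hk'side : ∀ z, x₀ < cross d z → side p k' z < 0 := by
    intro z hz
    have heq := hc.cross_sub_eq h d z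
    rw [hvX, ← hXeq, sub_self, mul_zero, zero_add] at heq
    by_contra hcon
    have c2 : side p k' z / turn p i ≤ 0 :=
      div_nonpos_of_nonneg_of_nonpos (not_lt.1 hcon) hT.le
    have c3 := mul_nonneg (neg_nonneg.2 c2) (sub_pos.2 hXj).le
    linarith
  have hk'0 : ∀ z, cross d z = x₀ → side p k' z = 0 := by
    intro z hz
    have heq := hc.cross_sub_eq h d z
    rw [hvX, ← hXeq, sub_self, mul_zero, zero_add, hz, sub_self] at heq
    have := (mul_eq_zero.1 heq.symm).resolve_right (sub_pos.2 hXj).ne'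
    exact (div_eq_zero_iff.1 this).resolve_right hT.ne
  -- Position of `b` along edge `k'`, which runs along the chord: `0` at `p i` and `1` at `p j'`.
  set c := side p k b / turn p i with hcdef
  have hc0 : 0 < c := div_pos_of_neg_of_neg hkb0 hT
  have hbeq : b = p i + c • (p j' - p i) := by
    have := hc.sub_eq h b
    rw [hk'0 b hXb, zero_div, zero_smul, add_zero] at this
    rw [← this]; simp
  have hBfreq := frequently_of_mem_closure hbB
  -- For `c < 1` the polygon lies below edge `k'` near `b`, against `B` being above. For `c ≥ 1` the
  -- vertex `p j'` is on the chord and convex by `hθ`: `c = 1` contradicts `B` again, and for `c >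
  -- 1` the chord would leave the polygon at `p j'`.
  rcases lt_or_ge c 1 with hc1 | hc1
  · have hbo : b ∈ openSegment ℝ (p k') (p (k' + 1)) := by
      rw [← hc.swap.openSegment_eq]
      exact mem_openSegment_iff_exists.2 ⟨c, hc0, hc1, hbeq⟩
    obtain ⟨z, hz1, hz2⟩ := (hBfreq.and_eventually (h.eventually_edge hccw hbo)).exists
    exact absurd (hz2.1.1 (hBS hz1).1) (not_le.2 (hk'side z (hBS hz1).2.1))
  · obtain ⟨k₃, j₃, hc3⟩ := hc.swap.exists_next
    refine hc.swap.not_both_reflex hθ (by rw [hvX, hXeq]) ⟨hrefl, ?_⟩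
    by_contra hconv
    have hev := hc3.eventually_convex h hccw hconv
    have hT' : 0 < turn p j' := (h.turn_ne_zero j').symm.lt_of_le (not_lt.1 hconv)
    rcases hc1.eq_or_lt with hc1 | hc1
    · have : b = p j' := by rw [hbeq, ← hc1]; simp
      rw [this] at hBfreq
      obtain ⟨z, hz1, hz2⟩ := (hBfreq.and_eventually hev).exists
      exact absurd (hz2.1 (hBS hz1).1).1 (not_le.2 (hk'side z (hBS hz1).2.1))
    · have hk3b : side p k₃ b < 0 := by
        have e1 : side p k₃ b = (1 - c) * turn p j' := by
          rw [hbeq, side_segment, hc3.swap.side_self, hc3.swap.side_other]; ring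
        rw [e1]
        exact mul_neg_of_neg_of_pos (by linarith) hT'
      have hj'mem : p j' ∈ segment ℝ (p i) b := by
        refine mem_segment_iff_exists.2 ⟨1 / c, by positivity, by
          rw [div_le_one hc0]; exact hc1.le, ?_⟩
        rw [hbeq, add_sub_cancel_left, smul_smul, one_div, inv_mul_cancel₀ hc0.ne', one_smul]
        simp
      have hsub : segment ℝ (p j') b ⊆ region p :=
        ((convex_segment _ _).segment_subset hj'mem (right_mem_segment _ _ _)).trans
          (hvb.trans hab)
      have hfr : ∃ᶠ z in 𝓝 (p j'), z ∈ region p ∧ side p k₃ z < 0 := by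
        refine (tendsto_add_smul (p j') (b - p j')).frequently (Eventually.frequently ?_)
        filter_upwards [Ioo_mem_nhdsGT one_pos] with ε hε
        refine ⟨hsub (mem_segment_iff_exists.2 ⟨ε, hε.1.le, hε.2.le, rfl⟩), ?_⟩
        rw [side_segment, hc3.swap.side_self]
        have := mul_neg_of_pos_of_neg hε.1 hk3b
        linarith
      obtain ⟨z, ⟨hz1, hz2⟩, hz3⟩ := (hfr.and_eventually hev).exists
      exact absurd (hz3.1 hz1).2 (not_le.2 hz2)


/-! ### The cell next to an edge at a colored vertex -/

lemma eventually_slab (p : Polygon Plane n) (d : Plane) (x₀ : ℝ) :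
    ∀ᶠ x₁ in 𝓝[>] x₀, ∀ i, p i ∉ slab d x₀ x₁ := by
  rw [eventually_all]
  intro i
  rcases le_or_gt (cross d (p i)) x₀ with hi | hi
  · exact Eventually.of_forall fun x₁ hx => absurd hx.1 (not_lt.2 hi)
  · filter_upwards [Ioo_mem_nhdsGT hi] with x₁ hx₁ hx
    exact absurd hx.2 (not_lt.2 hx₁.2.le)

/-- Both edges at the reflex vertex `i` leave the parallel to `d` through it to the positive side,
and there are no further vertices between this line and the level `x₁`. -/
structure IsCut (p : Polygon Plane n) (d : Plane) (x₁ : ℝ) (i k j k' j' : Fin n) : Prop where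
  simple : IsSimple p
  ccw : IsCounterclockwise p
  corner : IsCorner i k j k' j'
  reflex : IsReflex p i
  lt : cross d (p i) < cross d (p j)
  lt' : cross d (p i) < cross d (p j')
  lt_level : cross d (p i) < x₁
  no_vertex : ∀ l, p l ∉ slab d (cross d (p i)) x₁

/-- The point of the line through the vertices `i` and `j` at level `x`. -/
noncomputable def edgePoint (p : Polygon Plane n) (d : Plane) (i j : Fin n) (x : ℝ) : Plane :=
  p i + ((x - cross d (p i)) / (cross d (p j) - cross d (p i))) • (p j - p i)

/-- The part of the polygon next to the edge from vertex `i` to vertex `j`, below level `x₁`. -/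
noncomputable def cutCell (p : Polygon Plane n) (d : Plane) (x₁ : ℝ) (i j : Fin n) : Set Plane :=
  cell p d (cross d (p i)) x₁ (edgePoint p d i j ((cross d (p i) + x₁) / 2))

/-- A compact convex subset of a line with an extreme point `v` is a segment. -/
lemma exists_eq_segment {M : Set Plane} {v e : Plane} (hM : IsCompact M) (hconv : Convex ℝ M)
    (hv : v ∈ M) (hX : ∀ z ∈ M, cross d z = cross d v) (he : cross d e ≠ 0)
    (hs : ∀ z ∈ M, 0 ≤ cross e (z - v)) : ∃ b ∈ M, M = segment ℝ v b := by
  -- `cross e` is injective on the line, vanishes at `v` after the shift and is nonnegative on `M`;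
  -- the other end of the segment is where it is largest.
  obtain ⟨b, hb, hmax⟩ := hM.exists_isMaxOn ⟨v, hv⟩
    ((continuous_cross e).comp (continuous_id.sub continuous_const)).continuousOn
    (f := fun z => cross e (z - v))
  have hd : d ≠ 0 := by rintro rfl; simp [cross] at he
  refine ⟨b, hb, subset_antisymm (fun z hz => ?_) (hconv.segment_subset hv hb)⟩
  obtain ⟨s, hs'⟩ := exists_smul_of_cross_eq_zero hd
    (show cross d (z - v) = 0 by rw [cross_sub_right, hX z hz, sub_self])
  obtain ⟨t, ht'⟩ := exists_smul_of_cross_eq_zero hd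
    (show cross d (b - v) = 0 by rw [cross_sub_right, hX b hb, sub_self])
  have h1 := hs z hz
  have h2 : cross e (z - v) ≤ cross e (b - v) := hmax hz
  have hed : cross e d ≠ 0 := by rw [cross_swap]; simpa using he
  rw [hs', cross_smul_right] at h1
  rw [hs', ht', cross_smul_right, cross_smul_right] at h2
  by_cases ht : t = 0
  · subst ht
    have hs0 : s = 0 := by
      have : s * cross e d = 0 := by linarith
      exact (mul_eq_zero.1 this).resolve_right hed
    rw [hs0, zero_smul, sub_eq_zero] at hs'
    rw [hs']
    exact left_mem_segment _ _ _
  · have hte : 0 < t * cross e d := by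
      have : t * cross e d ≠ 0 := mul_ne_zero ht hed
      exact lt_of_le_of_ne (h1.trans h2) this.symm
    have hst : s / t = s * cross e d / (t * cross e d) := by field_simp
    refine mem_segment_iff_exists.2 ⟨s / t, ?_, ?_, ?_⟩
    · rw [hst]; exact div_nonneg h1 hte.le
    · rw [hst, div_le_one hte]; exact h2
    · rw [ht', smul_smul, div_mul_cancel₀ _ ht, ← hs']; simp

namespace IsCut

variable {i k j k' j' : Fin n}

lemma swap (D : IsCut p d x₁ i k j k' j') : IsCut p d x₁ i k' j' k j :=
  ⟨D.simple, D.ccw, D.corner.swap, D.reflex, D.lt', D.lt, D.lt_level, D.no_vertex⟩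

lemma turn_neg (D : IsCut p d x₁ i k j k' j') : turn p i < 0 := D.reflex

lemma level_le (D : IsCut p d x₁ i k j k' j') : x₁ ≤ cross d (p j) := by
  by_contra h
  exact D.no_vertex j ⟨D.lt, not_le.1 h⟩

lemma cross_edgePoint (D : IsCut p d x₁ i k j k' j') (x : ℝ) :
    cross d (edgePoint p d i j x) = x := by
  have : cross d (p j) - cross d (p i) ≠ 0 := (sub_pos.2 D.lt).ne'
  rw [edgePoint, cross_segment, div_mul_cancel₀ _ this]
  ring

lemma edgePoint_mem (D : IsCut p d x₁ i k j k' j') {x : ℝ} (h0 : cross d (p i) < x) (h1 : x < x₁) :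
    edgePoint p d i j x ∈ openSegment ℝ (p i) (p j) := by
  have h2 := D.level_le
  have h3 : 0 < cross d (p j) - cross d (p i) := sub_pos.2 D.lt
  refine mem_openSegment_iff_exists.2 ⟨_, div_pos (sub_pos.2 h0) h3, ?_, rfl⟩
  rw [div_lt_one h3]
  linarith

lemma edge_subset_region (D : IsCut p d x₁ i k j k' j') : segment ℝ (p i) (p j) ⊆ region p := by
  rw [D.corner.segment_eq]
  exact WatchmanTour.edge_subset_region k

lemma side_edge (D : IsCut p d x₁ i k j k' j') {z : Plane} (hz : z ∈ segment ℝ (p i) (p j)) :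
    side p k z = 0 := by
  rw [D.corner.segment_eq] at hz
  exact side_of_mem_edge hz

lemma mid_mem (D : IsCut p d x₁ i k j k' j') :
    cross d (p i) < (cross d (p i) + x₁) / 2 ∧ (cross d (p i) + x₁) / 2 < x₁ := by
  have := D.lt_level
  constructor <;> linarith

lemma mem_cell_of_mem_edge (D : IsCut p d x₁ i k j k' j') {z : Plane}
    (hz : z ∈ segment ℝ (p i) (p j)) (hzS : z ∈ slab d (cross d (p i)) x₁) :
    z ∈ cutCell p d x₁ i j := by
  have hm := D.edgePoint_mem D.mid_mem.1 D.mid_mem.2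
  have hms := openSegment_subset_segment ℝ _ _ hm
  have hmS : edgePoint p d i j ((cross d (p i) + x₁) / 2) ∈ slab d (cross d (p i)) x₁ := by
    simp only [slab, mem_ofPred_eq, D.cross_edgePoint]; exact D.mid_mem
  exact subset_cell (C := segment ℝ (p i) (p j) ∩ slab d (cross d (p i)) x₁)
    ((convex_segment _ _).inter (convex_slab _ _ _)).isPreconnected
    (inter_subset_inter_left _ D.edge_subset_region)
    ⟨_, ⟨hms, hmS⟩, mem_connectedComponentIn ⟨D.edge_subset_region hms, hmS⟩⟩ ⟨hz, hzS⟩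

lemma edgePoint_mem_cell (D : IsCut p d x₁ i k j k' j') {x : ℝ} (h0 : cross d (p i) < x)
    (h1 : x < x₁) : edgePoint p d i j x ∈ cutCell p d x₁ i j := by
  refine D.mem_cell_of_mem_edge (openSegment_subset_segment ℝ _ _ (D.edgePoint_mem h0 h1)) ?_
  simp only [slab, mem_ofPred_eq, D.cross_edgePoint]
  exact ⟨h0, h1⟩

lemma cell_subset (_ : IsCut p d x₁ i k j k' j') :
    cutCell p d x₁ i j ⊆ region p ∩ slab d (cross d (p i)) x₁ :=
  WatchmanTour.cell_subset

lemma convex_cell (D : IsCut p d x₁ i k j k' j') : Convex ℝ (cutCell p d x₁ i j) :=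
  D.simple.convex_cell D.ccw D.no_vertex _

lemma eventually_mem_cell (D : IsCut p d x₁ i k j k' j') {w : Plane}
    (hw : w ∈ cutCell p d x₁ i j) : ∀ᶠ y in 𝓝 w, y ∈ region p → y ∈ cutCell p d x₁ i j :=
  D.simple.eventually_mem_cell D.ccw D.no_vertex hw

lemma spans (D : IsCut p d x₁ i k j k' j') : Spans p d (cross d (p i)) x₁ k := by
  have hm := D.edgePoint_mem D.mid_mem.1 D.mid_mem.2
  have := openSegment_subset_segment ℝ _ _ hm
  rw [D.corner.segment_eq] at this
  refine (spans_of_mem D.no_vertex ?_ this).1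
  simp only [slab, mem_ofPred_eq, D.cross_edgePoint]
  exact D.mid_mem

lemma side_nonneg (D : IsCut p d x₁ i k j k' j') {z : Plane} (hz : z ∈ cutCell p d x₁ i j) :
    0 ≤ side p k z := by
  have hm := D.edgePoint_mem_cell D.mid_mem.1 D.mid_mem.2
  rw [← D.simple.side_nonneg_iff D.ccw isPreconnected_cell D.cell_subset D.spans hm hz]
  exact (D.side_edge (openSegment_subset_segment ℝ _ _
    (D.edgePoint_mem D.mid_mem.1 D.mid_mem.2))).ge

lemma side_nonneg_closure (D : IsCut p d x₁ i k j k' j') {z : Plane}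
    (hz : z ∈ closure (cutCell p d x₁ i j)) : 0 ≤ side p k z :=
  closure_minimal (fun _ => D.side_nonneg) (isClosed_le continuous_const (continuous_side p k)) hz

lemma closure_subset_region (D : IsCut p d x₁ i k j k' j') :
    closure (cutCell p d x₁ i j) ⊆ region p :=
  closure_minimal (fun _ hz => (D.cell_subset hz).1) isClosed_region

lemma cross_closure (D : IsCut p d x₁ i k j k' j') {z : Plane}
    (hz : z ∈ closure (cutCell p d x₁ i j)) : cross d (p i) ≤ cross d z :=
  closure_minimal (fun _ hz => (D.cell_subset hz).2.1.le)
    (isClosed_le continuous_const (continuous_cross d)) hz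

lemma mem_cell_of_mem_closure (_ : IsCut p d x₁ i k j k' j') {z : Plane}
    (hz : z ∈ closure (cutCell p d x₁ i j)) (hzR : z ∈ region p ∩ slab d (cross d (p i)) x₁) :
    z ∈ cutCell p d x₁ i j :=
  WatchmanTour.mem_cell_of_mem_closure hz hzR

lemma tendsto_edgePoint (_ : IsCut p d x₁ i k j k' j') :
    Tendsto (edgePoint p d i j) (𝓝[>] (cross d (p i))) (𝓝 (p i)) := by
  have hc : Continuous (edgePoint p d i j) := by unfold edgePoint; fun_prop
  have := (hc.tendsto (cross d (p i))).mono_left (nhdsWithin_le_nhds (s := Ioi (cross d (p i))))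
  simpa [edgePoint] using this

lemma frequently_edgePoint (D : IsCut p d x₁ i k j k' j') :
    ∃ᶠ z in 𝓝 (p i), z ∈ cutCell p d x₁ i j ∧ side p k z = 0 := by
  refine D.tendsto_edgePoint.frequently (Eventually.frequently ?_)
  filter_upwards [Ioo_mem_nhdsGT D.lt_level] with x hx
  exact ⟨D.edgePoint_mem_cell hx.1 hx.2,
    D.side_edge (openSegment_subset_segment ℝ _ _ (D.edgePoint_mem hx.1 hx.2))⟩

lemma vertex_mem_closure (D : IsCut p d x₁ i k j k' j') : p i ∈ closure (cutCell p d x₁ i j) :=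
  mem_closure_iff_frequently.2 (D.frequently_edgePoint.mono fun _ h => h.1)

/-- Near the vertex, the cell contains all points on the inner side of its edge. -/
lemma eventually_mem_cell_vertex (D : IsCut p d x₁ i k j k' j') :
    ∀ᶠ z in 𝓝 (p i), 0 ≤ side p k z → cross d (p i) < cross d z → z ∈ cutCell p d x₁ i j := by
  have hlt : ∀ᶠ z in 𝓝 (p i), cross d z < x₁ :=
    (continuous_cross d).continuousAt.eventually (gt_mem_nhds D.lt_level)
  obtain ⟨r, hr, hball⟩ := Metric.eventually_nhds_iff_ball.1
    ((D.corner.eventually_reflex D.simple D.ccw D.reflex).and hlt)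
  obtain ⟨u, ⟨hu1, hu2⟩, hu3⟩ :=
    (D.frequently_edgePoint.and_eventually (Metric.ball_mem_nhds _ hr)).exists
  have hsub := subset_cell (p := p)
    (C := Metric.ball (p i) r ∩ ({z | 0 ≤ side p k z} ∩ slab d (cross d (p i)) x₁))
    (z := edgePoint p d i j ((cross d (p i) + x₁) / 2))
    ((convex_ball _ r).inter ((convex_side_nonneg p k).inter (convex_slab _ _ _))).isPreconnected
    (fun z hz => ⟨(hball z hz.1).1.2 (Or.inl hz.2.1), hz.2.2⟩)
    ⟨u, ⟨hu3, hu2.ge, (D.cell_subset hu1).2⟩, hu1⟩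
  filter_upwards [Metric.ball_mem_nhds _ hr] with z hz h0 h1
  exact hsub ⟨hz, h0, h1, (hball z hz).2⟩

lemma isCompact_closure (D : IsCut p d x₁ i k j k' j') :
    IsCompact (closure (cutCell p d x₁ i j)) :=
  isCompact_region.of_isClosed_subset isClosed_closure D.closure_subset_region

lemma cross_edge_ne_zero (D : IsCut p d x₁ i k j k' j') : cross d (p (k + 1) - p k) ≠ 0 := by
  rw [cross_sub_right]
  have := D.lt_level
  rcases D.spans with ⟨h2, h3⟩ | ⟨h2, h3⟩
  · exact (by linarith : 0 < cross d (p (k + 1)) - cross d (p k)).ne'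
  · exact (by linarith : cross d (p (k + 1)) - cross d (p k) < 0).ne

/-- The sections of the closed cell are segments that start on the edge. -/
lemma exists_section (D : IsCut p d x₁ i k j k' j') {v : Plane}
    (hv : v ∈ closure (cutCell p d x₁ i j)) (hvs : side p k v = 0) :
    ∃ b, cross d b = cross d v ∧ b ∈ closure (cutCell p d x₁ i j) ∧
      closure (cutCell p d x₁ i j) ∩ {z | cross d z = cross d v} = segment ℝ v b := by
  have hconv : Convex ℝ {z : Plane | cross d z = cross d v} := by
    intro x hx y hy a b ha hb hab
    simp only [mem_ofPred_eq, cross_add_right, cross_smul_right] at *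
    rw [hx, hy, ← add_mul, hab, one_mul]
  obtain ⟨b, hb, hb'⟩ := exists_eq_segment (d := d) (e := p (k + 1) - p k)
    (D.isCompact_closure.inter_right (isClosed_eq (continuous_cross d) continuous_const))
    (D.convex_cell.closure.inter hconv) ⟨hv, rfl⟩ (fun z hz => hz.2) D.cross_edge_ne_zero
    (fun z hz => by
      have := D.side_nonneg_closure hz.1
      rw [side_eq p k z v, hvs, zero_add] at this
      exact this)
  exact ⟨b, hb.2, hb.1, hb'⟩

/-- The parallel to `d` at a small level separates the cell into two parts that are not connected
in the polygon without it. -/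
lemma exists_separation (D : IsCut p d x₁ i k j k' j') {x : ℝ} (h0 : cross d (p i) < x)
    (h1 : x < x₁) : ∃ (G : Plane → ℝ) (c₁ c₂ : ℤ), c₁ ≠ c₂ ∧
      ContinuousOn G (region p \ (cutCell p d x₁ i j ∩ {z | cross d z = x})) ∧
      (∀ z ∈ region p \ (cutCell p d x₁ i j ∩ {z | cross d z = x}), ∃ m : ℤ, G z = m) ∧
      (∀ z ∈ cutCell p d x₁ i j, x < cross d z → G z = c₁) ∧
      (∀ z ∈ cutCell p d x₁ i j, cross d z < x → G z = c₂) := by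
  set K := cutCell p d x₁ i j with hK
  set v := edgePoint p d i j x with hv
  have hvX : cross d v = x := D.cross_edgePoint x
  have hvo := D.edgePoint_mem h0 h1
  have hvK := D.edgePoint_mem_cell h0 h1
  rw [← hv] at hvo hvK
  have hvs : side p k v = 0 := D.side_edge (openSegment_subset_segment ℝ _ _ hvo)
  have hd : d ≠ 0 := by
    intro h; exact D.cross_edge_ne_zero (by rw [h]; simp [cross])
  obtain ⟨b, hbX, hbcl, hsec⟩ := D.exists_section (subset_closure hvK) hvs
  rw [hvX] at hbX hsec
  have hsecK : segment ℝ v b ⊆ K := by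
    intro z hz
    rw [← hsec] at hz
    have hzX : cross d z = x := hz.2
    exact D.mem_cell_of_mem_closure hz.1 ⟨D.closure_subset_region hz.1, by
      simp only [slab, mem_ofPred_eq, hzX]; exact ⟨h0, h1⟩⟩
  have hKsec : ∀ z ∈ K, cross d z = x → z ∈ segment ℝ v b := fun z hz hzX =>
    hsec ▸ ⟨subset_closure hz, hzX⟩
  have hedge := D.simple.eventually_edge D.ccw (D.corner.openSegment_eq ▸ hvo)
  have hvKev := D.eventually_mem_cell hvK
  -- the far end of the section lies on the inner side
  have hsb : 0 < side p k b := by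
    have hcd : cross (p (k + 1) - p k) d ≠ 0 := by
      rw [cross_swap]; simpa using D.cross_edge_ne_zero
    -- This displacement keeps the level and increases `side p k`, so the section contains more than
    -- `v`.
    have := (tendsto_add_smul v ((cross (p (k + 1) - p k) d) • d)).eventually (hedge.and hvKev)
    obtain ⟨ε, ⟨he1, he2⟩, he3⟩ := (this.and self_mem_nhdsWithin).exists
    have he3 : 0 < ε := he3
    have hpos : 0 < side p k (v + ε • (cross (p (k + 1) - p k) d) • d) := by
      rw [side_eq p k _ v, hvs, add_sub_cancel_left, cross_smul_right, cross_smul_right, zero_add]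
      have := mul_self_pos.2 hcd
      positivity
    have hz := hKsec _ (he2 (he1.1.2 hpos.le)) (by
      rw [cross_add_right, cross_smul_right, cross_smul_right, cross_self, hvX]; ring)
    obtain ⟨t, ht0, ht1, htz⟩ := mem_segment_iff_exists.1 hz
    rw [htz, side_segment, hvs, zero_add, sub_zero] at hpos
    by_contra hcon
    nlinarith
  set m := b - v with hm
  have hside : ∀ τ : ℝ, side p k (v + τ • m) = τ * side p k b := by
    intro τ; rw [hm, side_segment, hvs]; ring
  have hmX : cross d m = 0 := by rw [hm, cross_sub_right, hbX, hvX, sub_self]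
  have hbm : b = v + (1 : ℝ) • m := by rw [hm]; simp
  have hbK : b ∈ K := hsecK (right_mem_segment _ _ _)
  -- the section cannot be prolonged inside the polygon
  have hlow : ∀ᶠ τ : ℝ in 𝓝[>] 0, v + (-τ) • m ∉ region p := by
    have := (tendsto_add_smul v (-m)).eventually hedge
    filter_upwards [this, self_mem_nhdsWithin] with τ hτ hτ0 hR
    have hτ0 : 0 < τ := hτ0
    rw [smul_neg, ← neg_smul] at hτ
    have := hτ.1.1 hR
    rw [hside] at this
    nlinarith
  have hup : ∀ᶠ τ : ℝ in 𝓝[>] 0, v + (1 + τ) • m ∉ region p := by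
    have := (tendsto_add_smul b m).eventually (D.eventually_mem_cell hbK)
    filter_upwards [this, self_mem_nhdsWithin] with τ hτ hτ0 hR
    have hτ0 : 0 < τ := hτ0
    have heq : b + τ • m = v + (1 + τ) • m := by
      rw [add_smul, ← add_assoc, ← hbm]
    rw [heq] at hτ
    obtain ⟨t, -, ht1, htz⟩ := mem_segment_iff_exists.1 (hKsec _ (hτ hR) (by
      rw [cross_add_right, cross_smul_right, hmX, hvX]; ring))
    have := congrArg (side p k) htz
    rw [hside, ← hm, hside] at this
    have := mul_right_cancel₀ hsb.ne' this
    linarith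
  -- Short prolongations of the section beyond both ends lie outside of the polygon; prolonging by
  -- `q / 2` gives a segment `a' b'` with both ends outside, as `exists_separating_function`
  -- requires.
  obtain ⟨q, hq0, hq⟩ := mem_nhdsGT_iff_exists_Ioo_subset.1 (hlow.and hup)
  have hq0 : 0 < q := hq0
  set κ := q / 2 with hκ
  have hκ0 : 0 < κ := by positivity
  have hκ' : ∀ τ, 0 < τ → τ ≤ κ → v + (-τ) • m ∉ region p ∧ v + (1 + τ) • m ∉ region p :=
    fun τ h h' => hq ⟨h, by linarith⟩
  set a' := v + (-κ) • m with ha'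
  set b' := v + (1 + κ) • m with hb'
  have hba : b' - a' = (1 + 2 * κ) • m := by
    rw [ha', hb', add_sub_add_left_eq_sub, ← sub_smul]; congr 1; ring
  have hline : ∀ t : ℝ, a' + t • (b' - a') = v + (t * (1 + 2 * κ) - κ) • m := by
    intro t
    rw [hba, ha', smul_smul, add_assoc, ← add_smul]; congr 2; ring
  -- The prolonged segment meets the polygon only in the section.
  have hcov : region p \ (K ∩ {z | cross d z = x}) ⊆ region p \ segment ℝ a' b' := by
    rintro z ⟨hzR, hzK⟩
    refine ⟨hzR, fun hz => hzK ?_⟩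
    obtain ⟨t, ht0, ht1, rfl⟩ := mem_segment_iff_exists.1 hz
    rw [hline] at hzR ⊢
    set τ := t * (1 + 2 * κ) - κ with hτ
    have hτ1 : -κ ≤ τ := by rw [hτ]; nlinarith
    have hτ2 : τ ≤ 1 + κ := by rw [hτ]; nlinarith
    have hτ3 : 0 ≤ τ := by
      by_contra hcon
      have := (hκ' (-τ) (by linarith) (by linarith)).1
      rw [neg_neg] at this
      exact this hzR
    have hτ4 : τ ≤ 1 := by
      by_contra hcon
      have := (hκ' (τ - 1) (by linarith) (by linarith)).2
      rw [add_sub_cancel] at this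
      exact this hzR
    refine ⟨hsecK (mem_segment_iff_exists.2 ⟨τ, hτ3, hτ4, rfl⟩), ?_⟩
    simp only [mem_ofPred_eq]
    rw [cross_add_right, cross_smul_right, hmX, hvX]; ring
  -- a point of the section in the interior of the polygon
  obtain ⟨τ, ⟨hτe, hτ1⟩, hτ0⟩ := (((tendsto_add_smul v m).eventually hedge).and
    (nhdsWithin_le_nhds (gt_mem_nhds one_pos : ∀ᶠ τ : ℝ in 𝓝 0, τ < 1)) |>.and
    self_mem_nhdsWithin).exists
  have hτ0 : 0 < τ := hτ0
  set w := v + τ • m with hw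
  have hwin : w ∈ inside p := hτe.2 (by rw [hside]; positivity)
  have hwK : w ∈ K := hsecK (mem_segment_iff_exists.2 ⟨τ, hτ0.le, hτ1.le, rfl⟩)
  have hwR : region p ∈ 𝓝 w :=
    mem_of_superset (isOpen_inside.mem_nhds hwin) inside_subset_region
  have hwo : w ∈ openSegment ℝ a' b' := by
    have hpos : 0 < 1 + 2 * κ := by positivity
    refine mem_openSegment_iff_exists.2 ⟨(τ + κ) / (1 + 2 * κ), by positivity, ?_, ?_⟩
    · rw [div_lt_one hpos]; linarith
    · rw [hline, div_mul_cancel₀ _ hpos.ne', add_sub_cancel_right]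
  obtain ⟨G, hGc, hGi, V, hV, hGV⟩ := exists_separating_function isClosed_region
    isPreconnected_compl_region (hκ' κ hκ0 le_rfl).1 (hκ' κ hκ0 le_rfl).2 hwo hwR
  have hGc' := hGc.mono hcov
  have hGi' : ∀ z ∈ region p \ (K ∩ {z | cross d z = x}), ∃ m : ℤ, G z = m :=
    fun z hz => hGi z (hcov hz)
  have hwX : cross d w = x := by
    rw [hw, cross_add_right, cross_smul_right, hmX, hvX]; ring
  have hNV : ∀ e : Plane, ∃ ε : ℝ, 0 < ε ∧ w + ε • e ∈ V ∧ w + ε • e ∈ K ∧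
      w + ε • (-e) ∈ V ∧ w + ε • (-e) ∈ K := by
    intro e
    have hev : ∀ᶠ z in 𝓝 w, z ∈ V ∧ z ∈ K := by
      filter_upwards [hV, hwR, D.eventually_mem_cell hwK] with z hz1 hz2 hz3
      exact ⟨hz1, hz3 hz2⟩
    obtain ⟨ε, ⟨he1, he2⟩, he3⟩ := (((tendsto_add_smul w e).eventually hev).and
      ((tendsto_add_smul w (-e)).eventually hev) |>.and self_mem_nhdsWithin).exists
    exact ⟨ε, he3, he1.1, he1.2, he2.1, he2.2⟩
  -- The sign of `s` tells in which direction the section runs along `d`, hence which of its sides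
  -- is the upper one.
  obtain ⟨s, hs⟩ := exists_smul_of_cross_eq_zero hd hmX
  have hs0 : s ≠ 0 := by
    rintro rfl
    rw [zero_smul] at hs
    rw [hbm, hs, smul_zero, add_zero, hvs] at hsb
    exact hsb.false
  obtain ⟨e, heX⟩ : ∃ e : Plane, 0 < cross d e :=
    ⟨p j - p i, by rw [cross_sub_right]; exact sub_pos.2 D.lt⟩
  have hjump : ∃ z ∈ K, ∃ z' ∈ K, x < cross d z ∧ cross d z' < x ∧ G z ≠ G z' := by
    obtain ⟨ε, hε, h1, h2, h3, h4⟩ := hNV e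
    refine ⟨_, h2, _, h4, ?_, ?_, ?_⟩
    · rw [cross_add_right, cross_smul_right, hwX]
      have := mul_pos hε heX; linarith
    · rw [cross_add_right, cross_smul_right, cross_neg_right, hwX]
      have := mul_pos hε heX; linarith
    have hpos : 0 < (1 + 2 * κ) * (ε * cross d e) := by positivity
    have e1 : ∀ y : Plane, cross (b' - a') (w + ε • y - w) =
        s * ((1 + 2 * κ) * (ε * cross d y)) := by
      intro y
      rw [hba, hs, add_sub_cancel_left, cross_smul_left, cross_smul_left, cross_smul_right]
      ring
    rcases hs0.lt_or_gt with hs' | hs'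
    · refine (hGV _ h3 _ h1 ?_ ?_).symm
      · rw [e1, cross_neg_right]
        have := mul_neg_of_neg_of_pos hs' hpos
        linarith
      · rw [e1]
        exact mul_neg_of_neg_of_pos hs' hpos
    · refine hGV _ h1 _ h3 ?_ ?_
      · rw [e1]; exact mul_pos hs' hpos
      · rw [e1, cross_neg_right]
        have := mul_pos hs' hpos
        linarith
  obtain ⟨z, hz, z', hz', hzX, hz'X, hne⟩ := hjump
  obtain ⟨c₁, hc₁⟩ := hGi' z ⟨(D.cell_subset hz).1, fun h => hzX.ne' h.2⟩
  obtain ⟨c₂, hc₂⟩ := hGi' z' ⟨(D.cell_subset hz').1, fun h => hz'X.ne h.2⟩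
  refine ⟨G, c₁, c₂, ?_, hGc', hGi', ?_, ?_⟩
  · rintro rfl
    exact hne (hc₁.trans hc₂.symm)
  -- The parts of the cell above and below the section are convex, so `G` is constant on each.
  · intro y hy hyX
    rw [← hc₁]
    exact eq_of_isPreconnected_of_int (C := K ∩ {q | x < cross d q})
      (R := region p \ (K ∩ {z | cross d z = x}))
      (D.convex_cell.inter (convex_cross_pos d x)).isPreconnected
      (fun q hq => ⟨(D.cell_subset hq.1).1, fun h => (hq.2 : x < cross d q).ne' h.2⟩)
      hGc' hGi' ⟨hy, hyX⟩ ⟨hz, hzX⟩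
  · intro y hy hyX
    rw [← hc₂]
    exact eq_of_isPreconnected_of_int (C := K ∩ {q | cross d q < x})
      (R := region p \ (K ∩ {z | cross d z = x}))
      (D.convex_cell.inter (convex_cross_neg d x)).isPreconnected
      (fun q hq => ⟨(D.cell_subset hq.1).1, fun h => (hq.2 : cross d q < x).ne h.2⟩)
      hGc' hGi' ⟨hy, hyX⟩ ⟨hz', hz'X⟩

end IsCut


/-! ### Pockets cut off at a colored vertex -/

/-- The maximal segment parallel to `d` through `v` in the polygon. -/
def parallelChord (p : Polygon Plane n) (d v : Plane) : Set Plane :=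
  connectedComponentIn (region p ∩ {z | cross d z = cross d v}) v

lemma parallelChord_subset {v : Plane} :
    parallelChord p d v ⊆ region p ∩ {z | cross d z = cross d v} :=
  connectedComponentIn_subset _ _

lemma subset_parallelChord {v : Plane} {C : Set Plane} (hC : IsPreconnected C) (hv : v ∈ C)
    (hCR : C ⊆ region p) (hX : ∀ z ∈ C, cross d z = cross d v) : C ⊆ parallelChord p d v :=
  hC.subset_connectedComponentIn hv fun z hz => ⟨hCR hz, hX z hz⟩

lemma segment_subset_parallelChord {v w : Plane} (h : segment ℝ v w ⊆ region p)
    (hX : cross d w = cross d v) : segment ℝ v w ⊆ parallelChord p d v := by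
  refine subset_parallelChord (isPreconnected_segment _ _) (left_mem_segment _ _ _) h ?_
  intro z hz
  obtain ⟨t, -, -, rfl⟩ := mem_segment_iff_exists.1 hz
  rw [cross_segment, hX]; ring

lemma isPreconnected_ray (u w : Plane) (δ : ℝ) :
    IsPreconnected ((fun ε : ℝ => u + ε • w) '' Ico 0 δ) :=
  isPreconnected_Ico.image _ (by fun_prop)

lemma mem_closure_of_eventually {S : Set Plane} {y e : Plane} (he : 0 < cross d e)
    (hy : x₀ ≤ cross d y) (h : ∀ᶠ z in 𝓝 y, x₀ < cross d z → z ∈ S) : y ∈ closure S := by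
  refine mem_closure_iff_frequently.2
    ((tendsto_add_smul y e).frequently (Eventually.frequently ?_))
  filter_upwards [(tendsto_add_smul y e).eventually h, self_mem_nhdsWithin] with ε h1 h2
  have h2 : 0 < ε := h2
  refine h1 ?_
  rw [cross_add_right, cross_smul_right]
  have := mul_pos h2 he
  linarith

namespace IsCut

variable {i k j k' j' : Fin n}

lemma exists_pos (D : IsCut p d x₁ i k j k' j') : 0 < cross d (p j - p i) := by
  rw [cross_sub_right]; exact sub_pos.2 D.lt

lemma direction_ne_zero (D : IsCut p d x₁ i k j k' j') : d ≠ 0 := by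
  intro h
  have := D.exists_pos
  rw [h] at this
  simp [cross] at this

/-- The cut: the part of the chord that bounds the cell. -/
lemma exists_cut (D : IsCut p d x₁ i k j k' j') : ∃ b, cross d b = cross d (p i) ∧
    0 < side p k b ∧
    closure (cutCell p d x₁ i j) ∩ {z | cross d z = cross d (p i)} = segment ℝ (p i) b := by
  obtain ⟨b, hbX, -, hsec⟩ := D.exists_section D.vertex_mem_closure D.corner.side_self
  refine ⟨b, hbX, ?_, hsec⟩
  have hcd : cross (p (k + 1) - p k) d ≠ 0 := by
    rw [cross_swap]; simpa using D.cross_edge_ne_zero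
  -- A step along the chord to the inner side of edge `k` stays in the closed cell, so the cut is
  -- nondegenerate.
  obtain ⟨ε, he1, he2⟩ := (((tendsto_add_smul (p i) ((cross (p (k + 1) - p k) d) • d)).eventually
    D.eventually_mem_cell_vertex.eventually_nhds).and self_mem_nhdsWithin).exists
  have he2 : 0 < ε := he2
  set z := p i + ε • (cross (p (k + 1) - p k) d) • d with hz
  have hpos : 0 < side p k z := by
    rw [hz, side_eq p k _ (p i), D.corner.side_self, add_sub_cancel_left, cross_smul_right,
      cross_smul_right, zero_add]
    have := mul_self_pos.2 hcd
    positivity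
  have hzX : cross d z = cross d (p i) := by
    rw [hz, cross_add_right, cross_smul_right, cross_smul_right, cross_self]; ring
  have hzcl : z ∈ closure (cutCell p d x₁ i j) := by
    refine mem_closure_of_eventually D.exists_pos hzX.ge ?_
    filter_upwards [he1, (continuous_side p k).continuousAt.eventually (lt_mem_nhds hpos)]
      with y hy1 hy2 hy3 using hy1 hy2.le hy3
  have hzs : z ∈ segment ℝ (p i) b := hsec ▸ ⟨hzcl, hzX⟩
  obtain ⟨t, ht0, ht1, htz⟩ := mem_segment_iff_exists.1 hzs
  rw [htz, side_segment, D.corner.side_self] at hpos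
  by_contra hcon
  nlinarith

variable {b : Plane}

lemma cross_of_mem_cut (_ : IsCut p d x₁ i k j k' j')
    (hb : closure (cutCell p d x₁ i j) ∩ {z | cross d z = cross d (p i)} = segment ℝ (p i) b)
    {z : Plane} (hz : z ∈ segment ℝ (p i) b) : cross d z = cross d (p i) := by
  rw [← hb] at hz; exact hz.2

lemma cut_subset_region (D : IsCut p d x₁ i k j k' j')
    (hb : closure (cutCell p d x₁ i j) ∩ {z | cross d z = cross d (p i)} = segment ℝ (p i) b) :
    segment ℝ (p i) b ⊆ region p := by
  rw [← hb]; exact inter_subset_left.trans D.closure_subset_region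

lemma cut_subset_chord (D : IsCut p d x₁ i k j k' j')
    (hb : closure (cutCell p d x₁ i j) ∩ {z | cross d z = cross d (p i)} = segment ℝ (p i) b) :
    segment ℝ (p i) b ⊆ parallelChord p d (p i) :=
  segment_subset_parallelChord (D.cut_subset_region hb)
    (D.cross_of_mem_cut hb (right_mem_segment _ _ _))

/-- The part of the edge above the chord connects the cell to `p j` and avoids the cut. -/
lemma cell_subset_pocket (D : IsCut p d x₁ i k j k' j')
    (hb : closure (cutCell p d x₁ i j) ∩ {z | cross d z = cross d (p i)} = segment ℝ (p i) b) :
    cutCell p d x₁ i j ⊆ connectedComponentIn (region p \ segment ℝ (p i) b) (p j) := by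
  set E := segment ℝ (p i) (p j) ∩ {z | cross d (p i) < cross d z} with hE
  have hpre : IsPreconnected E :=
    ((convex_segment _ _).inter (convex_cross_pos d _)).isPreconnected
  have hKpre : IsPreconnected (cutCell p d x₁ i j) := isPreconnected_cell
  have hm := D.edgePoint_mem D.mid_mem.1 D.mid_mem.2
  have hmE : edgePoint p d i j ((cross d (p i) + x₁) / 2) ∈ E :=
    ⟨openSegment_subset_segment ℝ _ _ hm, by
      simp only [mem_ofPred_eq, D.cross_edgePoint]; exact D.mid_mem.1⟩
  have hun := hpre.union _ hmE (D.edgePoint_mem_cell D.mid_mem.1 D.mid_mem.2) hKpre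
  refine subset_trans subset_union_right (hun.subset_connectedComponentIn
    (Or.inl ⟨right_mem_segment _ _ _, D.lt⟩) ?_)
  rintro z (hz | hz)
  · exact ⟨D.edge_subset_region hz.1, fun hc =>
      (hz.2 : cross d (p i) < cross d z).ne' (D.cross_of_mem_cut hb hc)⟩
  · exact ⟨(D.cell_subset hz).1, fun hc =>
      (D.cell_subset hz).2.1.ne' (D.cross_of_mem_cut hb hc)⟩

/-- The part of the cell below level `x` can only be left through the section at level `x` or
through the cut. The vertex is on the lower side of the section. In the polygon without the cut, the
lower part only hangs on to the upper part, so replacing the value there by `c₁` removes the jump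
and gives a function that is constant on the pocket. -/
lemma exists_pocket_separation (D : IsCut p d x₁ i k j k' j')
    (hb : closure (cutCell p d x₁ i j) ∩ {z | cross d z = cross d (p i)} = segment ℝ (p i) b)
    {x : ℝ} (h0 : cross d (p i) < x) (h1 : x < x₁) : ∃ (G : Plane → ℝ) (c₁ c₂ : ℤ), c₁ ≠ c₂ ∧
      (∀ C, IsPreconnected C → C ⊆ region p \ (cutCell p d x₁ i j ∩ {z | cross d z = x}) →
        ∀ z ∈ C, ∀ z' ∈ C, G z = G z') ∧ G (p i) = c₂ ∧
      ∀ z ∈ connectedComponentIn (region p \ segment ℝ (p i) b) (p j),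
        z ∉ cutCell p d x₁ i j ∨ x < cross d z → G z = c₁ := by
  classical
  obtain ⟨G, c₁, c₂, hne, hGc, hGi, hG1, hG2⟩ := D.exists_separation h0 h1
  set K := cutCell p d x₁ i j with hK
  refine ⟨G, c₁, c₂, hne, fun C hC hCR z hz z' hz' =>
    eq_of_isPreconnected_of_int hC hCR hGc hGi hz hz', ?_, ?_⟩
  · have hlt : ∀ᶠ z in 𝓝 (p i), cross d z < x :=
      (continuous_cross d).continuousAt.eventually (gt_mem_nhds h0)
    have hfr := D.frequently_edgePoint.and_eventually hlt
    have hcl : p i ∈ closure (K ∩ {z | cross d z < x}) :=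
      mem_closure_iff_frequently.2 (hfr.mono fun z hz => ⟨hz.1.1, hz.2⟩)
    obtain ⟨u, ⟨hu1, -⟩, hu2⟩ := hfr.exists
    have hpre : IsPreconnected (insert (p i) (K ∩ {z | cross d z < x})) :=
      (D.convex_cell.inter (convex_cross_neg d x)).isPreconnected.subset_closure
        (subset_insert _ _) (insert_subset hcl subset_closure)
    rw [← hG2 u hu1 hu2]
    refine eq_of_isPreconnected_of_int hpre ?_ hGc hGi (mem_insert _ _) (Or.inr ⟨hu1, hu2⟩)
    rintro z (rfl | hz)
    · exact ⟨vertex_mem_region i, fun h => h0.ne h.2⟩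
    · exact ⟨(D.cell_subset hz.1).1, fun h => (hz.2 : cross d z < x).ne h.2⟩
  · set R := region p \ segment ℝ (p i) b with hR
    let f : Plane → ℝ := fun z => if z ∈ K ∧ cross d z ≤ x then c₁ else G z
    have hfK : ∀ z ∈ K, f z = c₁ := by
      intro z hz
      by_cases hx : cross d z ≤ x
      · simp [f, hz, hx]
      · simp [f, hx, hG1 z hz (not_le.1 hx)]
    have hf : ContinuousOn f R := by
      intro z hz
      by_cases hzK : z ∈ K
      · refine (continuousWithinAt_const (b := (c₁ : ℝ))).congr_of_eventuallyEq ?_ (hfK z hzK)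
        filter_upwards [nhdsWithin_le_nhds (D.eventually_mem_cell hzK), self_mem_nhdsWithin]
          with y hy hyR using hfK y (hy hyR.1)
      -- Limits of the lower part of the cell lie in the cell or on the cut, so `f` agrees with `G`
      -- near `z`.
      · have hncl : z ∉ closure (K ∩ {y | cross d y ≤ x}) := by
          intro hcl
          have hzcl := closure_mono inter_subset_left hcl
          have hzx : cross d z ≤ x := closure_minimal (fun y hy => hy.2)
            (isClosed_le (continuous_cross d) continuous_const) hcl
          rcases (D.cross_closure hzcl).eq_or_lt with h2 | h2
          · exact hz.2 (hb ▸ ⟨hzcl, h2.symm⟩)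
          · exact hzK (D.mem_cell_of_mem_closure hzcl ⟨hz.1, h2, hzx.trans_lt h1⟩)
        have hGz : ContinuousWithinAt G R z := by
          have hd : z ∈ region p \ (K ∩ {z | cross d z = x}) := ⟨hz.1, fun h => hzK h.1⟩
          refine (hGc z hd).mono_of_mem_nhdsWithin ?_
          filter_upwards [self_mem_nhdsWithin, nhdsWithin_le_nhds
            (isClosed_closure.isOpen_compl.mem_nhds hncl)] with y hy1 hy2
          exact ⟨hy1.1, fun h => hy2 (subset_closure ⟨h.1, (h.2 : cross d y = x).le⟩)⟩
        refine hGz.congr_of_eventuallyEq ?_ (by simp [f, hzK])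
        filter_upwards [nhdsWithin_le_nhds (isClosed_closure.isOpen_compl.mem_nhds hncl)]
          with y hy
        have : ¬ (y ∈ K ∧ cross d y ≤ x) := fun h => hy (subset_closure h)
        simp [f, this]
    have hfi : ∀ z ∈ R, ∃ m : ℤ, f z = m := by
      intro z hz
      by_cases hzK : z ∈ K
      · exact ⟨c₁, hfK z hzK⟩
      · obtain ⟨m, hm⟩ := hGi z ⟨hz.1, fun h => hzK h.1⟩
        exact ⟨m, by simp [f, hzK, hm]⟩
    intro z hz hzx
    have hu := D.edgePoint_mem_cell D.mid_mem.1 D.mid_mem.2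
    have := eq_of_isPreconnected_of_int isPreconnected_connectedComponentIn
      (connectedComponentIn_subset R (p j)) hf hfi hz (D.cell_subset_pocket hb hu)
    rw [hfK _ hu] at this
    rw [← this]
    have hno : ¬ (z ∈ K ∧ cross d z ≤ x) := by
      rintro ⟨h2, h3⟩
      rcases hzx with hzx | hzx
      · exact hzx h2
      · exact absurd h3 (not_le.2 hzx)
    simp [f, hno]

/-- A connected set through the vertex on the negative side does not meet the pocket. -/
lemma not_mem_pocket (D : IsCut p d x₁ i k j k' j')
    (hb : closure (cutCell p d x₁ i j) ∩ {z | cross d z = cross d (p i)} = segment ℝ (p i) b)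
    {C : Set Plane} (hC : IsPreconnected C) (hCR : C ⊆ region p) (hi : p i ∈ C)
    (hX : ∀ z ∈ C, cross d z ≤ cross d (p i)) {z : Plane} (hz : z ∈ C) :
    z ∉ connectedComponentIn (region p \ segment ℝ (p i) b) (p j) := by
  intro hzQ
  obtain ⟨G, c₁, c₂, hne, hG, hGi, hGQ⟩ :=
    D.exists_pocket_separation hb D.mid_mem.1 D.mid_mem.2
  have h1 := hGQ z hzQ (Or.inl fun hzK => absurd (hX z hz) (not_le.2 (D.cell_subset hzK).2.1))
  have h2 := hG C hC (fun y hy => ⟨hCR hy, fun h =>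
    absurd (hX y hy) (not_le.2 (D.cell_subset h.1).2.1)⟩) z hz _ hi
  rw [h1, hGi] at h2
  exact hne (by exact_mod_cast h2)

lemma isPreconnected_chord (v : Plane) : IsPreconnected (parallelChord p d v) :=
  isPreconnected_connectedComponentIn

lemma vertex_mem_chord (i : Fin n) : p i ∈ parallelChord p d (p i) :=
  mem_connectedComponentIn ⟨vertex_mem_region i, rfl⟩

lemma chord_not_mem_pocket (D : IsCut p d x₁ i k j k' j')
    (hb : closure (cutCell p d x₁ i j) ∩ {z | cross d z = cross d (p i)} = segment ℝ (p i) b)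
    {z : Plane} (hz : z ∈ parallelChord p d (p i)) :
    z ∉ connectedComponentIn (region p \ segment ℝ (p i) b) (p j) :=
  D.not_mem_pocket hb (isPreconnected_chord _) (fun _ h => (parallelChord_subset h).1)
    (vertex_mem_chord i) (fun _ h => (parallelChord_subset h).2.le) hz

lemma target_mem (D : IsCut p d x₁ i k j k' j')
    (hb : closure (cutCell p d x₁ i j) ∩ {z | cross d z = cross d (p i)} = segment ℝ (p i) b) :
    p j ∈ region p \ segment ℝ (p i) b :=
  ⟨vertex_mem_region j, fun h => D.lt.ne' (D.cross_of_mem_cut hb h)⟩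

/-- Cutting along the chord or along the cut yields the same pocket. -/
lemma pocket_eq (D : IsCut p d x₁ i k j k' j')
    (hb : closure (cutCell p d x₁ i j) ∩ {z | cross d z = cross d (p i)} = segment ℝ (p i) b) :
    connectedComponentIn (region p \ parallelChord p d (p i)) (p j) =
      connectedComponentIn (region p \ segment ℝ (p i) b) (p j) := by
  refine subset_antisymm
    (connectedComponentIn_mono _ (sdiff_subset_sdiff_right (D.cut_subset_chord hb))) ?_
  refine isPreconnected_connectedComponentIn.subset_connectedComponentIn
    (mem_connectedComponentIn (D.target_mem hb)) fun z hz => ?_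
  exact ⟨(connectedComponentIn_subset _ _ hz).1, fun h => D.chord_not_mem_pocket hb h hz⟩

/-- The cut is the part of the chord that bounds the pocket. -/
lemma chord_inter_closure (D : IsCut p d x₁ i k j k' j')
    (hb : closure (cutCell p d x₁ i j) ∩ {z | cross d z = cross d (p i)} = segment ℝ (p i) b) :
    parallelChord p d (p i) ∩
      closure (connectedComponentIn (region p \ segment ℝ (p i) b) (p j)) = segment ℝ (p i) b := by
  refine subset_antisymm (fun z hz => ?_) (fun z hz => ⟨D.cut_subset_chord hb hz, ?_⟩)
  · by_contra hzc
    -- A point of the chord that is a limit of the pocket but not on the cut would itself belong to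
    -- the pocket.
    have hpre : IsPreconnected
        (insert z (connectedComponentIn (region p \ segment ℝ (p i) b) (p j))) :=
      isPreconnected_connectedComponentIn.subset_closure (subset_insert _ _)
        (insert_subset hz.2 subset_closure)
    refine D.chord_not_mem_pocket hb hz.1 (hpre.subset_connectedComponentIn
      (Or.inr (mem_connectedComponentIn (D.target_mem hb))) ?_ (mem_insert _ _))
    exact insert_subset ⟨(parallelChord_subset hz.1).1, hzc⟩ (connectedComponentIn_subset _ _)
  · rw [← hb] at hz
    exact closure_mono (D.cell_subset_pocket hb) hz.1

/-- The pocket does not contain points next to the cut on its negative side. -/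
lemma not_eventually_mem_pocket (D : IsCut p d x₁ i k j k' j')
    (hb : closure (cutCell p d x₁ i j) ∩ {z | cross d z = cross d (p i)} = segment ℝ (p i) b)
    {x N : Plane} (hx : x ∈ segment ℝ (p i) b) (hN : cross d N < 0)
    (hev : ∀ᶠ ε : ℝ in 𝓝[>] 0,
      x + ε • N ∈ connectedComponentIn (region p \ segment ℝ (p i) b) (p j)) : False := by
  obtain ⟨δ, hδ, hsub⟩ := mem_nhdsGT_iff_exists_Ioo_subset.1 hev
  have hδ : 0 < δ := hδ
  have hxr : x ∈ (fun ε : ℝ => x + ε • N) '' Ico 0 δ := ⟨0, ⟨le_rfl, hδ⟩, by simp⟩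
  have hxX := D.cross_of_mem_cut hb hx
  -- The chord together with the short ray is connected, contains the vertex and stays at or below
  -- its level.
  refine D.not_mem_pocket hb ((isPreconnected_chord (p := p) (d := d) (p i)).union x
    (D.cut_subset_chord hb hx) hxr (isPreconnected_ray x N δ)) ?_
    (Or.inl (vertex_mem_chord i)) ?_ (z := x + (δ / 2) • N)
    (Or.inr ⟨δ / 2, ⟨by positivity, by linarith⟩, rfl⟩) (hsub ⟨by positivity, by linarith⟩)
  · rintro z (hz | ⟨ε, hε, rfl⟩)
    · exact (parallelChord_subset hz).1
    · rcases hε.1.eq_or_lt with h0 | h0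
      · simp only [← h0, zero_smul, add_zero]
        exact D.cut_subset_region hb hx
      · exact (connectedComponentIn_subset _ _ (hsub ⟨h0, hε.2⟩)).1
  · rintro z (hz | ⟨ε, hε, rfl⟩)
    · exact (parallelChord_subset hz).2.le
    · simp only [cross_add_right, cross_smul_right]
      have := mul_nonneg hε.1 (neg_nonneg.2 hN.le)
      linarith

/-- Near an interior point of the cut, the cell contains the positive side. -/
lemma eventually_mem_cell_of_inside (D : IsCut p d x₁ i k j k' j') {w : Plane}
    (hw : w ∈ closure (cutCell p d x₁ i j)) (hwX : cross d w = cross d (p i))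
    (hwi : w ∈ inside p) :
    ∀ᶠ z in 𝓝 w, cross d (p i) < cross d z → z ∈ cutCell p d x₁ i j := by
  have hlt : ∀ᶠ z in 𝓝 w, cross d z < x₁ :=
    (continuous_cross d).continuousAt.eventually (gt_mem_nhds (hwX ▸ D.lt_level))
  obtain ⟨r, hr, hball⟩ := Metric.eventually_nhds_iff_ball.1
    ((isOpen_inside.eventually_mem hwi).and hlt)
  obtain ⟨u, hu1, hu2⟩ := ((mem_closure_iff_frequently.1 hw).and_eventually
    (Metric.ball_mem_nhds w hr)).exists
  have hsub := subset_cell (p := p) (C := Metric.ball w r ∩ slab d (cross d (p i)) x₁)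
    (z := edgePoint p d i j ((cross d (p i) + x₁) / 2))
    ((convex_ball _ r).inter (convex_slab _ _ _)).isPreconnected
    (fun z hz => ⟨inside_subset_region (hball z hz.1).1, hz.2⟩)
    ⟨u, ⟨hu2, (D.cell_subset hu1).2⟩, hu1⟩
  filter_upwards [Metric.ball_mem_nhds _ hr] with z hz h1
  exact hsub ⟨hz, h1, (hball z hz).2⟩

lemma eventually_mem_cut (D : IsCut p d x₁ i k j k' j')
    (hb : closure (cutCell p d x₁ i j) ∩ {z | cross d z = cross d (p i)} = segment ℝ (p i) b)
    {w : Plane} (hw : w ∈ segment ℝ (p i) b) (hwi : w ∈ inside p) :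
    ∀ᶠ z in 𝓝 w, cross d z = cross d (p i) → z ∈ segment ℝ (p i) b := by
  have hw' := hw
  rw [← hb] at hw'
  filter_upwards [(D.eventually_mem_cell_of_inside hw'.1 hw'.2 hwi).eventually_nhds] with z hz hzX
  rw [← hb]
  exact ⟨mem_closure_of_eventually D.exists_pos hzX.ge hz, hzX⟩

/-- At a point in the inside the cut extends in both directions along its line, which fails at an
endpoint. -/
lemma mem_openSegment_of_inside (D : IsCut p d x₁ i k j k' j')
    (hb : closure (cutCell p d x₁ i j) ∩ {z | cross d z = cross d (p i)} = segment ℝ (p i) b)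
    (hsb : 0 < side p k b) {w : Plane} (hw : w ∈ segment ℝ (p i) b) (hwi : w ∈ inside p) :
    w ∈ openSegment ℝ (p i) b := by
  refine mem_openSegment_of_ne_left_right ?_ ?_ hw
  · rintro rfl
    exact hwi.1 (mem_boundary_iff.2 ⟨i, left_mem_segment _ _ _⟩)
  · rintro rfl
    have hbX := D.cross_of_mem_cut hb hw
    obtain ⟨ε, h1, h2⟩ := (((tendsto_add_smul b (b - p i)).eventually
      (D.eventually_mem_cut hb hw hwi)).and self_mem_nhdsWithin).exists
    have h2 : 0 < ε := h2
    obtain ⟨t, -, ht1, ht⟩ := mem_segment_iff_exists.1 (h1 (by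
      rw [cross_add_right, cross_smul_right, cross_sub_right, hbX]; ring))
    have := congrArg (side p k) ht
    rw [side_segment, D.corner.side_self, side_eq p k _ b, add_sub_cancel_left, cross_smul_right,
      side_eq p k b (p i), D.corner.side_self] at this
    rw [side_eq p k b (p i), D.corner.side_self, zero_add] at hsb
    nlinarith

lemma exists_inside_mem_cell (D : IsCut p d x₁ i k j k' j') :
    ∃ u ∈ cutCell p d x₁ i j, u ∈ inside p := by
  have hu := D.edgePoint_mem_cell D.mid_mem.1 D.mid_mem.2
  have huo := D.edgePoint_mem D.mid_mem.1 D.mid_mem.2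
  have hus := D.side_edge (openSegment_subset_segment ℝ _ _ huo)
  obtain ⟨z, h1, h2, h3⟩ := ((D.simple.frequently_side one_ne_zero hus).and_eventually
    ((D.eventually_mem_cell hu).and
      (D.simple.eventually_edge D.ccw (D.corner.openSegment_eq ▸ huo)))).exists
  rw [one_mul] at h1
  exact ⟨z, h2 (h3.1.2 h1.le), h3.2 h1⟩

/-- Every point outside of the pocket is connected to the negative side of the cut. -/
lemma exists_mem_component (D : IsCut p d x₁ i k j k' j')
    (hb : closure (cutCell p d x₁ i j) ∩ {z | cross d z = cross d (p i)} = segment ℝ (p i) b)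
    (hsb : 0 < side p k b) {t : Plane} (ht : t ∈ region p \ segment ℝ (p i) b)
    (htQ : t ∉ connectedComponentIn (region p \ segment ℝ (p i) b) (p j)) :
    ∃ x ∈ openSegment ℝ (p i) b, ∀ N : Plane, cross d N < 0 → ∀ᶠ ε : ℝ in 𝓝[>] 0,
      x + ε • N ∈ connectedComponentIn (region p \ segment ℝ (p i) b) t := by
  set R := region p \ segment ℝ (p i) b with hR
  set Z := connectedComponentIn R t with hZ
  have hZpre : IsPreconnected Z := isPreconnected_connectedComponentIn
  have hZR : Z ⊆ R := connectedComponentIn_subset _ _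
  have hZsub : ∀ C, IsPreconnected C → C ⊆ R → (C ∩ Z).Nonempty → C ⊆ Z := by
    rintro C hC hCR ⟨y, hy, hyZ⟩
    rw [hZ, connectedComponentIn_eq hyZ]
    exact hC.subset_connectedComponentIn hy hCR
  have hZK : ∀ z ∈ cutCell p d x₁ i j, z ∉ Z := by
    intro z hz hzZ
    apply htQ
    rw [connectedComponentIn_eq (D.cell_subset_pocket hb hz), ← connectedComponentIn_eq hzZ]
    exact mem_connectedComponentIn ht
  -- Passing from `t` to a point of the inside makes the connectedness of the inside available.
  have hin : ∃ t' ∈ Z, t' ∈ inside p := by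
    obtain ⟨w, hw⟩ := D.simple.exists_inside_access D.ccw ht.1
    have hc : ∀ᶠ ε : ℝ in 𝓝[>] 0, t + ε • w ∉ segment ℝ (p i) b :=
      (tendsto_add_smul t w).eventually ((isClosed_segment _ _).isOpen_compl.mem_nhds ht.2)
    obtain ⟨δ, hδ, hsub⟩ := mem_nhdsGT_iff_exists_Ioo_subset.1 (hw.and hc)
    have hδ : 0 < δ := hδ
    have hray : (fun ε : ℝ => t + ε • w) '' Ico 0 δ ⊆ Z := by
      refine hZsub _ (isPreconnected_ray t w δ) ?_
        ⟨t, ⟨0, ⟨le_rfl, hδ⟩, by simp⟩, mem_connectedComponentIn ht⟩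
      rintro _ ⟨ε, hε, rfl⟩
      rcases hε.1.eq_or_lt with h0 | h0
      · simp only [← h0, zero_smul, add_zero]; exact ht
      · have := hsub ⟨h0, hε.2⟩
        exact ⟨inside_subset_region this.1, this.2⟩
    exact ⟨_, hray ⟨δ / 2, ⟨by positivity, by linarith⟩, rfl⟩,
      (hsub ⟨by positivity, by linarith⟩).1⟩
  obtain ⟨t', ht'Z, ht'i⟩ := hin
  obtain ⟨u, huK, hui⟩ := D.exists_inside_mem_cell
  -- Off the cut, membership in `Z` is locally constant on the inside. Since `t'` is in `Z` and `u`
  -- is not, `Z` accumulates at a point of the cut in the inside.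
  have hw : ∃ w ∈ segment ℝ (p i) b, w ∈ inside p ∧ ∃ᶠ z in 𝓝 w, z ∈ Z := by
    by_contra! hcon
    refine hZK u huK ((iff_of_isPreconnected (D.simple.isPreconnected_inside D.ccw)
      (fun z => z ∈ Z) (fun x hx => ?_) ht'i hui).1 ht'Z)
    by_cases hxc : x ∈ segment ℝ (p i) b
    · filter_upwards [hcon x hxc hx] with y hy _
      simp only [hy, iff_false]
      exact fun h => (hZR h).2 hxc
    · obtain ⟨r, hr, hball⟩ := Metric.eventually_nhds_iff_ball.1
        ((isOpen_inside.eventually_mem hx).and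
          ((isClosed_segment (p i) b).isOpen_compl.eventually_mem hxc))
      have hbR : Metric.ball x r ⊆ R := fun y hy =>
        ⟨inside_subset_region (hball y hy).1, (hball y hy).2⟩
      have hpre := (convex_ball x r).isPreconnected
      filter_upwards [Metric.ball_mem_nhds x hr] with y hy _
      constructor
      · exact fun h => hZsub _ hpre hbR ⟨x, Metric.mem_ball_self hr, h⟩ hy
      · exact fun h => hZsub _ hpre hbR ⟨y, hy, h⟩ (Metric.mem_ball_self hr)
  obtain ⟨w, hwc, hwi, hfr⟩ := hw
  have hwX := D.cross_of_mem_cut hb hwc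
  have hwcl : w ∈ closure (cutCell p d x₁ i j) := by
    have := hwc; rw [← hb] at this; exact this.1
  refine ⟨w, D.mem_openSegment_of_inside hb hsb hwc hwi, fun N hN => ?_⟩
  obtain ⟨r, hr, hball⟩ := Metric.eventually_nhds_iff_ball.1
    ((isOpen_inside.eventually_mem hwi).and ((D.eventually_mem_cell_of_inside hwcl hwX hwi).and
      (D.eventually_mem_cut hb hwc hwi)))
  -- Near `w`, points at the level of the cut are on the cut and points above it are in the cell, so
  -- `Z` can only come from below.
  have hhalf : Metric.ball w r ∩ {z | cross d z < cross d (p i)} ⊆ Z := by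
    refine hZsub _ ((convex_ball w r).inter (convex_cross_neg d _)).isPreconnected ?_ ?_
    · rintro z ⟨hz1, hz2⟩
      exact ⟨inside_subset_region (hball z hz1).1, fun h =>
        (hz2 : cross d z < cross d (p i)).ne (D.cross_of_mem_cut hb h)⟩
    · obtain ⟨z, hzZ, hzr⟩ := (hfr.and_eventually (Metric.ball_mem_nhds w hr)).exists
      refine ⟨z, ⟨hzr, ?_⟩, hzZ⟩
      obtain ⟨-, h2, h3⟩ := hball z hzr
      rcases lt_trichotomy (cross d z) (cross d (p i)) with h | h | h
      · exact h
      · exact absurd (h3 h) (hZR hzZ).2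
      · exact absurd hzZ (hZK z (h2 h))
  filter_upwards [(tendsto_add_smul w N).eventually (Metric.ball_mem_nhds w hr),
    self_mem_nhdsWithin] with ε h1 h2
  refine hhalf ⟨h1, ?_⟩
  have h2 : 0 < ε := h2
  simp only [mem_ofPred_eq, cross_add_right, cross_smul_right, hwX]
  have := mul_neg_of_pos_of_neg h2 hN
  linarith

/-- The cells next to the two edges at the vertex are different. -/
lemma disjoint_cells (D : IsCut p d x₁ i k j k' j') {z : Plane}
    (hz : z ∈ cutCell p d x₁ i j) : z ∉ cutCell p d x₁ i j' := by
  intro hz'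
  have hsub : cutCell p d x₁ i j' ⊆ cutCell p d x₁ i j :=
    subset_cell isPreconnected_cell D.swap.cell_subset ⟨z, hz', hz⟩
  -- If the cells agreed, convexity would put into the polygon the midpoint of the two edge points
  -- at level `x`. It tends to the vertex, yet lies on the outer side of both edges.
  have hlim : Tendsto (fun x => (1 / 2 : ℝ) • edgePoint p d i j x
      + (1 / 2 : ℝ) • edgePoint p d i j' x) (𝓝[>] (cross d (p i))) (𝓝 (p i)) := by
    have := (D.tendsto_edgePoint.const_smul (1 / 2 : ℝ)).add
      (D.swap.tendsto_edgePoint.const_smul (1 / 2 : ℝ))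
    rwa [← add_smul, add_halves, one_smul] at this
  obtain ⟨x, hx, hx0, hx1⟩ := ((hlim.eventually
    (D.corner.eventually_reflex D.simple D.ccw D.reflex)).and
    (Ioo_mem_nhdsGT D.lt_level)).exists
  have hm := D.convex_cell (D.edgePoint_mem_cell hx0 hx1)
    (hsub (D.swap.edgePoint_mem_cell hx0 hx1)) (by norm_num : (0 : ℝ) ≤ 1 / 2)
    (by norm_num : (0 : ℝ) ≤ 1 / 2) (by norm_num)
  have heq : (1 / 2 : ℝ) • edgePoint p d i j x + (1 / 2 : ℝ) • edgePoint p d i j' x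
      = edgePoint p d i j x + (1 / 2 : ℝ) • (edgePoint p d i j' x - edgePoint p d i j x) := by
    module
  have hs : ∀ {k j k' j'} (D : IsCut p d x₁ i k j k' j'),
      side p k (edgePoint p d i j x) = 0 ∧ side p k (edgePoint p d i j' x) < 0 := by
    intro k j k' j' D
    constructor
    · exact D.side_edge (openSegment_subset_segment ℝ _ _ (D.edgePoint_mem hx0 hx1))
    · rw [edgePoint, side_segment, D.corner.side_self, D.corner.side_other, sub_zero, zero_add]
      exact mul_neg_of_pos_of_neg (div_pos (sub_pos.2 hx0) (sub_pos.2 D.lt')) D.turn_neg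
  have h1 := hx.1 (D.cell_subset hm).1
  rw [heq, side_segment, side_segment] at h1
  have h2 := hs D
  have h3 := hs D.swap
  rcases h1 with h1 | h1 <;> linarith [h2.1, h2.2, h3.1, h3.2]

/-- No monotone connection joins the two pockets of a colored vertex. -/
lemma false_of_monotone (D : IsCut p d x₁ i k j k' j')
    (hb : closure (cutCell p d x₁ i j) ∩ {z | cross d z = cross d (p i)} = segment ℝ (p i) b)
    {t y : Plane} (ht : t ∈ connectedComponentIn (region p \ segment ℝ (p i) b) (p j))
    (hy : y ∈ cutCell p d x₁ i j') {Γ : Set Plane} (hΓ : IsPreconnected Γ) (hΓR : Γ ⊆ region p)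
    (hmono : ∀ x, IsPreconnected (Γ ∩ {z | cross d z = x})) (htΓ : t ∈ Γ) (hyΓ : y ∈ Γ) :
    False := by
  obtain ⟨b', -, -, hb'⟩ := D.swap.exists_cut
  have hyX := (D.swap.cell_subset hy).2
  -- The level is chosen below `y`, and below `t` in case `t` lies in the cell itself, so that both
  -- sections really separate.
  obtain ⟨x, hx0, hx1, hxy, hxt⟩ : ∃ x, cross d (p i) < x ∧ x < x₁ ∧ x < cross d y ∧
      (t ∉ cutCell p d x₁ i j ∨ x < cross d t) := by
    by_cases htK : t ∈ cutCell p d x₁ i j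
    · obtain ⟨x, hx0, hx1⟩ := exists_between (lt_min hyX.1 (D.cell_subset htK).2.1)
      exact ⟨x, hx0, (hx1.trans_le (min_le_left _ _)).trans hyX.2, hx1.trans_le (min_le_left _ _),
        Or.inr (hx1.trans_le (min_le_right _ _))⟩
    · obtain ⟨x, hx0, hx1⟩ := exists_between hyX.1
      exact ⟨x, hx0, hx1.trans hyX.2, hx1, Or.inl htK⟩
  -- The opposite cell is attached to the vertex without crossing the section, so `G` takes the
  -- value `c₂` of the vertex on it.
  have hvert : ∀ {k j k' j'} (D : IsCut p d x₁ i k j k' j') {z : Plane},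
      z ∈ cutCell p d x₁ i j' → IsPreconnected (insert (p i) (cutCell p d x₁ i j')) ∧
      insert (p i) (cutCell p d x₁ i j') ⊆
        region p \ (cutCell p d x₁ i j ∩ {z | cross d z = x}) := by
    intro k j k' j' D z hz
    refine ⟨isPreconnected_cell.subset_closure (subset_insert _ _)
      (insert_subset D.swap.vertex_mem_closure subset_closure), insert_subset
      ⟨vertex_mem_region i, fun h => hx0.ne h.2⟩ fun q hq =>
      ⟨(D.swap.cell_subset hq).1, fun h => D.disjoint_cells h.1 hq⟩⟩
  obtain ⟨G, c₁, c₂, hne, hG, hGi, hGQ⟩ := D.exists_pocket_separation hb hx0 hx1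
  obtain ⟨G', c₁', c₂', hne', hG', hGi', hGQ'⟩ := D.swap.exists_pocket_separation hb' hx0 hx1
  have hz1 : ∃ z ∈ Γ, z ∈ cutCell p d x₁ i j ∧ cross d z = x := by
    by_contra! hcon
    have h1 := hG Γ hΓ (fun z hz => ⟨hΓR hz, fun h => hcon z hz h.1 h.2⟩) t htΓ y hyΓ
    have h2 := hG _ (hvert D hy).1 (hvert D hy).2 y (Or.inr hy) _ (mem_insert _ _)
    rw [hGQ t ht hxt, h2, hGi] at h1
    exact hne (by exact_mod_cast h1)
  -- With a point of `Γ` in the first cell at hand, the same argument with the two edges exchanged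
  -- applies to `z₁` and `y`.
  obtain ⟨z₁, hz1Γ, hz1K, hz1X⟩ := hz1
  have hz2 : ∃ z ∈ Γ, z ∈ cutCell p d x₁ i j' ∧ cross d z = x := by
    by_contra! hcon
    have h1 := hG' Γ hΓ (fun z hz => ⟨hΓR hz, fun h => hcon z hz h.1 h.2⟩) y hyΓ z₁ hz1Γ
    have h2 := hG' _ (hvert D.swap hz1K).1 (hvert D.swap hz1K).2 z₁ (Or.inr hz1K) _
      (mem_insert _ _)
    rw [hGQ' y (D.swap.cell_subset_pocket hb' hy) (Or.inr hxy), h2, hGi'] at h1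
    exact hne' (by exact_mod_cast h1)
  obtain ⟨z₂, hz2Γ, hz2K, hz2X⟩ := hz2
  -- The points of `Γ` at level `x` form a connected set in the slab, so `z₁` and `z₂` share a cell.
  refine D.disjoint_cells (subset_cell (hmono x) ?_ ⟨z₁, ⟨hz1Γ, hz1X⟩, hz1K⟩ ⟨hz2Γ, hz2X⟩) hz2K
  rintro z ⟨hz, hzX⟩
  have hzX : cross d z = x := hzX
  exact ⟨hΓR hz, by simp only [slab, mem_ofPred_eq, hzX]; exact ⟨hx0, hx1⟩⟩

end IsCut


/-! ### Cuts and pockets -/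

lemma dir_ne_zero (θ : ℝ) : dir θ ≠ 0 := by
  intro h
  have h0 := congrArg (fun z : Plane => z 0) h
  have h1 := congrArg (fun z : Plane => z 1) h
  have h2 := Real.sin_sq_add_cos_sq θ
  simp [dir] at h0 h1
  simp [h0, h1] at h2

lemma lineThrough_eq {θ : ℝ} (hd : d = dir θ ∨ d = -dir θ) (v : Plane) :
    lineThrough θ v = {z | cross d z = cross d v} := by
  have h : ∀ z, cross d z = cross d v ↔ cross (dir θ) (z - v) = 0 := by
    intro z
    rw [cross_sub_right, sub_eq_zero]
    rcases hd with rfl | rfl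
    · rfl
    · rw [cross_neg_left, cross_neg_left, neg_inj]
  ext z
  rw [mem_ofPred_eq, h]
  constructor
  · rintro ⟨t, rfl⟩
    rw [add_sub_cancel_left, cross_smul_right, cross_self, mul_zero]
  · intro hz
    obtain ⟨t, ht⟩ := exists_smul_of_cross_eq_zero (dir_ne_zero θ) hz
    exact ⟨t, by rw [← ht]; abel⟩

lemma chord_eq {θ : ℝ} (hd : d = dir θ ∨ d = -dir θ) (i : Fin n) :
    chord p θ i = parallelChord p d (p i) := by
  rw [chord, lineThrough_eq hd, parallelChord]

lemma eq_of_segment_eq {v b c : Plane} (h : segment ℝ v b = segment ℝ v c) : b = c :=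
  (wbtw_swap_right_iff ℝ v).1 ⟨mem_segment_iff_wbtw.1 (h ▸ right_mem_segment ℝ v b),
    mem_segment_iff_wbtw.1 (h ▸ right_mem_segment ℝ v c)⟩

lemma cross_leftNormal_smul (d : Plane) (t : ℝ) :
    cross d (leftNormal (t • d)) = t * (d 0 ^ 2 + d 1 ^ 2) := by
  rw [← cross_leftNormal, ← cross_smul_right]
  congr 1
  ext i; fin_cases i <;> simp [leftNormal]

lemma exists_isCut (h : IsSimple p) (hccw : IsCounterclockwise p) {i k j k' j' : Fin n}
    (hc : IsCorner i k j k' j') (hr : IsReflex p i) (h1 : cross d (p i) < cross d (p j))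
    (h2 : cross d (p i) < cross d (p j')) : ∃ x₁, IsCut p d x₁ i k j k' j' := by
  obtain ⟨x₁, hv, hx⟩ := ((eventually_slab p d (cross d (p i))).and self_mem_nhdsWithin).exists
  exact ⟨x₁, h, hccw, hc, hr, h1, h2, hx, hv⟩

namespace IsCut

variable {i k j k' j' : Fin n} {b : Plane}

/-- The left normal of the cut points downwards. The pocket contains no points just below the cut by
`not_eventually_mem_pocket`, every other component does by `exists_mem_component`. -/
lemma leftRegion_eq (D : IsCut p d x₁ i k j k' j')
    (hb : closure (cutCell p d x₁ i j) ∩ {z | cross d z = cross d (p i)} = segment ℝ (p i) b)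
    (hsb : 0 < side p k b) {a c : Plane} (hs : segment ℝ a c = segment ℝ (p i) b)
    (ho : openSegment ℝ a c = openSegment ℝ (p i) b) (hN : cross d (leftNormal (c - a)) < 0) :
    leftRegion p a c =
      region p \ connectedComponentIn (region p \ segment ℝ (p i) b) (p j) := by
  rw [leftRegion, hs, ho]
  ext z
  constructor
  · rintro (hz | ⟨hz, x, hx, hev⟩)
    · exact ⟨D.cut_subset_region hb hz, D.chord_not_mem_pocket hb (D.cut_subset_chord hb hz)⟩
    · refine ⟨hz.1, fun hzQ => ?_⟩
      rw [← connectedComponentIn_eq hzQ] at hev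
      exact D.not_eventually_mem_pocket hb (openSegment_subset_segment ℝ _ _ hx) hN hev
  · rintro ⟨hz, hzQ⟩
    by_cases hzs : z ∈ segment ℝ (p i) b
    · exact Or.inl hzs
    · obtain ⟨x, hx, h⟩ := D.exists_mem_component hb hsb ⟨hz, hzs⟩ hzQ
      exact Or.inr ⟨⟨hz, hzs⟩, x, hx, h _ hN⟩

lemma exists_sub_eq (D : IsCut p d x₁ i k j k' j')
    (hb : closure (cutCell p d x₁ i j) ∩ {z | cross d z = cross d (p i)} = segment ℝ (p i) b) :
    ∃ t : ℝ, b = p i + t • d := by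
  have hX := D.cross_of_mem_cut hb (right_mem_segment _ _ _)
  obtain ⟨t, ht⟩ := exists_smul_of_cross_eq_zero D.direction_ne_zero (w := b - p i)
    (by rw [cross_sub_right, hX, sub_self])
  exact ⟨t, by rw [← ht]; abel⟩

/-- Since the edge climbs and `b` lies to its left, the cut runs away from the vertex in direction
`-d`; the left normal of `-d` points downwards. -/
lemma leftRegion_forward (D : IsCut p d x₁ i i (i + 1) k' j')
    (hb : closure (cutCell p d x₁ i (i + 1)) ∩ {z | cross d z = cross d (p i)} =
      segment ℝ (p i) b) (hsb : 0 < side p i b) :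
    leftRegion p (p i) b =
      region p \ connectedComponentIn (region p \ segment ℝ (p i) b) (p (i + 1)) := by
  refine D.leftRegion_eq hb hsb rfl rfl ?_
  obtain ⟨t, rfl⟩ := D.exists_sub_eq hb
  have hpos := D.exists_pos
  have hd := sq_add_sq_pos D.direction_ne_zero
  rw [add_sub_cancel_left, cross_leftNormal_smul]
  rw [side, add_sub_cancel_left, cross_smul_right, cross_swap] at hsb
  nlinarith

/-- Now the directed edge descends to the vertex and `b` is a positive multiple of `d` away from it.
Directed towards the vertex, the cut again runs along `-d`. -/
lemma leftRegion_backward (D : IsCut p d x₁ i (i - 1) (i - 1) k' j')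
    (hb : closure (cutCell p d x₁ i (i - 1)) ∩ {z | cross d z = cross d (p i)} =
      segment ℝ (p i) b) (hsb : 0 < side p (i - 1) b) :
    leftRegion p b (p i) =
      region p \ connectedComponentIn (region p \ segment ℝ (p i) b) (p (i - 1)) := by
  refine D.leftRegion_eq hb hsb (segment_symm _ _ _) (openSegment_symm _ _ _) ?_
  obtain ⟨t, rfl⟩ := D.exists_sub_eq hb
  have hpos := D.exists_pos
  have hd := sq_add_sq_pos D.direction_ne_zero
  rw [show p i - (p i + t • d) = (-t) • d by rw [neg_smul]; abel, cross_leftNormal_smul]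
  rw [side_sub_one, add_sub_cancel_left, cross_smul_right, cross_swap, cross_sub_right] at hsb
  rw [cross_sub_right] at hpos
  nlinarith

lemma chord_inter_closure_component {θ : ℝ} (hd : d = dir θ ∨ d = -dir θ)
    (D : IsCut p d x₁ i k j k' j')
    (hb : closure (cutCell p d x₁ i j) ∩ {z | cross d z = cross d (p i)} = segment ℝ (p i) b) :
    chord p θ i ∩ closure (connectedComponentIn (region p \ chord p θ i) (p j)) =
      segment ℝ (p i) b := by
  rw [chord_eq hd, D.pocket_eq hb, D.chord_inter_closure hb]

lemma isColored {θ : ℝ} (hd : d = dir θ ∨ d = -dir θ)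
    (D : IsCut p d x₁ i k j k' j') : IsColored p θ i := by
  refine ⟨D.reflex, ?_⟩
  have h1 := D.exists_pos
  have h2 := D.swap.exists_pos
  rcases hd with rfl | rfl
  · right
    rcases D.corner with ⟨-, rfl, -, rfl⟩ | ⟨-, rfl, -, rfl⟩
    exacts [⟨h2, h1⟩, ⟨h1, h2⟩]
  · left
    rw [cross_neg_left, Left.neg_pos_iff] at h1 h2
    rcases D.corner with ⟨-, rfl, -, rfl⟩ | ⟨-, rfl, -, rfl⟩
    exacts [⟨h2, h1⟩, ⟨h1, h2⟩]

/-- The points outside of a pocket are those to the left of a cut. -/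
lemma exists_isThetaCut {θ : ℝ} (hd : d = dir θ ∨ d = -dir θ) (D : IsCut p d x₁ i k j k' j')
    (hb : closure (cutCell p d x₁ i j) ∩ {z | cross d z = cross d (p i)} = segment ℝ (p i) b)
    (hsb : 0 < side p k b) : ∃ a c, IsThetaCut p θ a c ∧ leftRegion p a c =
      region p \ connectedComponentIn (region p \ segment ℝ (p i) b) (p j) := by
  have hch := D.chord_inter_closure_component hd hb
  have hcol := D.isColored hd
  rcases D.corner with ⟨rfl, rfl, -, -⟩ | ⟨rfl, rfl, -, -⟩
  · exact ⟨_, b, Or.inl ⟨_, hcol, rfl, hch.symm⟩, D.leftRegion_forward hb hsb⟩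
  · exact ⟨b, _, Or.inr ⟨_, hcol, rfl, by rw [segment_symm]; exact hch.symm⟩,
      D.leftRegion_backward hb hsb⟩

end IsCut

lemma IsColored.exists_direction {θ : ℝ} {i : Fin n} (hc : IsColored p θ i) :
    ∃ d, (d = dir θ ∨ d = -dir θ) ∧ cross d (p i) < cross d (p (i - 1)) ∧
      cross d (p i) < cross d (p (i + 1)) := by
  rcases hc.2 with h | h
  · refine ⟨_, Or.inr rfl, ?_⟩
    simp only [EdgesRight, cross_sub_right] at h
    simp only [cross_neg_left]
    constructor <;> linarith
  · refine ⟨_, Or.inl rfl, ?_⟩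
    simp only [EdgesLeft, cross_sub_right] at h
    constructor <;> linarith

lemma IsThetaCut.exists_isCut (h : IsSimple p) (hccw : IsCounterclockwise p) {θ : ℝ}
    {a c : Plane} (hac : IsThetaCut p θ a c) : ∃ (d : Plane) (x₁ : ℝ) (i k j k' j' : Fin n)
      (b : Plane), (d = dir θ ∨ d = -dir θ) ∧ IsCut p d x₁ i k j k' j' ∧
      closure (cutCell p d x₁ i j) ∩ {z | cross d z = cross d (p i)} = segment ℝ (p i) b ∧
      leftRegion p a c =
        region p \ connectedComponentIn (region p \ segment ℝ (p i) b) (p j) := by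
  rcases hac with ⟨i, hc, rfl, hs⟩ | ⟨i, hc, rfl, hs⟩
  · obtain ⟨d, hd, h1, h2⟩ := hc.exists_direction
    obtain ⟨x₁, D⟩ := WatchmanTour.exists_isCut h hccw (Or.inl ⟨rfl, rfl, rfl, rfl⟩) hc.1 h2 h1
    obtain ⟨b, -, hsb, hb⟩ := D.exists_cut
    obtain rfl := eq_of_segment_eq (hs.trans (D.chord_inter_closure_component hd hb))
    exact ⟨d, x₁, i, _, _, _, _, c, hd, D, hb, D.leftRegion_forward hb hsb⟩
  · obtain ⟨d, hd, h1, h2⟩ := hc.exists_direction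
    obtain ⟨x₁, D⟩ := WatchmanTour.exists_isCut h hccw (Or.inr ⟨rfl, rfl, rfl, rfl⟩) hc.1 h1 h2
    obtain ⟨b, -, hsb, hb⟩ := D.exists_cut
    rw [segment_symm] at hs
    obtain rfl := eq_of_segment_eq (hs.trans (D.chord_inter_closure_component hd hb))
    exact ⟨d, x₁, i, _, _, _, _, a, hd, D, hb, D.leftRegion_backward hb hsb⟩

/-- A tour that sees the whole polygon visits the left side of every cut. -/
theorem IsThetaWatchman.inter_leftRegion_nonempty (h : IsSimple p) (hccw : IsCounterclockwise p)
    {θ : ℝ} {x : Plane} {T : Path x x} (hT : range T ⊆ region p) (hw : IsThetaWatchman p θ T)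
    {a c : Plane} (hac : IsThetaCut p θ a c) : (range T ∩ leftRegion p a c).Nonempty := by
  obtain ⟨d, x₁, i, k, j, k', j', b, hd, D, hb, hL⟩ := hac.exists_isCut h hccw
  rw [hL]
  by_contra hemp
  -- The witness is a point on the other edge at the vertex, hidden from the whole pocket.
  have hyK := D.swap.edgePoint_mem_cell D.mid_mem.1 D.mid_mem.2
  obtain ⟨t, ht, γ, hγR, hγ⟩ := hw _ (D.swap.cell_subset hyK).1
  have htQ : t ∈ connectedComponentIn (region p \ segment ℝ (p i) b) (p j) := by
    by_contra htQ
    exact hemp ⟨t, ht, hT ht, htQ⟩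
  refine D.false_of_monotone hb htQ hyK (isPreconnected_range γ.continuous) hγR
    (fun x => ?_) ⟨0, γ.source⟩ ⟨1, γ.target⟩
  rcases (range γ ∩ {z | cross d z = x}).eq_empty_or_nonempty with he | ⟨z, hz, rfl⟩
  · rw [he]; exact isPreconnected_empty
  · rw [← lineThrough_eq hd]; exact hγ z


/-! ### Monotone paths -/

/-- Some path from `y` to `z` in the polygon is monotone in the level `cross d`. -/
def Climbs (p : Polygon Plane n) (d y z : Plane) : Prop :=
  ∃ γ : Path y z, range γ ⊆ region p ∧ Monotone fun t => cross d (γ t)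

lemma climbs_of_segment {y z : Plane} (h : segment ℝ y z ⊆ region p)
    (hX : cross d y ≤ cross d z) : Climbs p d y z := by
  refine ⟨Path.segment y z, by rwa [Path.range_segment], fun s t hst => ?_⟩
  simp only [Path.segment_apply, AffineMap.lineMap_apply_module', add_comm _ y, cross_segment]
  have := mul_le_mul_of_nonneg_right (Subtype.coe_le_coe.2 hst) (sub_nonneg.2 hX)
  linarith

namespace Climbs

variable {y z w : Plane}

lemma symm (h : Climbs p d y z) : Climbs p (-d) z y := by
  obtain ⟨γ, hγ, hm⟩ := h
  refine ⟨γ.symm, by rwa [Path.symm_range], fun s t hst => ?_⟩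
  simp only [cross_neg_left, Path.symm_apply]
  exact neg_le_neg (hm (unitInterval.symm_le_symm.2 hst))

lemma trans (h : Climbs p d y z) (h' : Climbs p d z w) : Climbs p d y w := by
  obtain ⟨γ, hγ, hm⟩ := h
  obtain ⟨γ', hγ', hm'⟩ := h'
  refine ⟨γ.trans γ', by rw [Path.trans_range]; exact union_subset hγ hγ', fun s t hst => ?_⟩
  have hst' : (s : ℝ) ≤ t := hst
  simp only [Path.trans_apply]
  split_ifs with h1 h2 h2
  · exact hm (Subtype.coe_le_coe.1 (by simpa using hst'))
  · refine (hm (b := 1) unitInterval.le_one').trans ?_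
    simp only [Path.target]
    conv_lhs => rw [← γ'.source]
    exact hm' unitInterval.nonneg'
  · exact absurd (hst'.trans h2) h1
  · exact hm' (Subtype.coe_le_coe.1 (by simpa using hst'))

lemma of_path {γ : Path y z} (hγ : range γ ⊆ region p) (hm : Monotone fun t => cross d (γ t))
    {s t : unitInterval} (hst : s ≤ t) : Climbs p d (γ s) (γ t) := by
  refine ⟨γ.subpath s t, ?_, fun a b hab => hm ?_⟩
  · rw [Path.range_subpath]
    exact (image_subset_range _ _).trans hγ
  · refine Subtype.coe_le_coe.1 ?_
    simp only [Icc.coe_convexComb]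
    have := mul_le_mul_of_nonneg_right (Subtype.coe_le_coe.2 hab)
      (sub_nonneg.2 (Subtype.coe_le_coe.2 hst))
    linarith

/-- The parameters at which a monotone function takes a given value form an interval. -/
lemma thetaSees {θ : ℝ} (hd : d = dir θ ∨ d = -dir θ) (h : Climbs p d y z) :
    ThetaSees p θ z y := by
  obtain ⟨γ, hγ, hm⟩ := h
  refine ⟨γ.symm, by rwa [Path.symm_range], fun a => ?_⟩
  rw [Path.symm_range, lineThrough_eq hd]
  have : range γ ∩ {z | cross d z = cross d a} = γ '' {t | cross d (γ t) = cross d a} := by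
    ext z
    constructor
    · rintro ⟨⟨t, rfl⟩, h⟩; exact ⟨t, h, rfl⟩
    · rintro ⟨t, h, rfl⟩; exact ⟨⟨t, rfl⟩, h⟩
  rw [this]
  refine IsPreconnected.image (OrdConnected.isPreconnected ⟨fun s hs t ht r hr => ?_⟩) _
    γ.continuous.continuousOn
  simp only [mem_ofPred_eq] at hs ht ⊢
  exact le_antisymm (ht ▸ hm hr.2) (hs ▸ hm hr.1)

end Climbs

/-- On a line parallel to `d`, `cross (leftNormal d)` is an injective coordinate, and its image of a
connected set is an interval. -/
lemma segment_subset_of_isPreconnected (hd : d ≠ 0) {S : Set Plane} (hS : IsPreconnected S)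
    {x : ℝ} (hX : ∀ z ∈ S, cross d z = x) {a b : Plane} (ha : a ∈ S) (hb : b ∈ S) :
    segment ℝ a b ⊆ S := by
  intro z hz
  set e := leftNormal d
  have hcon : OrdConnected (cross e '' S) :=
    (hS.image _ (continuous_cross e).continuousOn).ordConnected
  obtain ⟨t, h0, h1, rfl⟩ := mem_segment_iff_exists.1 hz
  have hmem : cross e (a + t • (b - a)) ∈ cross e '' S := by
    have ha' := mem_image_of_mem (cross e) ha
    have hb' := mem_image_of_mem (cross e) hb
    rw [cross_segment]
    rcases le_total (cross e a) (cross e b) with h | h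
    · exact hcon.out ha' hb' ⟨by nlinarith, by nlinarith⟩
    · exact hcon.out hb' ha' ⟨by nlinarith, by nlinarith⟩
  obtain ⟨s, hs, hse⟩ := hmem
  have h2 : cross d (a + t • (b - a) - s) = 0 := by
    rw [cross_sub_right, cross_segment, hX a ha, hX b hb, hX s hs]; ring
  obtain ⟨r, hr⟩ := exists_smul_of_cross_eq_zero hd h2
  have h3 : cross e (a + t • (b - a) - s) = 0 := by rw [cross_sub_right, hse, sub_self]
  rw [hr, cross_smul_right, cross_swap, cross_leftNormal] at h3
  have hr0 : r = 0 := by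
    have := sq_add_sq_pos hd
    rcases mul_eq_zero.1 h3 with h | h
    · exact h
    · linarith
  rw [hr0, zero_smul, sub_eq_zero] at hr
  rwa [hr]

/-- The part of a monotone path just above the level of one of its points. -/
lemma exists_germ {y z : Plane} {γ : Path y z} (hγ : range γ ⊆ region p)
    (hm : Monotone fun t => cross d (γ t)) {s : unitInterval} (hs : s < 1)
    (hgt : ∀ t, s < t → cross d (γ s) < cross d (γ t)) (hx : cross d (γ s) < x₁) :
    IsPreconnected (γ '' {t | s < t ∧ cross d (γ t) < x₁}) ∧
      γ '' {t | s < t ∧ cross d (γ t) < x₁} ⊆ region p ∩ slab d (cross d (γ s)) x₁ ∧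
      γ s ∈ closure (γ '' {t | s < t ∧ cross d (γ t) < x₁}) := by
  refine ⟨IsPreconnected.image (OrdConnected.isPreconnected ⟨fun a ha b hb c hc => ?_⟩) _
    γ.continuous.continuousOn, ?_, ?_⟩
  · exact ⟨ha.1.trans_le hc.1, (hm hc.2).trans_lt hb.2⟩
  · rintro _ ⟨t, ⟨h1, h2⟩, rfl⟩
    exact ⟨hγ ⟨t, rfl⟩, hgt t h1, h2⟩
  · have : (𝓝[>] s).NeBot := nhdsGT_neBot_of_exists_gt ⟨1, hs⟩
    refine mem_closure_of_tendsto (b := 𝓝[>] s) (γ.continuous.continuousAt.mono_left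
      nhdsWithin_le_nhds) ?_
    filter_upwards [self_mem_nhdsWithin, nhdsWithin_le_nhds
      (((continuous_cross d).comp γ.continuous).continuousAt.eventually (gt_mem_nhds hx))]
      with t h1 h2 using ⟨t, ⟨h1, h2⟩, rfl⟩

lemma exists_level {y z : Plane} {γ : Path y z}
    {s : unitInterval} {x : ℝ} (h0 : cross d (γ s) < x) (h1 : x < cross d z) :
    ∃ t, s < t ∧ cross d (γ t) = x := by
  have hc : Continuous fun t => cross d (γ t) := (continuous_cross d).comp γ.continuous
  obtain ⟨t, ht, rfl⟩ := intermediate_value_Icc (unitInterval.le_one' (t := s)) hc.continuousOn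
    ⟨h0.le, by simpa using h1.le⟩
  refine ⟨t, lt_of_le_of_ne ht.1 ?_, rfl⟩
  rintro rfl
  exact lt_irrefl _ h0

lemma isClosed_segment_subset {α : Type*} [TopologicalSpace α] {f g : α → Plane}
    (hf : Continuous f) (hg : Continuous g) {S : Set Plane} (hS : IsClosed S) :
    IsClosed {q | segment ℝ (f q) (g q) ⊆ S} := by
  have : {q | segment ℝ (f q) (g q) ⊆ S} =
      ⋂ t ∈ Icc (0 : ℝ) 1, {q | f q + t • (g q - f q) ∈ S} := by
    ext q
    simp only [mem_ofPred_eq, mem_iInter]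
    constructor
    · exact fun h t ht => h (mem_segment_iff_exists.2 ⟨t, ht.1, ht.2, rfl⟩)
    · intro h z hz
      obtain ⟨t, h0, h1, rfl⟩ := mem_segment_iff_exists.1 hz
      exact h t ⟨h0, h1⟩
  rw [this]
  exact isClosed_biInter fun t _ => hS.preimage (by fun_prop)

/-- The cut `v b` bounds a pocket containing `z`, and the cut is contained in `V`. -/
def InPocket (p : Polygon Plane n) (d : Plane) (V : Set Plane) (z : Plane) : Prop :=
  ∃ (x₁ : ℝ) (i k j k' j' : Fin n) (b : Plane), IsCut p d x₁ i k j k' j' ∧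
    closure (cutCell p d x₁ i j) ∩ {z | cross d z = cross d (p i)} = segment ℝ (p i) b ∧
    0 < side p k b ∧ z ∈ connectedComponentIn (region p \ segment ℝ (p i) b) (p j) ∧
    segment ℝ (p i) b ⊆ V

/-- Two ascending paths with a common origin whose ends are not related by a monotone path are
separated by a cut. -/
lemma IsSimple.climbs_or_inPocket (h : IsSimple p) (hccw : IsCounterclockwise p)
    (hθ : ∀ i : Fin n, cross d (p (i + 1) - p i) = 0 → ¬ (IsReflex p i ∧ IsReflex p (i + 1)))
    (hd : d ≠ 0) {w y z : Plane} (hy : Climbs p d w y) (hz : Climbs p d w z) :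
    Climbs p d y z ∨ Climbs p (-d) y z ∨ InPocket p d {c | Climbs p (-d) y c} z := by
  obtain ⟨β, hβ, hmβ⟩ := hy
  obtain ⟨σ, hσ, hmσ⟩ := hz
  -- Pairs of parameters at equal levels whose points are joined by a level segment in the polygon.
  -- The set is compact, and a pair with maximal sum marks where the common ascent gets stuck.
  set M : Set (unitInterval × unitInterval) := {q | cross d (σ q.1) = cross d (β q.2)} ∩
    {q | segment ℝ (σ q.1) (β q.2) ⊆ region p} with hM
  have hcβ : Continuous fun q : unitInterval × unitInterval => β q.2 :=
    β.continuous.comp continuous_snd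
  have hcσ : Continuous fun q : unitInterval × unitInterval => σ q.1 :=
    σ.continuous.comp continuous_fst
  have hMc : IsCompact M := (IsClosed.inter (isClosed_eq ((continuous_cross d).comp hcσ)
    ((continuous_cross d).comp hcβ)) (isClosed_segment_subset hcσ hcβ isClosed_region)).isCompact
  have hM0 : ((0, 0) : unitInterval × unitInterval) ∈ M := by
    refine ⟨by simp, ?_⟩
    simp only [mem_ofPred_eq, Path.source, segment_same, singleton_subset_iff]
    exact hβ ⟨0, β.source⟩
  obtain ⟨⟨t, s⟩, hts, hmax⟩ := hMc.exists_isMaxOn ⟨_, hM0⟩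
    (f := fun q : unitInterval × unitInterval => (q.1 : ℝ) + q.2) (by fun_prop)
  have hX : cross d (σ t) = cross d (β s) := hts.1
  have hseg : segment ℝ (σ t) (β s) ⊆ region p := hts.2
  have hdesc : Climbs p (-d) y (β s) := by
    have := (Climbs.of_path hβ hmβ (unitInterval.le_one' (t := s))).symm
    rwa [β.target] at this
  rcases eq_or_lt_of_le (unitInterval.le_one' (t := s)) with rfl | hs1
  · left
    rw [β.target, segment_symm] at hseg
    rw [β.target] at hX
    have := Climbs.of_path hσ hmσ (unitInterval.le_one' (t := t))
    rw [σ.target] at this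
    exact (climbs_of_segment hseg hX.ge).trans this
  right
  rcases eq_or_lt_of_le (unitInterval.le_one' (t := t)) with rfl | ht1
  · left
    rw [σ.target] at hseg hX
    rw [segment_symm] at hseg
    exact hdesc.trans (climbs_of_segment hseg (by rw [cross_neg_left, cross_neg_left, hX]))
  right
  -- Were `β` level after `s`, the level segment could be extended along it to `β s'`, against
  -- maximality.
  have hgtβ : ∀ s', s < s' → cross d (β s) < cross d (β s') := by
    intro s' hs'
    refine lt_of_le_of_ne (hmβ hs'.le) fun heq => ?_
    have hpre : IsPreconnected (segment ℝ (σ t) (β s) ∪ β '' Icc s s') :=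
      (isPreconnected_segment _ _).union (β s) (right_mem_segment _ _ _)
        ⟨s, left_mem_Icc.2 hs'.le, rfl⟩
        (isPreconnected_Icc.image _ β.continuous.continuousOn)
    have hlev : ∀ z ∈ segment ℝ (σ t) (β s) ∪ β '' Icc s s', cross d z = cross d (β s) := by
      rintro z (hz | ⟨r, hr, rfl⟩)
      · obtain ⟨r, -, -, rfl⟩ := mem_segment_iff_exists.1 hz
        rw [cross_segment, hX]; ring
      · exact le_antisymm ((hmβ hr.2).trans heq.ge) (hmβ hr.1)
    have hsub := (segment_subset_of_isPreconnected hd hpre hlev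
      (Or.inl (left_mem_segment _ _ _)) (Or.inr ⟨s', right_mem_Icc.2 hs'.le, rfl⟩)).trans
      (union_subset hseg ((image_subset_range _ _).trans hβ))
    have := hmax (show (t, s') ∈ M from ⟨hX.trans heq, hsub⟩)
    simp only [mem_ofPred_eq, add_le_add_iff_left, Subtype.coe_le_coe] at this
    exact absurd hs' (not_lt.2 this)
  have hgtσ : ∀ t', t < t' → cross d (σ t) < cross d (σ t') := by
    intro t' ht'
    refine lt_of_le_of_ne (hmσ ht'.le) fun heq => ?_
    have hpre : IsPreconnected (segment ℝ (σ t) (β s) ∪ σ '' Icc t t') :=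
      (isPreconnected_segment _ _).union (σ t) (left_mem_segment _ _ _)
        ⟨t, left_mem_Icc.2 ht'.le, rfl⟩
        (isPreconnected_Icc.image _ σ.continuous.continuousOn)
    have hlev : ∀ z ∈ segment ℝ (σ t) (β s) ∪ σ '' Icc t t', cross d z = cross d (σ t) := by
      rintro z (hz | ⟨r, hr, rfl⟩)
      · obtain ⟨r, -, -, rfl⟩ := mem_segment_iff_exists.1 hz
        rw [cross_segment, hX]; ring
      · exact le_antisymm ((hmσ hr.2).trans heq.ge) (hmσ hr.1)
    have hsub := (segment_subset_of_isPreconnected hd hpre hlev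
      (Or.inr ⟨t', right_mem_Icc.2 ht'.le, rfl⟩) (Or.inl (right_mem_segment _ _ _))).trans
      (union_subset hseg ((image_subset_range _ _).trans hσ))
    have := hmax (show (t', s) ∈ M from ⟨heq.symm.trans hX, hsub⟩)
    simp only [mem_ofPred_eq, add_le_add_iff_right, Subtype.coe_le_coe] at this
    exact absurd ht' (not_lt.2 this)
  have hy0 : cross d (σ t) < cross d y := by
    rw [hX]; simpa using hgtβ 1 hs1
  have hz0 : cross d (σ t) < cross d z := by simpa using hgtσ 1 ht1
  obtain ⟨x₁, hv, hx⟩ := ((eventually_slab p d (cross d (σ t))).and self_mem_nhdsWithin).exists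
  -- A level in the vertex-free slab that both paths still reach.
  obtain ⟨x, hx0, hx1⟩ := exists_between (lt_min (show cross d (σ t) < x₁ from hx)
    (lt_min hy0 hz0))
  obtain ⟨t', ht', hXt'⟩ := exists_level (γ := σ) hx0
    (hx1.trans_le ((min_le_right _ _).trans (min_le_right _ _)))
  obtain ⟨s', hs', hXs'⟩ := exists_level (γ := β) (hX ▸ hx0)
    (hx1.trans_le ((min_le_right _ _).trans (min_le_left _ _)))
  have hx1 : x < x₁ := hx1.trans_le (min_le_left _ _)
  obtain ⟨hA, hAS, haA⟩ := exists_germ hσ hmσ ht1 hgtσ hx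
  obtain ⟨hB, hBS, hbB⟩ := exists_germ hβ hmβ hs1 hgtβ (hX ▸ hx)
  rw [← hX] at hBS
  -- By maximality the segment between the paths at level `x` leaves the polygon. The germ of `σ`
  -- comes first, so the edge found borders the part that leads to `z`.
  obtain ⟨i, k, j, k', j', hc, hr, hXi, hj, hj', hi, u, hu, hXu, hsegu⟩ :=
    h.exists_obstacle hccw hθ hx hv hseg rfl hX.symm hA hAS haA hB hBS hbB
      ⟨t', ⟨ht', hXt' ▸ hx1⟩, rfl⟩ ⟨s', ⟨hs', hXs' ▸ hx1⟩, rfl⟩ (hXt'.trans hXs'.symm) (by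
        intro hsub
        have := hmax (show (t', s') ∈ M from ⟨hXt'.trans hXs'.symm, hsub⟩)
        simp only [mem_ofPred_eq] at this
        have h1 : (t : ℝ) < t' := ht'
        have h2 : (s : ℝ) < s' := hs'
        linarith)
  obtain ⟨x₂, D⟩ := exists_isCut h hccw hc hr (hXi ▸ hj) (hXi ▸ hj')
  obtain ⟨b, -, hsb, hb⟩ := D.exists_cut
  refine ⟨x₂, i, k, j, k', j', b, D, hb, hsb, ?_, fun c hc => ?_⟩
  -- From `p j` down the edge to `u`, across to `σ t'` and along `σ` to `z`: all of it stays above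
  -- the level of the cut.
  · have huj : segment ℝ u (p j) ⊆ segment ℝ (p i) (p j) :=
      (convex_segment _ _).segment_subset (openSegment_subset_segment ℝ _ _ hu)
        (right_mem_segment _ _ _)
    have hpre : IsPreconnected ((segment ℝ (p j) u ∪ segment ℝ u (σ t')) ∪ σ '' Ioc t 1) :=
      ((isPreconnected_segment _ _).union u (right_mem_segment _ _ _) (left_mem_segment _ _ _)
        (isPreconnected_segment _ _)).union (σ t') (Or.inr (right_mem_segment _ _ _))
        ⟨t', ⟨ht', unitInterval.le_one'⟩, rfl⟩
        (isPreconnected_Ioc.image _ σ.continuous.continuousOn)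
    refine hpre.subset_connectedComponentIn (Or.inl (Or.inl (left_mem_segment _ _ _))) ?_
      (Or.inr ⟨1, ⟨ht1, le_rfl⟩, σ.target⟩)
    have hlev : ∀ q, cross d (σ t) < cross d q → q ∉ segment ℝ (p i) b := fun q hq hqs =>
      hq.ne' ((D.cross_of_mem_cut hb hqs).trans hXi)
    have hu0 : cross d (σ t) < cross d u := by rw [hXu, hXt']; exact hx0
    have hconv := convex_cross_pos d (cross d (σ t))
    have hsegj : segment ℝ (p j) u ⊆ {q | cross d (σ t) < cross d q} :=
      hconv.segment_subset hj hu0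
    have hsegu' : segment ℝ u (σ t') ⊆ {q | cross d (σ t) < cross d q} :=
      hconv.segment_subset hu0 (hgtσ t' ht')
    rw [segment_symm] at hsegu huj
    refine union_subset (union_subset (fun q hq => ?_) (fun q hq => ?_)) ?_
    · refine ⟨D.edge_subset_region (huj hq), hlev q ?_⟩
      exact hsegj hq
    · refine ⟨hsegu hq, hlev q ?_⟩
      exact hsegu' hq
    · rintro _ ⟨r, hr, rfl⟩
      exact ⟨hσ ⟨r, rfl⟩, hlev _ (hgtσ r hr.1)⟩
  -- From `y` descend along `β` to `β s`, then move at constant level to the vertex and on along the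
  -- cut.
  · have h1 : segment ℝ (β s) (p i) ⊆ region p :=
      ((convex_segment (σ t) (β s)).segment_subset (right_mem_segment ℝ (σ t) (β s)) hi).trans hseg
    have h2 : segment ℝ (p i) c ⊆ region p := ((convex_segment (p i) b).segment_subset
      (left_mem_segment ℝ (p i) b) hc).trans (D.cut_subset_region hb)
    refine (hdesc.trans (climbs_of_segment h1 ?_)).trans (climbs_of_segment h2 ?_)
    · rw [cross_neg_left, cross_neg_left, ← hX, hXi]
    · rw [cross_neg_left, cross_neg_left, D.cross_of_mem_cut hb hc]


/-! ### Tours that visit the left sides of all cuts -/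

/-- The endpoints of monotone paths from `y`. -/
def visible (p : Polygon Plane n) (d y : Plane) : Set Plane :=
  {z | Climbs p d y z ∨ Climbs p (-d) y z}

lemma visible_neg (y : Plane) : visible p (-d) y = visible p d y := by
  ext z
  simp only [visible, neg_neg, mem_ofPred_eq, or_comm]

lemma forall_neg_of_forall
    (hθ : ∀ i : Fin n, cross d (p (i + 1) - p i) = 0 → ¬ (IsReflex p i ∧ IsReflex p (i + 1))) :
    ∀ i : Fin n, cross (-d) (p (i + 1) - p i) = 0 → ¬ (IsReflex p i ∧ IsReflex p (i + 1)) := by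
  intro i hi
  exact hθ i (by rwa [cross_neg_left, neg_eq_zero] at hi)

/-- If the segment rises, `w` is a common origin of ascending paths to `y` and to `z`; if it falls,
it continues the descent from `y`. -/
lemma IsSimple.visible_or_inPocket_of_climbs (h : IsSimple p) (hccw : IsCounterclockwise p)
    (hθ : ∀ i : Fin n, cross d (p (i + 1) - p i) = 0 → ¬ (IsReflex p i ∧ IsReflex p (i + 1)))
    (hd : d ≠ 0) {w y z : Plane} (hw : Climbs p (-d) y w) (hwz : segment ℝ w z ⊆ region p) :
    z ∈ visible p d y ∨ InPocket p d (visible p d y) z := by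
  rcases le_total (cross d w) (cross d z) with hX | hX
  · have hwy := hw.symm
    rw [neg_neg] at hwy
    rcases h.climbs_or_inPocket hccw hθ hd hwy (climbs_of_segment hwz hX) with h | h |
      ⟨x₁, i, k, j, k', j', b, D, hb, hsb, hz, hV⟩
    · exact Or.inl (Or.inl h)
    · exact Or.inl (Or.inr h)
    · exact Or.inr ⟨x₁, i, k, j, k', j', b, D, hb, hsb, hz, hV.trans fun c hc => Or.inr hc⟩
  · refine Or.inl (Or.inr (hw.trans (climbs_of_segment hwz ?_)))
    rw [cross_neg_left, cross_neg_left]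
    exact neg_le_neg hX

/-- Whatever can be reached along a segment from a visible point is visible or separated from the
visible points by a visible cut. -/
lemma IsSimple.visible_or_inPocket (h : IsSimple p) (hccw : IsCounterclockwise p)
    (hθ : ∀ i : Fin n, cross d (p (i + 1) - p i) = 0 → ¬ (IsReflex p i ∧ IsReflex p (i + 1)))
    (hd : d ≠ 0) {w y z : Plane} (hw : w ∈ visible p d y) (hwz : segment ℝ w z ⊆ region p) :
    z ∈ visible p d y ∨ InPocket p d (visible p d y) z ∨
      InPocket p (-d) (visible p d y) z := by
  rcases hw with hw | hw
  · rw [← visible_neg]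
    rw [← neg_neg d] at hw
    rcases h.visible_or_inPocket_of_climbs hccw (forall_neg_of_forall hθ) (neg_ne_zero.2 hd) hw
      hwz with h | h
    exacts [Or.inl h, Or.inr (Or.inr h)]
  · rcases h.visible_or_inPocket_of_climbs hccw hθ hd hw hwz with h | h
    exacts [Or.inl h, Or.inr (Or.inl h)]

/-- A connected set that starts in the pocket either meets the cut, hence `V`, or remains in the
pocket. -/
lemma InPocket.exists_mem_or {V : Set Plane} {w z : Plane} (hw : InPocket p d V w) {C : Set Plane}
    (hC : IsPreconnected C) (hCR : C ⊆ region p) (hwC : w ∈ C) (hzC : z ∈ C) :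
    (C ∩ V).Nonempty ∨ InPocket p d V z := by
  obtain ⟨x₁, i, k, j, k', j', b, D, hb, hsb, hwQ, hV⟩ := hw
  by_cases hCc : (C ∩ segment ℝ (p i) b).Nonempty
  · exact Or.inl (hCc.mono (inter_subset_inter_right _ hV))
  · refine Or.inr ⟨x₁, i, k, j, k', j', b, D, hb, hsb, ?_, hV⟩
    have hsub : C ⊆ region p \ segment ℝ (p i) b :=
      fun q hq => ⟨hCR hq, fun hqc => hCc ⟨q, hq, hqc⟩⟩
    rw [connectedComponentIn_eq hwQ]
    exact hC.subset_connectedComponentIn hwC hsub hzC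

/-- The alternative passes along every segment in the polygon, so it is locally constant on the
connected inside; both `y` and `x` are linked to the inside by segments. -/
lemma IsSimple.visible_or_inPocket_of_mem (h : IsSimple p) (hccw : IsCounterclockwise p)
    (hθ : ∀ i : Fin n, cross d (p (i + 1) - p i) = 0 → ¬ (IsReflex p i ∧ IsReflex p (i + 1)))
    (hd : d ≠ 0) {y x : Plane} (hy : y ∈ region p) (hx : x ∈ region p) :
    x ∈ visible p d y ∨ InPocket p d (visible p d y) x ∨
      InPocket p (-d) (visible p d y) x := by
  set Q : Plane → Prop := fun z => z ∈ visible p d y ∨ InPocket p d (visible p d y) z ∨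
      InPocket p (-d) (visible p d y) z with hQ
  have step : ∀ w z, segment ℝ w z ⊆ region p → Q w → Q z := by
    intro w z hwz hw
    -- If the segment meets a visible point, start again from there with the rest of the segment.
    have key : (segment ℝ w z ∩ visible p d y).Nonempty → Q z := by
      rintro ⟨q, hq, hqV⟩
      exact h.visible_or_inPocket hccw hθ hd hqV (((convex_segment w z).segment_subset hq
        (right_mem_segment ℝ w z)).trans hwz)
    rcases hw with hw | hw | hw
    · exact h.visible_or_inPocket hccw hθ hd hw hwz
    · rcases hw.exists_mem_or (isPreconnected_segment w z) hwz (left_mem_segment ℝ w z)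
        (right_mem_segment ℝ w z) with h1 | h1
      exacts [key h1, Or.inr (Or.inl h1)]
    · rcases hw.exists_mem_or (isPreconnected_segment w z) hwz (left_mem_segment ℝ w z)
        (right_mem_segment ℝ w z) with h1 | h1
      exacts [key h1, Or.inr (Or.inr h1)]
  have access : ∀ t ∈ region p, ∃ z ∈ inside p, segment ℝ t z ⊆ region p := by
    intro t ht
    obtain ⟨w, hw⟩ := h.exists_inside_access hccw ht
    obtain ⟨δ, hδ, hsub⟩ := mem_nhdsGT_iff_exists_Ioc_subset.1 hw
    have hδ : 0 < δ := hδ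
    refine ⟨t + δ • w, hsub ⟨hδ, le_rfl⟩, fun q hq => ?_⟩
    obtain ⟨r, h0, h1, rfl⟩ := mem_segment_iff_exists.1 hq
    rw [add_sub_cancel_left, smul_smul]
    rcases h0.eq_or_lt with rfl | h0
    · simpa using ht
    · exact inside_subset_region (hsub ⟨by positivity, by nlinarith⟩)
  obtain ⟨y', hy', hyy'⟩ := access y hy
  obtain ⟨x', hx', hxx'⟩ := access x hx
  refine step x' x (segment_symm ℝ x x' ▸ hxx') ((iff_of_isPreconnected
    (h.isPreconnected_inside hccw) Q (fun a ha => ?_) hy' hx').1 (step y y' hyy' (Or.inl (Or.inl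
      (climbs_of_segment (by simpa using hy) le_rfl)))))
  obtain ⟨r, hr, hball⟩ := Metric.isOpen_iff.1 isOpen_inside a ha
  filter_upwards [Metric.ball_mem_nhds a hr] with b hb _
  have hsub : ∀ u ∈ Metric.ball a r, ∀ v ∈ Metric.ball a r, segment ℝ u v ⊆ region p :=
    fun u hu v hv => ((convex_ball a r).segment_subset hu hv).trans
      (hball.trans inside_subset_region)
  have ha' := Metric.mem_ball_self (x := a) hr
  exact ⟨step a b (hsub a ha' b hb), step b a (hsub b hb a ha')⟩

/-- A tour that visits the left side of every cut sees the whole polygon. -/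
theorem IsSimple.isThetaWatchman (h : IsSimple p) (hccw : IsCounterclockwise p) {θ : ℝ}
    (hθ : ∀ i : Fin n, cross (dir θ) (p (i + 1) - p i) = 0 →
      ¬ (IsReflex p i ∧ IsReflex p (i + 1)))
    {x : Plane} {T : Path x x} (hT : range T ⊆ region p)
    (hcut : ∀ a b, IsThetaCut p θ a b → (range T ∩ leftRegion p a b).Nonempty) :
    IsThetaWatchman p θ T := by
  intro y hy
  have hsees : (range T ∩ visible p (dir θ) y).Nonempty → ∃ x ∈ range T, ThetaSees p θ x y := by
    rintro ⟨t, ht, hV | hV⟩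
    · exact ⟨t, ht, hV.thetaSees (Or.inl rfl)⟩
    · exact ⟨t, ht, hV.thetaSees (Or.inr rfl)⟩
  refine hsees ?_
  have hxT : x ∈ range T := ⟨0, T.source⟩
  -- The tour starts in the pocket and visits the left region, which is the complement of the
  -- pocket. Being connected, it meets the cut, and the cut is visible from `y`.
  have hpocket : ∀ d, (d = dir θ ∨ d = -dir θ) → InPocket p d (visible p (dir θ) y) x →
      (range T ∩ visible p (dir θ) y).Nonempty := by
    rintro d hd ⟨x₁, i, k, j, k', j', b, D, hb, hsb, hxQ, hV⟩
    obtain ⟨a, c, hac, hL⟩ := D.exists_isThetaCut hd hb hsb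
    obtain ⟨t, htT, htL⟩ := hcut a c hac
    rw [hL] at htL
    refine Nonempty.mono (inter_subset_inter_right _ hV) ?_
    by_contra hcon
    refine htL.2 ?_
    have hsub : range T ⊆ region p \ segment ℝ (p i) b :=
      fun q hq => ⟨hT hq, fun hqc => hcon ⟨q, hq, hqc⟩⟩
    rw [connectedComponentIn_eq hxQ]
    exact (isPreconnected_range T.continuous).subset_connectedComponentIn hxT hsub htT
  rcases h.visible_or_inPocket_of_mem hccw hθ (dir_ne_zero θ) hy (hT hxT) with h1 | h1 | h1
  · exact ⟨x, hxT, h1⟩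
  · exact hpocket _ (Or.inl rfl) h1
  · exact hpocket _ (Or.inr rfl) h1

end WatchmanTour

theorem mainTheorem5 {n : ℕ} [NeZero n] (p : Polygon WatchmanTour.Plane n)
    (hsimple : WatchmanTour.IsSimple p) (hccw : WatchmanTour.IsCounterclockwise p) (θ : ℝ)
    (hθ : ∀ i : Fin n, WatchmanTour.cross (WatchmanTour.dir θ) (p (i + 1) - p i) = 0 →
      ¬ (WatchmanTour.IsReflex p i ∧ WatchmanTour.IsReflex p (i + 1)))
    {x₀ : WatchmanTour.Plane} (T : Path x₀ x₀)
    (hT : Set.range T ⊆ WatchmanTour.region p) :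
    WatchmanTour.IsThetaWatchman p θ T ↔
      ∀ a b : WatchmanTour.Plane, WatchmanTour.IsThetaCut p θ a b →
        (Set.range T ∩ WatchmanTour.leftRegion p a b).Nonempty :=
  ⟨fun hw _ _ hac => hw.inter_leftRegion_nonempty hsimple hccw hT hac,
    fun hcut => hsimple.isThetaWatchman hccw hθ hT hcut⟩
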